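/- **kPMF.** Given a directed graph $G=(V,E,w)$ on $n=|V|$ nodes with $m=|E|$ edges and positive integer edge capacities $w$, and an integer $k$, list (in any order) every pair of distinct nodes $u,v\in V$ whose maximum flow value from $u$ to $v$ is at most $k$, together with that value. **MAX-CNF-SAT**: given a CNF formula, output the maximum number of its clauses that one assignment can satisfy. **SETH**: for every $\varepsilon>0$ there is an integer $k\ge 3$ such that $k$SAT on $n$ variables and $m$ clauses cannot be solved in time $2^{(1-\varepsilon)n}\,\mathrm{poly}(m)$. Running times are on a word RAM, with words of $O(\log n)$ bits for graph problems on $n$ nodes and of $O(n'+\log m')$ bits for formulas with $n'$ variables and $m'$ clauses. **Theorem.** For every $\varepsilon>0$ there is a $\delta=\delta(\varepsilon)>0$ such that the following holds for every constant $c\in[0,1]$. Suppose that kPMF on graphs with $n\ge 2$ nodes, $m=O(n)$ edges, capacities in $\{1,\dots,n\}$ and threshold $k=\tilde\Theta(n^c)$ can be solved in time $O((n^2k)^{1-\varepsilon})$; that is, for all constants $A,B,d$ there is an algorithm that does so on all instances with $m\le An$ and $n^c/(B\log^d n)\le k\le B\,n^c\log^d n$, where the constant in the running time may depend on $A,B,d$.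 Then MAX-CNF-SAT on $n'$ variables and $O(n')$ clauses can be solved in time $O(2^{(1-\delta)n'})$ (that is, for every constant $A'$ there is such an algorithm for all formulas with at most $A'n'$ clauses), and in particular SETH is false. -/

import Mathlib

/-! ## The word RAM

A structured word RAM.  Words are natural numbers below `2 ^ w`.  A program uses finitely many
registers and finitely many arrays of words; array cells are addressed by register contents
(random access).  Every instruction and every evaluation of a branching condition is one step. -/

namespace WordRAM

/-- The binary operations that take one step. -/
inductive Op
  | add | sub | mul | div | mod | band | bor | bxor | shl | shr | lt | eq

/-- The value of an operation on `w`-bit words; arithmetic wraps around modulo `2 ^ w`. -/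
def Op.eval (w : ℕ) : Op → ℕ → ℕ → ℕ
  | .add, x, y => (x + y) % 2 ^ w
  | .sub, x, y => (x + (2 ^ w - y)) % 2 ^ w
  | .mul, x, y => (x * y) % 2 ^ w
  | .div, x, y => (x / y) % 2 ^ w
  | .mod, x, y => (x % y) % 2 ^ w
  | .band, x, y => (x &&& y) % 2 ^ w
  | .bor, x, y => (x ||| y) % 2 ^ w
  | .bxor, x, y => (x ^^^ y) % 2 ^ w
  | .shl, x, y => (x * 2 ^ y) % 2 ^ w
  | .shr, x, y => (x / 2 ^ y) % 2 ^ w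
  | .lt, x, y => (if x < y then 1 else 0) % 2 ^ w
  | .eq, x, y => (if x = y then 1 else 0) % 2 ^ w

/-- Programs. Registers and arrays are named by natural numbers. -/
inductive Prog
  /-- `r := c` -/
  | const (r c : ℕ)
  /-- `r := a o b` -/
  | op (o : Op) (r a b : ℕ)
  /-- `r := A[i]`, where `i` is a register -/
  | load (r A i : ℕ)
  /-- `A[i] := r`, where `i` and `r` are registers -/
  | store (A i r : ℕ)
  /-- first `p`, then `q` -/
  | seq (p q : Prog)
  /-- `if r ≠ 0 then p else q` -/
  | ite (r : ℕ) (p q : Prog)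
  /-- `while r ≠ 0 do p` -/
  | loop (r : ℕ) (p : Prog)

/-- The contents of the registers and of the arrays. -/
structure State where
  reg : ℕ → ℕ
  mem : ℕ → ℕ → ℕ

/-- Overwrite register `r`. -/
def State.setReg (s : State) (r v : ℕ) : State :=
  { s with reg := Function.update s.reg r v }

/-- Overwrite cell `i` of array `A`. -/
def State.setMem (s : State) (A i v : ℕ) : State :=
  { s with mem := Function.update s.mem A (Function.update (s.mem A) i v) }

/-- `Exec w p s t s'`: with word length `w`, the program `p` started in the state `s` halts
after exactly `t` steps in the state `s'`. -/
inductive Exec (w : ℕ) : Prog → State → ℕ → State → Prop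
  | const (r c : ℕ) (s : State) :
      Exec w (.const r c) s 1 (s.setReg r (c % 2 ^ w))
  | op (o : Op) (r a b : ℕ) (s : State) :
      Exec w (.op o r a b) s 1 (s.setReg r (o.eval w (s.reg a) (s.reg b)))
  | load (r A i : ℕ) (s : State) :
      Exec w (.load r A i) s 1 (s.setReg r (s.mem A (s.reg i)))
  | store (A i r : ℕ) (s : State) :
      Exec w (.store A i r) s 1 (s.setMem A (s.reg i) (s.reg r))
  | seq {p q : Prog} {s s₁ s₂ : State} {t₁ t₂ : ℕ} :
      Exec w p s t₁ s₁ → Exec w q s₁ t₂ s₂ → Exec w (.seq p q) s (t₁ + t₂) s₂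
  | ite_true {r : ℕ} {p q : Prog} {s s₁ : State} {t : ℕ} :
      s.reg r ≠ 0 → Exec w p s t s₁ → Exec w (.ite r p q) s (t + 1) s₁
  | ite_false {r : ℕ} {p q : Prog} {s s₁ : State} {t : ℕ} :
      s.reg r = 0 → Exec w q s t s₁ → Exec w (.ite r p q) s (t + 1) s₁
  | loop_done {r : ℕ} {p : Prog} {s : State} :
      s.reg r = 0 → Exec w (.loop r p) s 1 s
  | loop_step {r : ℕ} {p : Prog} {s s₁ s₂ : State} {t₁ t₂ : ℕ} :
      s.reg r ≠ 0 → Exec w p s t₁ s₁ → Exec w (.loop r p) s₁ t₂ s₂ →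
      Exec w (.loop r p) s (t₁ + t₂ + 1) s₂

/-- The initial state: the input words are in array `0`, everything else is zero. -/
def initial (w : ℕ) (x : List ℕ) : State where
  reg := fun _ => 0
  mem := fun A i => if A = 0 then x.getD i 0 % 2 ^ w else 0

/-- A computational problem on the instances `x : ι` with `valid x`, given to the machine as
`input x`, can be solved in time `O(T)`.  The output is what the machine leaves in array `1`.
The word length is any `w` that is at least a constant times `bits x`; the constants `κ` and `C`
do not depend on the instance. -/
def SolvableInTime {ι : Type} (valid : ι → Prop) (input : ι → List ℕ) (bits : ι → ℕ)
    (correct : ι → (ℕ → ℕ) → Prop) (T : ι → ℝ) : Prop :=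
  ∃ (P : Prog) (κ : ℕ) (C : ℝ), ∀ x : ι, valid x → ∀ w : ℕ, κ * bits x ≤ w →
    ∃ (t : ℕ) (s : State), Exec w P (initial w (input x)) t s ∧
      correct x (s.mem 1) ∧ (t : ℝ) ≤ C * T x

end WordRAM

/-! ## Maximum flow -/

/-- A simple directed graph with integer edge capacities on the node set `V`: the edges are the
pairs of nonzero capacity. -/
structure Network (V : Type) where
  cap : V → V → ℕ
  loopless : ∀ v, cap v v = 0

namespace Network

variable {V : Type} [Fintype V]

/-- `f` is a feasible flow from `s` to `t`. -/
structure IsFlow (G : Network V) (s t : V) (f : V → V → ℝ) : Prop where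
  nonneg : ∀ u v, 0 ≤ f u v
  le_cap : ∀ u v, f u v ≤ G.cap u v
  conserve : ∀ v, v ≠ s → v ≠ t → ∑ u, f u v = ∑ u, f v u

/-- The net amount of flow that leaves `s`. -/
def flowValue (s : V) (f : V → V → ℝ) : ℝ := ∑ v, f s v - ∑ v, f v s

/-- `x` is the maximum flow that can be shipped from `s` to `t`. -/
def IsMaxFlow (G : Network V) (s t : V) (x : ℝ) : Prop :=
  IsGreatest {y : ℝ | ∃ f, G.IsFlow s t f ∧ flowValue s f = y} x

end Network

/-! ## kPMF -/

/-- An instance of kPMF: a network on `n` nodes, a list of its edges (in any order), and a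
threshold `k`. -/
structure KPMFInstance where
  n : ℕ
  G : Network (Fin n)
  edges : List (Fin n × Fin n)
  nodup : edges.Nodup
  mem_edges : ∀ u v, (u, v) ∈ edges ↔ G.cap u v ≠ 0
  k : ℕ

namespace KPMFInstance

/-- The number of edges. -/
def m (x : KPMFInstance) : ℕ := x.edges.length

/-- The input words: `n`, `m`, `k`, and tail, head and capacity of every edge. -/
def input (x : KPMFInstance) : List ℕ :=
  x.n :: x.m :: x.k ::
    x.edges.flatMap fun e => [(e.1 : ℕ), (e.2 : ℕ), x.G.cap e.1 e.2]

/-- Words have `O(log n)` bits. -/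
def bits (x : KPMFInstance) : ℕ := Nat.log 2 x.n + 1

/-- The triple `(a, b, y)` occurs in the output: cell `0` holds the number of triples, and the
triples follow it. -/
def InOutput (out : ℕ → ℕ) (a b y : ℕ) : Prop :=
  ∃ i < out 0, out (3 * i + 1) = a ∧ out (3 * i + 2) = b ∧ out (3 * i + 3) = y

/-- The output lists, in any order, exactly the pairs of distinct nodes whose maximum flow is at
most `k`, each with its maximum flow value. -/
def Correct (x : KPMFInstance) (out : ℕ → ℕ) : Prop :=
  ∀ a b y : ℕ, InOutput out a b y ↔
    ∃ u v : Fin x.n, (u : ℕ) = a ∧ (v : ℕ) = b ∧ u ≠ v ∧ x.G.IsMaxFlow u v y ∧ y ≤ x.k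

/-- The instances with `n ≥ 2` nodes, at most `A * n` edges, capacities in `[n]` and
`n ^ c / (B * log ^ d n) ≤ k ≤ B * n ^ c * log ^ d n`. -/
structure InClass (c : ℝ) (A B d : ℕ) (x : KPMFInstance) : Prop where
  two_le : 2 ≤ x.n
  sparse : x.m ≤ A * x.n
  cap_le : ∀ u v, x.G.cap u v ≤ x.n
  le_k : (x.n : ℝ) ^ c ≤ B * Real.log x.n ^ d * x.k
  k_le : (x.k : ℝ) ≤ B * (x.n : ℝ) ^ c * Real.log x.n ^ d

end KPMFInstance

/-- kPMF on graphs with `n` nodes, `k = Θ̃(n ^ c)`, `m = O(n)` edges and capacities in `[n]` can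
be solved in time `O((n ^ 2 * k) ^ (1 - ε))`, whatever the constants hidden in `Θ̃(n ^ c)` and
in `m = O(n)` are. -/
def KPMFSolvable (ε c : ℝ) : Prop :=
  ∀ A B d : ℕ, WordRAM.SolvableInTime (KPMFInstance.InClass c A B d) KPMFInstance.input
    KPMFInstance.bits KPMFInstance.Correct fun x => ((x.n : ℝ) ^ 2 * x.k) ^ (1 - ε)

/-! ## Satisfiability -/

/-- A CNF formula on `n` variables: a list of clauses, each of which is a list of distinct
literals; the literal `(i, b)` is true if variable `i` has the value `b`. -/
structure CNF where
  n : ℕ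
  clauses : List (List (Fin n × Bool))
  nodup : ∀ C ∈ clauses, C.Nodup

namespace CNF

/-- The number of clauses. -/
def m (F : CNF) : ℕ := F.clauses.length

/-- The assignment `a` satisfies the clause `C`. -/
def satisfies {n : ℕ} (a : Fin n → Bool) (C : List (Fin n × Bool)) : Bool :=
  C.any fun l => a l.1 == l.2

/-- The number of clauses that `a` satisfies. -/
def numSat (F : CNF) (a : Fin F.n → Bool) : ℕ := F.clauses.countP (satisfies a)

def Satisfiable (F : CNF) : Prop := ∃ a : Fin F.n → Bool, ∀ C ∈ F.clauses, satisfies a C = true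

/-- The input words: `n`, `m`, and for every clause its length and its literals. -/
def input (F : CNF) : List ℕ :=
  F.n :: F.m ::
    F.clauses.flatMap fun C => C.length :: C.map fun l => 2 * (l.1 : ℕ) + l.2.toNat

/-- Words have `O(n + log m)` bits, so that they can count the steps of exhaustive search. -/
def bits (F : CNF) : ℕ := F.n + Nat.log 2 (F.m + 1) + 1

/-- MAX-CNF-SAT: the output is the maximum number of clauses that can be satisfied. -/
def CorrectMax (F : CNF) (out : ℕ → ℕ) : Prop := IsGreatest (Set.range F.numSat) (out 0)

/-- CNF-SAT: the output is nonzero exactly if the formula is satisfiable. -/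
def CorrectSat (F : CNF) (out : ℕ → ℕ) : Prop := out 0 ≠ 0 ↔ F.Satisfiable

/-- Every clause has at most `k` literals. -/
def IsKCNF (k : ℕ) (F : CNF) : Prop := ∀ C ∈ F.clauses, C.length ≤ k

end CNF

/-- MAX-CNF-SAT on `n` variables and `O(n)` clauses can be solved in time `O(2 ^ ((1 - δ) n))`. -/
def MaxCNFSatSolvable (δ : ℝ) : Prop :=
  ∀ A : ℕ, WordRAM.SolvableInTime (fun F : CNF => F.m ≤ A * F.n) CNF.input CNF.bits
    CNF.CorrectMax fun F => (2 : ℝ) ^ ((1 - δ) * F.n)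

/-- `k`SAT on `n` variables and `m` clauses can be solved in time `2 ^ ((1 - ε) n) * poly(m)`. -/
def KSatSolvable (k : ℕ) (ε : ℝ) : Prop :=
  ∃ e : ℕ, WordRAM.SolvableInTime (CNF.IsKCNF k) CNF.input CNF.bits CNF.CorrectSat
    fun F => (2 : ℝ) ^ ((1 - ε) * F.n) * ((F.m : ℝ) + 1) ^ e

/-- The Strong Exponential Time Hypothesis. -/
def SETH : Prop := ∀ ε : ℝ, 0 < ε → ∃ k : ℕ, 3 ≤ k ∧ ¬ KSatSolvable k ε

set_option linter.unusedSimpArgs false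

/-! ### Determinism, the length of outputs, and the case c = 0. -/

namespace WordRAM

/-! The proof is a fine-grained reduction from MAX-CNF-SAT by a split of the variables into three
blocks. Let the blocks have h, h and n' - 2h variables, let α, γ and β range over the partial
assignments of these blocks, and let K = 2^(n' - 2h) be the number of the β; h is at least n'/3, so
K ≤ 2^h. Let M be the number of clauses and u(α,β,γ) the number of clauses that none of the three
parts satisfies. The network has a source for every α and a sink for every γ and every σ < M. A
source can send one unit for every pair of a clause i and a β. Such a unit can reach a sink by way
of the node (6, i, 0) only if α, β and γ all leave i unsatisfied. Otherwise it has to overflow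
through the node (4, 0, β), whose edge towards the sinks of σ has capacity σ. Thus each β
contributes min(M, σ + u), and the maximum flow is the sum over β of min(M, σ + u(α,β,γ))
(`isMaxFlow_edgeList`: explicit paths in one direction, an explicit cut in the other). It is below
K·M exactly if some β completes α and γ to an assignment that satisfies more than σ clauses
(`inOutput_edgeList`). The largest such σ among the listed pairs determines the optimum.

For the running time, h is taken slightly above n'/(2 + c), so that K is at most 2^(hc). Isolated
nodes are added until there are N = 2^h · (8(M+1))^D nodes with D ≥ 2 and D ≥ 1/c. The padding makes
the network sparse, brings the capacities below N, and makes N^c large compared with K·M, so that a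
threshold of order N^c reveals all flows below K·M. Since N²k is 2^(h(2+c)), which is barely above
2^n', times a polynomial in M, the exponent 1 - ε saves an exponential factor
(`CNF.mul_le_nodes_rpow`, `CNF.time_le_fuel`).

The real number c is not available to the machine, so N^c cannot be computed. Instead, all powers of
two up to a sufficiently large bound are tried as thresholds. For a wrong threshold the given
program may diverge or output anything. It is therefore simulated with a limited amount of fuel
(`Prog.fueled`), and time stamps give every simulation an empty memory at no cost. Its output only
serves as a hint: the best listed pair supplies α and γ, and all K values of β are then tested by
counting satisfied clauses. The recorded value never exceeds the optimum, and the right threshold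
makes it reach the optimum (`runs_candidateProg`, `exists_succeeds`).

For c = 0 no padding helps, but then the hypothesis itself is false: a graph without edges has n² -
n pairs to be listed, which takes longer than n^(2(1-ε)). The resulting algorithm works for any
number of clauses, with a polynomial factor in M and n'. With M = O(n') this factor is absorbed by
giving up half of the saving; for kSAT the part that depends on M stays in poly(m), and comparing
the optimum with M decides satisfiability. -/

theorem Exec.deterministic {w : ℕ} {p : Prog} {s s₁ s₂ : State} {t₁ t₂ : ℕ}
    (h₁ : Exec w p s t₁ s₁) (h₂ : Exec w p s t₂ s₂) : t₁ = t₂ ∧ s₁ = s₂ := by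
  induction h₁ generalizing t₂ s₂ with
  | const r c s => cases h₂; exact ⟨rfl, rfl⟩
  | op o r a b s => cases h₂; exact ⟨rfl, rfl⟩
  | load r A i s => cases h₂; exact ⟨rfl, rfl⟩
  | store A i r s => cases h₂; exact ⟨rfl, rfl⟩
  | seq _ _ ih₁ ih₂ =>
    cases h₂ with
    | seq a b =>
      obtain ⟨rfl, rfl⟩ := ih₁ a
      obtain ⟨rfl, rfl⟩ := ih₂ b
      exact ⟨rfl, rfl⟩
  | ite_true h _ ih =>
    cases h₂ with
    | ite_true h' a => obtain ⟨rfl, rfl⟩ := ih a; exact ⟨rfl, rfl⟩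
    | ite_false h' a => exact absurd h' h
  | ite_false h _ ih =>
    cases h₂ with
    | ite_true h' a => exact absurd h h'
    | ite_false h' a => obtain ⟨rfl, rfl⟩ := ih a; exact ⟨rfl, rfl⟩
  | loop_done h =>
    cases h₂ with
    | loop_done h' => exact ⟨rfl, rfl⟩
    | loop_step h' a b => exact absurd h h'
  | loop_step h _ _ ih₁ ih₂ =>
    cases h₂ with
    | loop_done h' => exact absurd h' h
    | loop_step h' a b =>
      obtain ⟨rfl, rfl⟩ := ih₁ a
      obtain ⟨rfl, rfl⟩ := ih₂ b
      exact ⟨rfl, rfl⟩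

/-- A run of `t` steps changes at most `t` memory cells. -/
theorem Exec.exists_changed {w : ℕ} {p : Prog} {s s' : State} {t : ℕ} (h : Exec w p s t s') :
    ∃ F : Finset (ℕ × ℕ), F.card ≤ t ∧ ∀ A i, (A, i) ∉ F → s'.mem A i = s.mem A i := by
  induction h with
  | const r c s => exact ⟨∅, by simp, fun _ _ _ => rfl⟩
  | op o r a b s => exact ⟨∅, by simp, fun _ _ _ => rfl⟩
  | load r A i s => exact ⟨∅, by simp, fun _ _ _ => rfl⟩
  | store A i r s =>
    refine ⟨{(A, s.reg i)}, by simp, fun B j h => ?_⟩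
    have h' : B = A → j ≠ s.reg i := by simpa using h
    by_cases hB : B = A
    · subst hB
      simp [State.setMem, h' rfl]
    · simp [State.setMem, hB]
  | seq _ _ ih₁ ih₂ =>
    obtain ⟨F, hF, h1⟩ := ih₁
    obtain ⟨G, hG, h2⟩ := ih₂
    refine ⟨F ∪ G, (Finset.card_union_le _ _).trans (by omega), fun A i h => ?_⟩
    rw [Finset.mem_union, not_or] at h
    rw [h2 _ _ h.2, h1 _ _ h.1]
  | ite_true h _ ih =>
    obtain ⟨F, hF, h1⟩ := ih
    exact ⟨F, by omega, h1⟩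
  | ite_false h _ ih =>
    obtain ⟨F, hF, h1⟩ := ih
    exact ⟨F, by omega, h1⟩
  | loop_done h => exact ⟨∅, by simp, fun _ _ _ => rfl⟩
  | loop_step h _ _ ih₁ ih₂ =>
    obtain ⟨F, hF, h1⟩ := ih₁
    obtain ⟨G, hG, h2⟩ := ih₂
    refine ⟨F ∪ G, (Finset.card_union_le _ _).trans (by omega), fun A i h => ?_⟩
    rw [Finset.mem_union, not_or] at h
    rw [h2 _ _ h.2, h1 _ _ h.1]

end WordRAM

open WordRAM

/-- A correct machine spends at least one step on every triple that it lists. -/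
theorem KPMFInstance.Correct.count_le {w : ℕ} {P : Prog} {x : KPMFInstance} {l : List ℕ} {t : ℕ}
    {s : State} (h : Exec w P (initial w l) t s) (hc : x.Correct (s.mem 1)) : s.mem 1 0 ≤ t := by
  obtain ⟨F, hF, hch⟩ := h.exists_changed
  refine le_trans ?_ hF
  rw [← Finset.card_range (s.mem 1 0)]
  -- The two nodes of a listed pair differ, so one of their two cells is nonzero. Array `1` starts
  -- with zeros, so this cell has been written during the run; different triples use different
  -- cells.
  refine Finset.card_le_card_of_injOn
    (fun i => if s.mem 1 (3 * i + 1) ≠ 0 then (1, 3 * i + 1) else (1, 3 * i + 2)) ?_ ?_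
  · intro i hi
    have hi' : i < s.mem 1 0 := by simpa using hi
    obtain ⟨u, v, hu, hv, huv, -⟩ := (hc (s.mem 1 (3 * i + 1)) (s.mem 1 (3 * i + 2))
      (s.mem 1 (3 * i + 3))).1 ⟨i, hi', rfl, rfl, rfl⟩
    by_contra hn
    by_cases h0 : s.mem 1 (3 * i + 1) = 0
    · simp only [h0, ne_eq, not_true_eq_false, if_false, Finset.mem_coe] at hn
      have := hch _ _ hn
      simp only [initial, one_ne_zero, if_false] at this
      apply huv
      ext
      rw [hu, hv, h0, this]
    · simp only [h0, ne_eq, not_false_eq_true, if_true, Finset.mem_coe] at hn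
      exact h0 (by rw [hch _ _ hn]; simp [initial])
  · intro i _ j _ hij
    simp only at hij
    split_ifs at hij <;> simp at hij <;> omega

/-- The instance without edges, with threshold `1`. -/
def KPMFInstance.edgeless (n : ℕ) : KPMFInstance where
  n := n
  G := ⟨fun _ _ => 0, fun _ => rfl⟩
  edges := []
  nodup := List.nodup_nil
  mem_edges := by simp
  k := 1

theorem KPMFInstance.edgeless_isMaxFlow (n : ℕ)
    (u v : Fin (KPMFInstance.edgeless n).n) :
    (KPMFInstance.edgeless n).G.IsMaxFlow u v 0 := by
  constructor
  · refine ⟨fun _ _ => 0, ⟨by simp, by simp, by simp⟩, by simp [Network.flowValue]⟩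
  · rintro y ⟨f, hf, rfl⟩
    have h0 : ∀ a b, f a b = 0 := fun a b =>
      le_antisymm (by simpa [KPMFInstance.edgeless] using hf.le_cap a b) (hf.nonneg a b)
    refine le_of_eq ?_
    rw [Network.flowValue, Finset.sum_eq_zero fun _ _ => h0 _ _, Finset.sum_eq_zero fun _ _ => h0 _ _, sub_zero]

/-- Every ordered pair of distinct nodes has maximum flow 0 and must be listed. The map from triple
numbers to pairs is onto these pairs, which bounds their number by that of the triples. -/
theorem KPMFInstance.edgeless_count (n : ℕ) (out : ℕ → ℕ)
    (h : (KPMFInstance.edgeless n).Correct out) : n * n - n ≤ out 0 := by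
  have h1 := Finset.offDiag_card (Finset.range n)
  rw [Finset.card_range] at h1
  rw [← h1]
  conv_rhs => rw [← Finset.card_range (out 0)]
  refine le_trans (Finset.card_le_card ?_)
    (Finset.card_image_le (f := fun i => (out (3 * i + 1), out (3 * i + 2))))
  rintro ⟨a, b⟩ hab
  simp only [Finset.mem_offDiag, Finset.mem_range] at hab
  obtain ⟨ha, hb, hne⟩ := hab
  obtain ⟨i, hi, h1, h2, -⟩ := (h a b 0).2 ⟨⟨a, ha⟩, ⟨b, hb⟩, rfl, rfl, fun e => hne (congrArg Fin.val e),
    by simpa using KPMFInstance.edgeless_isMaxFlow n _ _, Nat.zero_le _⟩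
  simp only [Finset.mem_image, Finset.mem_range]
  exact ⟨i, hi, by rw [h1, h2]⟩

/-- For `c = 0` the output of an instance without edges is too long for the time bound. -/
theorem not_kPMFSolvable_zero {ε : ℝ} (hε : 0 < ε) : ¬ KPMFSolvable ε 0 := by
  intro h
  obtain ⟨P, κ, C, hP⟩ := h 1 1 0
  have key : ∀ n : ℕ, 2 ≤ n → (n : ℝ) ^ (2 * ε) ≤ 2 * C := by
    intro n hn
    have hn' : (2 : ℝ) ≤ n := by exact_mod_cast hn
    obtain ⟨t, s, hex, hcor, ht⟩ := hP (KPMFInstance.edgeless n)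
      ⟨hn, by simp [KPMFInstance.m, KPMFInstance.edgeless],
        by simp [KPMFInstance.edgeless], by simp [KPMFInstance.edgeless],
        by simp [KPMFInstance.edgeless]⟩ _ le_rfl
    have h1 := KPMFInstance.Correct.count_le hex hcor
    have h2 := KPMFInstance.edgeless_count n _ hcor
    have h3 : ((n * n - n : ℕ) : ℝ) ≤ C * (((n : ℝ) ^ 2 * 1) ^ (1 - ε)) := by
      refine le_trans ?_ (le_trans ht (by simp [KPMFInstance.edgeless]))
      exact_mod_cast h2.trans h1
    rw [Nat.cast_sub (by nlinarith), Nat.cast_mul, mul_one] at h3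
    have h4 : (((n : ℝ) ^ 2) ^ (1 - ε)) * (n : ℝ) ^ (2 * ε) = n ^ 2 := by
      rw [← Real.rpow_natCast, ← Real.rpow_mul (by positivity), ← Real.rpow_add (by positivity)]
      congr 1
      push_cast
      ring
    have hpos : 0 < ((n : ℝ) ^ 2) ^ (1 - ε) := by positivity
    -- The factor 2 comes from n² ≤ 2(n² - n) for n ≥ 2.
    have : (((n : ℝ) ^ 2) ^ (1 - ε)) * (n : ℝ) ^ (2 * ε) ≤ ((n : ℝ) ^ 2) ^ (1 - ε) * (2 * C) := by
      rw [h4]; nlinarith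
    exact le_of_mul_le_mul_left this hpos
  have ht := (tendsto_rpow_atTop (show 0 < 2 * ε by positivity)).comp
    tendsto_natCast_atTop_atTop
  obtain ⟨n, hn, hn2⟩ := ((ht.eventually_gt_atTop (2 * C)).and
    (Filter.eventually_ge_atTop 2)).exists
  exact absurd (key n hn2) (not_le.2 hn)

namespace WordRAM

theorem State.setReg_reg (s : State) (r v q : ℕ) :
    (s.setReg r v).reg q = if q = r then v else s.reg q := by
  simp [State.setReg, Function.update_apply]

@[simp] theorem State.setReg_mem (s : State) (r v : ℕ) : (s.setReg r v).mem = s.mem := rfl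

@[simp] theorem State.setMem_reg (s : State) (A i v : ℕ) : (s.setMem A i v).reg = s.reg := rfl

theorem State.setMem_mem (s : State) (A i v B j : ℕ) :
    (s.setMem A i v).mem B j = if B = A ∧ j = i then v else s.mem B j := by
  by_cases hB : B = A
  · subst hB
    simp [State.setMem, Function.update_apply]
  · simp [State.setMem, hB]

/-! ## Running a program with a bounded amount of fuel on a fresh memory -/

/-- All registers of the program are below `R`. -/
def Prog.RegsBelow (R : ℕ) : Prog → Prop
  | .const r _ => r < R
  | .op _ r a b => r < R ∧ a < R ∧ b < R
  | .load r _ i => r < R ∧ i < R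
  | .store _ i r => i < R ∧ r < R
  | .seq p q => p.RegsBelow R ∧ q.RegsBelow R
  | .ite r p q => r < R ∧ p.RegsBelow R ∧ q.RegsBelow R
  | .loop r p => r < R ∧ p.RegsBelow R

theorem Prog.RegsBelow.mono {R R' : ℕ} (h : R ≤ R') {p : Prog} (hp : p.RegsBelow R) :
    p.RegsBelow R' := by
  induction p with
  | const r c => exact lt_of_lt_of_le hp h
  | op o r a b => exact ⟨hp.1.trans_le h, hp.2.1.trans_le h, hp.2.2.trans_le h⟩
  | load r A i => exact ⟨hp.1.trans_le h, hp.2.trans_le h⟩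
  | store A i r => exact ⟨hp.1.trans_le h, hp.2.trans_le h⟩
  | seq p q ihp ihq => exact ⟨ihp hp.1, ihq hp.2⟩
  | ite r p q ihp ihq => exact ⟨hp.1.trans_le h, ihp hp.2.1, ihq hp.2.2⟩
  | loop r p ih => exact ⟨hp.1.trans_le h, ih hp.2⟩

theorem Prog.exists_regsBelow (p : Prog) : ∃ R, p.RegsBelow R := by
  induction p with
  | const r c => exact ⟨r + 1, Nat.lt_succ_self r⟩
  | op o r a b => exact ⟨r + a + b + 1, by simp only [Prog.RegsBelow]; omega⟩
  | load r A i => exact ⟨r + i + 1, by simp only [Prog.RegsBelow]; omega⟩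
  | store A i r => exact ⟨r + i + 1, by simp only [Prog.RegsBelow]; omega⟩
  | seq p q ihp ihq =>
    obtain ⟨R, hR⟩ := ihp
    obtain ⟨R', hR'⟩ := ihq
    exact ⟨R + R', hR.mono (by omega), hR'.mono (by omega)⟩
  | ite r p q ihp ihq =>
    obtain ⟨R, hR⟩ := ihp
    obtain ⟨R', hR'⟩ := ihq
    exact ⟨r + 1 + R + R', by omega, hR.mono (by omega), hR'.mono (by omega)⟩
  | loop r p ih =>
    obtain ⟨R, hR⟩ := ih
    exact ⟨r + 1 + R, by omega, hR.mono (by omega)⟩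

/-- Register `15` becomes nonzero if register `64 + 2 * r` is nonzero and there is fuel left in
register `14`. -/
def fuelTest (r : ℕ) : Prog :=
  .ite 14 (.ite (64 + 2 * r) (.const 15 1) (.const 15 0)) (.const 15 0)

/-- The program simulates `p`: register `r` is kept in register `64 + 2 * r`, array `A` in array
`2 + 2 * A`, where a cell only counts if its stamp in array `3 + 2 * A` equals register `13`.
Every iteration of a loop uses one unit of the fuel in register `14`. -/
def Prog.fueled : Prog → Prog
  | .const r c => .const (64 + 2 * r) c
  | .op o r a b => .op o (64 + 2 * r) (64 + 2 * a) (64 + 2 * b)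
  | .load r A i => .seq (.load 15 (3 + 2 * A) (64 + 2 * i)) (.seq (.op .eq 15 15 13)
      (.ite 15 (.load (64 + 2 * r) (2 + 2 * A) (64 + 2 * i)) (.const (64 + 2 * r) 0)))
  | .store A i r => .seq (.store (2 + 2 * A) (64 + 2 * i) (64 + 2 * r))
      (.store (3 + 2 * A) (64 + 2 * i) 13)
  | .seq p q => .seq p.fueled q.fueled
  | .ite r p q => .ite (64 + 2 * r) p.fueled q.fueled
  | .loop r p => .seq (fuelTest r) (.loop 15 (.seq (.seq (.const 16 1) (.op .sub 14 14 16))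
      (.seq p.fueled (fuelTest r))))

/-- The time of `p.fueled` per unit of fuel. -/
def Prog.fuelCost : Prog → ℕ
  | .const _ _ => 1
  | .op _ _ _ _ => 1
  | .load _ _ _ => 4
  | .store _ _ _ => 2
  | .seq p q => p.fuelCost + q.fuelCost
  | .ite _ p q => p.fuelCost + q.fuelCost + 1
  | .loop _ p => p.fuelCost + 6

/-- What a fueled program leaves unchanged. -/
structure FuelFrame (w : ℕ) (s s' : State) : Prop where
  reg : ∀ r < 64, r ≠ 14 → r ≠ 15 → r ≠ 16 → s'.reg r = s.reg r
  fuel : s'.reg 14 ≤ s.reg 14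
  mem₀ : s'.mem 0 = s.mem 0
  mem₁ : s'.mem 1 = s.mem 1
  stamp : ∀ A i, s'.mem (3 + 2 * A) i = s.mem (3 + 2 * A) i ∨
    s'.mem (3 + 2 * A) i = s.reg 13

theorem FuelFrame.refl {w : ℕ} (s : State) : FuelFrame w s s :=
  ⟨fun _ _ _ _ _ => rfl, le_rfl, rfl, rfl, fun _ _ => .inl rfl⟩

theorem FuelFrame.trans {w : ℕ} {s s' s'' : State} (h : FuelFrame w s s')
    (h' : FuelFrame w s' s'') : FuelFrame w s s'' := by
  refine ⟨fun r a b c d => (h'.reg r a b c d).trans (h.reg r a b c d), h'.fuel.trans h.fuel,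
    h'.mem₀.trans h.mem₀, h'.mem₁.trans h.mem₁, fun A i => ?_⟩
  rcases h'.stamp A i with h1 | h1
  · rw [h1]; exact h.stamp A i
  · rw [h1]; exact .inr (h.reg 13 (by omega) (by omega) (by omega) (by omega))

theorem FuelFrame.setReg {w : ℕ} (s : State) {r : ℕ} (v : ℕ) (hr : 64 ≤ r ∨ r = 15 ∨ r = 16) :
    FuelFrame w s (s.setReg r v) := by
  have h (q : ℕ) (h1 : q ≠ r) : (s.setReg r v).reg q = s.reg q := by
    simp [State.setReg, h1]
  exact ⟨fun q _ _ _ _ => h q (by omega), (h 14 (by omega)).le, rfl, rfl, fun _ _ => .inl rfl⟩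

theorem exec_fuelTest {w : ℕ} (hw : 1 ≤ w) (r : ℕ) (s : State) :
    ∃ t, t ≤ 3 ∧ Exec w (fuelTest r) s t
      (s.setReg 15 (if s.reg 14 ≠ 0 ∧ s.reg (64 + 2 * r) ≠ 0 then 1 else 0)) := by
  have h1 : 1 % 2 ^ w = 1 := Nat.mod_eq_of_lt (Nat.one_lt_two_pow (by omega))
  have e1 : Exec w (.const 15 1) s 1 (s.setReg 15 1) := by
    have := Exec.const (w := w) 15 1 s
    rwa [h1] at this
  have e0 : Exec w (.const 15 0) s 1 (s.setReg 15 0) := by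
    have := Exec.const (w := w) 15 0 s
    rwa [Nat.zero_mod] at this
  by_cases h14 : s.reg 14 = 0
  · refine ⟨2, by omega, ?_⟩
    simp only [h14, ne_eq, not_true_eq_false, false_and, if_false]
    exact .ite_false h14 e0
  · by_cases hr : s.reg (64 + 2 * r) = 0
    · refine ⟨3, by omega, ?_⟩
      simp only [hr, ne_eq, not_true_eq_false, and_false, if_false]
      exact .ite_true h14 (.ite_false hr e0)
    · refine ⟨3, by omega, ?_⟩
      simp only [hr, h14, ne_eq, not_false_eq_true, and_self, if_true]
      exact .ite_true h14 (.ite_true hr e1)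

theorem exec_fuelDec {w : ℕ} (s : State) (h0 : s.reg 14 ≠ 0) (hlt : s.reg 14 < 2 ^ w) :
    Exec w (.seq (.const 16 1) (.op .sub 14 14 16)) s 2
      ((s.setReg 16 1).setReg 14 (s.reg 14 - 1)) := by
  have hw : 1 < 2 ^ w := by omega
  have e := Exec.seq (Exec.const (w := w) 16 1 s) (Exec.op .sub 14 14 16 _)
  rw [Nat.mod_eq_of_lt hw] at e
  have : Op.eval w .sub ((s.setReg 16 1).reg 14) ((s.setReg 16 1).reg 16) = s.reg 14 - 1 := by
    simp only [State.setReg_reg, Op.eval]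
    norm_num
    rw [show s.reg 14 + (2 ^ w - 1) = (s.reg 14 - 1) + 2 ^ w by omega, Nat.add_mod_right,
      Nat.mod_eq_of_lt (by omega)]
  rwa [this] at e

theorem fuelFrame_dec {w : ℕ} (s : State) :
    FuelFrame w s ((s.setReg 16 1).setReg 14 (s.reg 14 - 1)) := by
  refine ⟨fun r _ h1 h2 h3 => ?_, ?_, rfl, rfl, fun _ _ => .inl rfl⟩
  · simp [State.setReg, h1, h3]
  · simp [State.setReg]

/-- A fueled program always halts, within its fuel. -/
theorem Prog.fueled_halts {w : ℕ} (hw : 1 ≤ w) (p : Prog) (s : State) (hs : s.reg 14 < 2 ^ w) :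
    ∃ t s', Exec w p.fueled s t s' ∧ FuelFrame w s s' ∧
      t ≤ p.fuelCost * (1 + (s.reg 14 - s'.reg 14)) := by
  induction p generalizing s with
  | const r c =>
    exact ⟨_, _, .const _ _ _, .setReg _ _ (by omega), by simp [Prog.fuelCost]⟩
  | op o r a b =>
    exact ⟨_, _, .op _ _ _ _ _, .setReg _ _ (by omega), by simp [Prog.fuelCost]⟩
  | load r A i =>
    let s₁ := s.setReg 15 (s.mem (3 + 2 * A) (s.reg (64 + 2 * i)))
    let s₂ := s₁.setReg 15 (Op.eval w .eq (s₁.reg 15) (s₁.reg 13))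
    have f₁ : FuelFrame w s s₁ := .setReg _ _ (by omega)
    have f₂ : FuelFrame w s₁ s₂ := .setReg _ _ (by omega)
    by_cases h : s₂.reg 15 = 0
    · refine ⟨_, _, .seq (.load _ _ _ _) (.seq (.op _ _ _ _ _) (.ite_false h (.const _ _ _))),
        (f₁.trans f₂).trans (.setReg _ _ (by omega)), ?_⟩
      simp only [Prog.fuelCost]
      omega
    · refine ⟨_, _, .seq (.load _ _ _ _) (.seq (.op _ _ _ _ _) (.ite_true h (.load _ _ _ _))),
        (f₁.trans f₂).trans (.setReg _ _ (by omega)), ?_⟩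
      simp only [Prog.fuelCost]
      omega
  | store A i r =>
    refine ⟨_, _, .seq (.store _ _ _ _) (.store _ _ _ _), ?_, by simp [Prog.fuelCost]⟩
    refine ⟨fun _ _ _ _ _ => rfl, le_rfl, ?_, ?_, fun B j => ?_⟩
    · funext j
      rw [State.setMem_mem, State.setMem_mem, if_neg (by omega), if_neg (by omega)]
    · funext j
      rw [State.setMem_mem, State.setMem_mem, if_neg (by omega), if_neg (by omega)]
    · rw [State.setMem_mem, State.setMem_mem]
      split_ifs
      · exact .inr rfl
      · omega
      · exact .inl rfl
  | seq p q ihp ihq =>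
    obtain ⟨t₁, s₁, e₁, f₁, h₁⟩ := ihp s hs
    obtain ⟨t₂, s₂, e₂, f₂, h₂⟩ := ihq s₁ (f₁.fuel.trans_lt hs)
    refine ⟨_, _, .seq e₁ e₂, f₁.trans f₂, ?_⟩
    have h3 := f₁.fuel
    have h4 := f₂.fuel
    simp only [Prog.fuelCost]
    calc t₁ + t₂ ≤ p.fuelCost * (1 + (s.reg 14 - s₂.reg 14))
        + q.fuelCost * (1 + (s.reg 14 - s₂.reg 14)) := by
          refine add_le_add (h₁.trans ?_) (h₂.trans ?_) <;> gcongr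
      _ = _ := by ring
  | ite r p q ihp ihq =>
    by_cases h : s.reg (64 + 2 * r) = 0
    · obtain ⟨t₂, s₂, e₂, f₂, h₂⟩ := ihq s hs
      refine ⟨_, _, .ite_false h e₂, f₂, ?_⟩
      simp only [Prog.fuelCost]
      nlinarith [Nat.zero_le (p.fuelCost * (1 + (s.reg 14 - s₂.reg 14)))]
    · obtain ⟨t₂, s₂, e₂, f₂, h₂⟩ := ihp s hs
      refine ⟨_, _, .ite_true h e₂, f₂, ?_⟩
      simp only [Prog.fuelCost]
      nlinarith [Nat.zero_le (q.fuelCost * (1 + (s.reg 14 - s₂.reg 14)))]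
  | loop r p ih =>
    -- Strong induction on the remaining fuel: every iteration burns a unit, which pays for its
    -- constant overhead and for the constant term in the bound of the body. The test only raises
    -- the flag in register `15` if fuel is left, so the decrement never wraps around.
    have main : ∀ n (s : State), s.reg 14 = n → s.reg 14 < 2 ^ w →
        (s.reg 15 ≠ 0 → s.reg 14 ≠ 0) →
        ∃ t s', Exec w (.loop 15 (.seq (.seq (.const 16 1) (.op .sub 14 14 16))
          (.seq p.fueled (fuelTest r)))) s t s' ∧ FuelFrame w s s' ∧
          t ≤ (p.fuelCost + 6) * (s.reg 14 - s'.reg 14) + 1 := by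
      intro n
      induction n using Nat.strong_induction_on with
      | _ n ihn =>
        intro s hn hs h15
        by_cases h : s.reg 15 = 0
        · exact ⟨_, _, .loop_done h, .refl _, by simp⟩
        · have h14 := h15 h
          let s₁ := (s.setReg 16 1).setReg 14 (s.reg 14 - 1)
          have e₁ : Exec w _ s 2 s₁ := exec_fuelDec s h14 hs
          have f₁ : FuelFrame w s s₁ := fuelFrame_dec s
          have hs₁ : s₁.reg 14 = s.reg 14 - 1 := by simp [s₁, State.setReg]
          obtain ⟨t₂, s₂, e₂, f₂, h₂⟩ := ih s₁ (by omega)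
          obtain ⟨t₃, h₃, e₃⟩ := exec_fuelTest hw r s₂
          set v := if s₂.reg 14 ≠ 0 ∧ s₂.reg (64 + 2 * r) ≠ 0 then 1 else 0 with hv
          have f₃ : FuelFrame w s₂ (s₂.setReg 15 v) := .setReg _ _ (by omega)
          have h3 : (s₂.setReg 15 v).reg 14 = s₂.reg 14 := by simp [State.setReg]
          have h3' : (s₂.setReg 15 v).reg 15 = v := by simp [State.setReg]
          have g2 := f₂.fuel
          obtain ⟨t₄, s₄, e₄, f₄, h₄⟩ := ihn (s₂.reg 14) (by omega) (s₂.setReg 15 v) h3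
            (by omega) (by rw [h3', h3, hv]; split_ifs with hh; exacts [fun _ => hh.1, by simp])
          have g4 := f₄.fuel
          refine ⟨_, _, .loop_step h (.seq e₁ (.seq e₂ e₃)) e₄,
            ((f₁.trans f₂).trans f₃).trans f₄, ?_⟩
          rw [h3] at h₄ g4
          obtain ⟨d, hd⟩ : ∃ d, s.reg 14 = s₂.reg 14 + 1 + d := ⟨s.reg 14 - s₂.reg 14 - 1, by omega⟩
          obtain ⟨d', hd'⟩ : ∃ d', s₂.reg 14 = s₄.reg 14 + d' := ⟨s₂.reg 14 - s₄.reg 14, by omega⟩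
          rw [hs₁, show 1 + (s.reg 14 - 1 - s₂.reg 14) = 1 + d by omega] at h₂
          rw [show s₂.reg 14 - s₄.reg 14 = d' by omega] at h₄
          rw [show s.reg 14 - s₄.reg 14 = d' + (1 + d) by omega]
          nlinarith
    obtain ⟨t₃, h₃, e₃⟩ := exec_fuelTest hw r s
    set v := if s.reg 14 ≠ 0 ∧ s.reg (64 + 2 * r) ≠ 0 then 1 else 0 with hv
    have f₃ : FuelFrame w s (s.setReg 15 v) := .setReg _ _ (by omega)
    have h3 : (s.setReg 15 v).reg 14 = s.reg 14 := by simp [State.setReg]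
    have h3' : (s.setReg 15 v).reg 15 = v := by simp [State.setReg]
    obtain ⟨t₄, s₄, e₄, f₄, h₄⟩ := main (s.reg 14) (s.setReg 15 v) h3
      (by omega) (by rw [h3', h3, hv]; split_ifs with hh; exacts [fun _ => hh.1, by simp])
    refine ⟨_, _, .seq e₃ e₄, f₃.trans f₄, ?_⟩
    rw [h3] at h₄
    simp only [Prog.fuelCost]
    nlinarith

/-- The contents of the simulated array `A`. -/
def State.stamped (s : State) (A i : ℕ) : ℕ :=
  if s.mem (3 + 2 * A) i = s.reg 13 then s.mem (2 + 2 * A) i else 0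

/-- The state `s` represents the state `v` of a simulated machine with registers below `R`. -/
structure Simulates (R : ℕ) (v s : State) : Prop where
  reg : ∀ r < R, s.reg (64 + 2 * r) = v.reg r
  mem : ∀ A i, s.stamped A i = v.mem A i

theorem Simulates.setReg {R : ℕ} {v s : State} (h : Simulates R v s) (r x : ℕ) :
    Simulates R (v.setReg r x) (s.setReg (64 + 2 * r) x) := by
  refine ⟨fun q hq => ?_, fun A i => ?_⟩
  · have := h.reg q hq
    simp [State.setReg_reg, this]
  · have := h.mem A i
    simp only [State.stamped, State.setReg_mem, State.setReg_reg] at this ⊢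
    rw [← this, if_neg (by omega : ¬ 13 = 64 + 2 * r)]

theorem Simulates.setReg_low {R : ℕ} {v s : State} (h : Simulates R v s) (r x : ℕ) (hr : r < 64)
    (h13 : r ≠ 13) : Simulates R v (s.setReg r x) := by
  refine ⟨fun q hq => ?_, fun A i => ?_⟩
  · rw [State.setReg_reg, if_neg (by omega), h.reg q hq]
  · have := h.mem A i
    simp only [State.stamped, State.setReg_mem, State.setReg_reg] at this ⊢
    rw [← this, if_neg (by omega : ¬ 13 = r)]

/-- A simulated store is a store of the value followed by a store of the current stamp. Data arrays
have even numbers and stamp arrays odd ones, so the two do not interfere. -/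
theorem State.stamped_store (s : State) (A i x B j : ℕ) :
    ((s.setMem (2 + 2 * A) i x).setMem (3 + 2 * A) i (s.reg 13)).stamped B j =
      if B = A ∧ j = i then x else s.stamped B j := by
  simp only [State.stamped, State.setMem_mem, State.setMem_reg]
  by_cases h : B = A ∧ j = i
  · obtain ⟨rfl, rfl⟩ := h
    simp
  · rw [if_neg h, if_neg (by omega : ¬ (2 + 2 * B = 3 + 2 * A ∧ j = i)),
      if_neg (by omega : ¬ (2 + 2 * B = 2 + 2 * A ∧ j = i)),
      if_neg (by omega : ¬ (3 + 2 * B = 2 + 2 * A ∧ j = i)),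
      if_neg (by omega : ¬ (3 + 2 * B = 3 + 2 * A ∧ j = i))]

theorem Simulates.setMem {R : ℕ} {v s : State} (h : Simulates R v s) (A i x : ℕ) :
    Simulates R (v.setMem A i x) ((s.setMem (2 + 2 * A) i x).setMem (3 + 2 * A) i (s.reg 13)) := by
  refine ⟨fun q hq => h.reg q hq, fun B j => ?_⟩
  rw [State.stamped_store, State.setMem_mem, h.mem]

/-- With enough fuel, the fueled program does what the program does. -/
theorem Exec.fueled {w R : ℕ} (hw : 1 ≤ w) {p : Prog} {v v' : State} {t : ℕ}
    (h : Exec w p v t v') (hp : p.RegsBelow R) (s : State) (hs : s.reg 14 < 2 ^ w)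
    (ht : t ≤ s.reg 14) (hv : Simulates R v s) :
    ∃ t' s', Exec w p.fueled s t' s' ∧ Simulates R v' s' ∧ s.reg 14 ≤ s'.reg 14 + t ∧
      s'.reg 14 ≤ s.reg 14 := by
  induction h generalizing s with
  | const r c v =>
    refine ⟨_, _, .const _ _ _, hv.setReg _ _, ?_⟩
    simp only [State.setReg]
    rw [Function.update_of_ne (by omega)]
    omega
  | op o r a b v =>
    refine ⟨_, _, .op _ _ _ _ _, ?_, ?_⟩
    · rw [hv.reg a hp.2.1, hv.reg b hp.2.2]
      exact hv.setReg _ _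
    · simp only [State.setReg]
      rw [Function.update_of_ne (by omega)]
      omega
  | load r A i v =>
    let s₁ := s.setReg 15 (s.mem (3 + 2 * A) (s.reg (64 + 2 * i)))
    let s₂ := s₁.setReg 15 (Op.eval w .eq (s₁.reg 15) (s₁.reg 13))
    have hv₂ : Simulates R v s₂ := (hv.setReg_low _ _ (by omega) (by omega)).setReg_low _ _
      (by omega) (by omega)
    have hm := hv₂.mem A (v.reg i)
    have hi := hv₂.reg i hp.2
    have h15 : s₂.reg 15 = if s.mem (3 + 2 * A) (v.reg i) = s.reg 13 then 1 else 0 := by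
      have h1 : 1 % 2 ^ w = 1 := Nat.mod_eq_of_lt (Nat.one_lt_two_pow (by omega))
      have e1 : s₁.reg 15 = s.mem (3 + 2 * A) (v.reg i) := by
        simp [s₁, State.setReg, hv.reg i hp.2]
      have e2 : s₁.reg 13 = s.reg 13 := by simp [s₁, State.setReg]
      simp only [s₂, State.setReg, Function.update_self, Op.eval] at *
      rw [e1, e2]
      split_ifs <;> simp [h1]
    have h14 : s₂.reg 14 = s.reg 14 := by simp [s₂, s₁, State.setReg]
    have h13 : s₂.reg 13 = s.reg 13 := by simp [s₂, s₁, State.setReg]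
    simp only [State.stamped, h13] at hm
    by_cases h : s.mem (3 + 2 * A) (v.reg i) = s.reg 13
    · have h0 : s₂.reg 15 ≠ 0 := by rw [h15, if_pos h]; exact one_ne_zero
      refine ⟨_, _, .seq (.load _ _ _ _) (.seq (.op _ _ _ _ _) (.ite_true h0 (.load _ _ _ _))),
        ?_, ?_⟩
      · rw [show s₂.mem = s.mem from rfl] at hm
        rw [if_pos h] at hm
        change Simulates R _ (s₂.setReg (64 + 2 * r) (s₂.mem (2 + 2 * A) (s₂.reg (64 + 2 * i))))
        rw [hi, show s₂.mem = s.mem from rfl, hm]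
        exact hv₂.setReg _ _
      · change _ ≤ (s₂.setReg (64 + 2 * r) _).reg 14 + _ ∧ (s₂.setReg (64 + 2 * r) _).reg 14 ≤ _
        simp only [State.setReg]
        rw [Function.update_of_ne (by omega)]
        omega
    · have h0 : s₂.reg 15 = 0 := by rw [h15, if_neg h]
      refine ⟨_, _, .seq (.load _ _ _ _) (.seq (.op _ _ _ _ _) (.ite_false h0 (.const _ _ _))),
        ?_, ?_⟩
      · rw [show s₂.mem = s.mem from rfl] at hm
        rw [if_neg h] at hm
        rw [← hm, Nat.zero_mod]
        exact hv₂.setReg _ _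
      · change _ ≤ (s₂.setReg (64 + 2 * r) _).reg 14 + _ ∧ (s₂.setReg (64 + 2 * r) _).reg 14 ≤ _
        simp only [State.setReg]
        rw [Function.update_of_ne (by omega)]
        omega
  | store A i r v =>
    refine ⟨_, _, .seq (.store _ _ _ _) (.store _ _ _ _), ?_, ?_⟩
    · have := hv.setMem A (v.reg i) (v.reg r)
      rw [← hv.reg i hp.1, ← hv.reg r hp.2] at this
      rw [← hv.reg i hp.1, ← hv.reg r hp.2]
      exact this
    · simp only [State.setMem]
      omega
  | seq _ _ ih₁ ih₂ =>
    obtain ⟨t₁, s₁, e₁, f₁, g₁, k₁⟩ := ih₁ hp.1 s hs (by omega) hv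
    obtain ⟨t₂, s₂, e₂, f₂, g₂, k₂⟩ := ih₂ hp.2 s₁ (by omega) (by omega) f₁
    exact ⟨_, _, .seq e₁ e₂, f₂, by omega, by omega⟩
  | ite_true h _ ih =>
    obtain ⟨t₁, s₁, e₁, f₁, g₁, k₁⟩ := ih hp.2.1 s hs (by omega) hv
    exact ⟨_, _, .ite_true (by rwa [hv.reg _ hp.1]) e₁, f₁, by omega, k₁⟩
  | ite_false h _ ih =>
    obtain ⟨t₁, s₁, e₁, f₁, g₁, k₁⟩ := ih hp.2.2 s hs (by omega) hv
    exact ⟨_, _, .ite_false (by rwa [hv.reg _ hp.1]) e₁, f₁, by omega, k₁⟩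
  | @loop_done r p v h =>
    obtain ⟨t₃, h₃, e₃⟩ := exec_fuelTest hw r s
    rw [if_neg (by rw [hv.reg _ hp.1]; simp [h])] at e₃
    refine ⟨_, _, .seq e₃ (.loop_done (by simp [State.setReg])),
      hv.setReg_low _ _ (by omega) (by omega), ?_⟩
    simp only [State.setReg]
    rw [Function.update_of_ne (by omega)]
    omega
  | @loop_step r p v v₁ v₂ t₁ t₂ h _ _ ih₁ ih₂ =>
    obtain ⟨t₃, h₃, e₃⟩ := exec_fuelTest hw r s
    rw [if_pos ⟨by omega, by rwa [hv.reg _ hp.1]⟩] at e₃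
    set s₀ := s.setReg 15 1 with hs₀
    have hv₀ : Simulates R v s₀ := hv.setReg_low _ _ (by omega) (by omega)
    have k0 : s₀.reg 14 = s.reg 14 := by simp [hs₀, State.setReg]
    have e₁ := exec_fuelDec (w := w) s₀ (by omega) (by omega)
    set s₁ := (s₀.setReg 16 1).setReg 14 (s₀.reg 14 - 1) with hs₁
    have hv₁ : Simulates R v s₁ := (hv₀.setReg_low _ _ (by omega) (by omega)).setReg_low _ _
      (by omega) (by omega)
    have k1 : s₁.reg 14 = s.reg 14 - 1 := by rw [← k0]; simp [hs₁, State.setReg]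
    obtain ⟨t₂', s₂, e₂, hv₂, g₂, k₂⟩ := ih₁ hp.2 s₁ (by omega) (by omega) hv₁
    obtain ⟨t₄, s₄, e₄, hv₄, g₄, k₄⟩ := ih₂ hp s₂ (by omega) (by omega) hv₂
    -- The induction hypothesis concerns a complete fueled loop, which begins with a test. This test
    -- is split off, because in the combined run it is the one at the end of the current iteration.
    cases e₄ with
    | seq a b =>
      exact ⟨_, _, .seq e₃ (.loop_step (by simp [hs₀, State.setReg]) (.seq e₁ (.seq e₂ a)) b),
        hv₄, by omega, by omega⟩

end WordRAM

/-! ## Flows: cuts and systems of paths -/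

namespace Network

variable {V : Type} [Fintype V]

/-- The value of a flow is at most the capacity of a cut. -/
theorem IsFlow.flowValue_le_cut [DecidableEq V] {G : Network V} {s t : V} {f : V → V → ℝ}
    (hf : G.IsFlow s t f) (S : V → Prop) [DecidablePred S] (hs : S s) (ht : ¬ S t) :
    flowValue s f ≤ ∑ u, ∑ v, if S u ∧ ¬ S v then (G.cap u v : ℝ) else 0 := by
  -- The net outflow is summed over the source side of the cut; by conservation only the source
  -- itself contributes.
  have h1 : flowValue s f = ∑ u, if S u then (∑ v, f u v - ∑ v, f v u) else 0 := by
    rw [Finset.sum_eq_single s]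
    · rw [if_pos hs, flowValue]
    · intro u _ hu
      split_ifs with h
      · rw [hf.conserve u hu (fun e => ht (e ▸ h)), sub_self]
      · rfl
    · simp
  have h2 : flowValue s f =
      (∑ u, ∑ v, if S u then f u v else 0) - ∑ u, ∑ v, if S v then f u v else 0 := by
    rw [h1, Finset.sum_comm (f := fun u v => if S v then f u v else 0),
      ← Finset.sum_sub_distrib]
    refine Finset.sum_congr rfl fun u _ => ?_
    split_ifs
    · rfl
    · simp
  rw [h2, ← Finset.sum_sub_distrib]
  refine Finset.sum_le_sum fun u _ => ?_
  rw [← Finset.sum_sub_distrib]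
  refine Finset.sum_le_sum fun v _ => ?_
  have h3 := hf.nonneg u v
  have h4 := hf.le_cap u v
  by_cases hu : S u <;> by_cases hv : S v <;> simp [hu, hv, h3, h4]

end Network

namespace List

variable {V : Type}

/-- The pairs of consecutive entries. -/
def steps : List V → List (V × V)
  | [] => []
  | [_] => []
  | a :: b :: l => (a, b) :: steps (b :: l)

theorem steps_map {V' : Type} (g : V → V') (l : List V) :
    (l.map g).steps = l.steps.map (Prod.map g g) := by
  induction l with
  | nil => rfl
  | cons a l ih =>
    cases l with
    | nil => rfl
    | cons b l => simp only [map_cons, steps] at ih ⊢; rw [ih]; rfl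

/-- Conservation for a walk: each visit to a node enters and leaves it once, except at the two ends.
The corrections are added on opposite sides so that no subtraction of natural numbers is needed, and
a walk may start and end at the same node. -/
theorem sum_count_steps [Fintype V] [DecidableEq V] (l : List V) (a b : V) (u : V)
    (ha : l.head? = some a) (hb : l.getLast? = some b) :
    ∑ v, l.steps.count (u, v) + (if u = b then 1 else 0) =
      ∑ v, l.steps.count (v, u) + (if u = a then 1 else 0) := by
  induction l generalizing a with
  | nil => simp at ha
  | cons c l ih =>
    cases l with
    | nil =>
      simp only [head?_cons, Option.some.injEq, getLast?_singleton] at ha hb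
      subst ha hb
      simp [steps]
    | cons d l =>
      simp only [head?_cons, Option.some.injEq] at ha
      subst ha
      have hd := ih d rfl (by simpa using hb)
      have e1 : ∑ v, (if (c, d) = (u, v) then 1 else 0 : ℕ) = if u = c then 1 else 0 := by
        by_cases h : u = c
        · subst h; simp
        · simp [h, Ne.symm h]
      have e2 : ∑ v, (if (c, d) = (v, u) then 1 else 0 : ℕ) = if u = d then 1 else 0 := by
        by_cases h : u = d
        · subst h; simp
        · simp [h, Ne.symm h]
      simp only [steps, count_cons, Finset.sum_add_distrib, beq_iff_eq, e1, e2]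
      omega

end List

namespace Network

variable {V : Type} [Fintype V] [DecidableEq V] {ι : Type}

/-- A family of paths that respects the capacities is a flow. -/
theorem isFlow_of_paths (G : Network V) {s t : V} (hst : s ≠ t) (R : Finset ι) (path : ι → List V)
    (hs : ∀ r ∈ R, (path r).head? = some s) (ht : ∀ r ∈ R, (path r).getLast? = some t)
    (hcap : ∀ u v, ∑ r ∈ R, (path r).steps.count (u, v) ≤ G.cap u v) :
    ∃ f, G.IsFlow s t f ∧ flowValue s f = R.card := by
  have key : ∀ u, ∑ v, ∑ r ∈ R, (path r).steps.count (u, v) + (if u = t then R.card else 0) =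
      ∑ v, ∑ r ∈ R, (path r).steps.count (v, u) + (if u = s then R.card else 0) := by
    intro u
    rw [Finset.sum_comm, Finset.sum_comm (γ := V)]
    have := Finset.sum_congr rfl fun r hr =>
      List.sum_count_steps (path r) s t u (hs r hr) (ht r hr)
    rw [Finset.sum_add_distrib, Finset.sum_add_distrib] at this
    by_cases h1 : u = t <;> by_cases h2 : u = s <;> simp [h1, h2] at this ⊢ <;> exact this
  refine ⟨fun u v => ((∑ r ∈ R, (path r).steps.count (u, v) : ℕ) : ℝ), ⟨?_, ?_, ?_⟩, ?_⟩
  · intro u v; positivity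
  · intro u v; exact_mod_cast hcap u v
  · intro v hvs hvt
    have := key v
    rw [if_neg hvs, if_neg hvt] at this
    simp only [add_zero] at this
    exact_mod_cast this.symm
  · have := key s
    rw [if_pos rfl, if_neg hst, add_zero] at this
    rw [flowValue, ← Nat.cast_sum, ← Nat.cast_sum, this]
    push_cast
    ring

end Network

/-! ## Networks given by lists of edges -/

/-- The capacity of the pair `(u, v)` in a list of triples. -/
def capOf (E : List (ℕ × ℕ × ℕ)) (u v : ℕ) : ℕ :=
  (E.map fun e => if e.1 = u ∧ e.2.1 = v then e.2.2 else 0).sum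

/-- The triples describe the edges of a simple network on `N` nodes. -/
structure IsEdgeList (N : ℕ) (E : List (ℕ × ℕ × ℕ)) : Prop where
  nodup : (E.map fun e => (e.1, e.2.1)).Nodup
  lt : ∀ e ∈ E, e.1 < N ∧ e.2.1 < N
  ne : ∀ e ∈ E, e.1 ≠ e.2.1
  pos : ∀ e ∈ E, e.2.2 ≠ 0

theorem capOf_eq_zero {E : List (ℕ × ℕ × ℕ)} {u v : ℕ}
    (h : (u, v) ∉ E.map fun e => (e.1, e.2.1)) : capOf E u v = 0 := by
  rw [capOf, List.sum_eq_zero]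
  intro x hx
  obtain ⟨e, he, rfl⟩ := List.mem_map.1 hx
  refine if_neg fun h' => h (List.mem_map.2 ⟨e, he, ?_⟩)
  rw [h'.1, h'.2]

theorem capOf_of_mem {E : List (ℕ × ℕ × ℕ)} (hE : (E.map fun e => (e.1, e.2.1)).Nodup)
    {u v c : ℕ} (h : (u, v, c) ∈ E) : capOf E u v = c := by
  induction E with
  | nil => simp at h
  | cons e E ih =>
    rw [List.map_cons, List.nodup_cons] at hE
    have hc : capOf (e :: E) u v = (if e.1 = u ∧ e.2.1 = v then e.2.2 else 0) + capOf E u v := by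
      simp [capOf]
    rcases List.mem_cons.1 h with rfl | h
    · rw [hc, capOf_eq_zero hE.1]
      simp
    · rw [hc, ih hE.2 h, if_neg, zero_add]
      rintro ⟨h1, h2⟩
      apply hE.1
      rw [h1, h2]
      exact List.mem_map.2 ⟨_, h, rfl⟩

/-- The instance of kPMF given by a list of edges. -/
def KPMFInstance.ofEdges {N : ℕ} {E : List (ℕ × ℕ × ℕ)} (hE : IsEdgeList N E) (k : ℕ) :
    KPMFInstance where
  n := N
  G := ⟨fun u v => capOf E u v, fun v => by
    apply capOf_eq_zero
    intro h
    obtain ⟨e, he, h⟩ := List.mem_map.1 h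
    rw [Prod.mk.injEq] at h
    exact hE.ne e he (h.1.trans h.2.symm)⟩
  edges := E.attach.map fun e => (⟨e.1.1, (hE.lt e.1 e.2).1⟩, ⟨e.1.2.1, (hE.lt e.1 e.2).2⟩)
  nodup := by
    have h1 : (E.attach.map fun e => (e.1.1, e.1.2.1)).Nodup := by
      have := hE.nodup
      rwa [← List.attach_map_subtype_val E, List.map_map] at this
    have h2 : (E.attach.map fun e => (e.1.1, e.1.2.1)) = List.map
        (fun p : Fin N × Fin N => ((p.1 : ℕ), (p.2 : ℕ))) (E.attach.map fun e =>
          ((⟨e.1.1, (hE.lt e.1 e.2).1⟩ : Fin N), (⟨e.1.2.1, (hE.lt e.1 e.2).2⟩ : Fin N))) := by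
      rw [List.map_map]
      rfl
    rw [h2] at h1
    exact List.Nodup.of_map _ h1
  mem_edges := by
    intro u v
    constructor
    · intro h
      obtain ⟨e, -, h⟩ := List.mem_map.1 h
      rw [Prod.mk.injEq] at h
      have := capOf_of_mem hE.nodup e.2
      rw [← h.1, ← h.2]
      change capOf E e.1.1 e.1.2.1 ≠ 0
      rw [this]
      exact hE.pos _ e.2
    · intro h
      have : ((u : ℕ), (v : ℕ)) ∈ E.map fun e => (e.1, e.2.1) := by
        by_contra h'
        exact h (capOf_eq_zero h')
      obtain ⟨e, he, h⟩ := List.mem_map.1 this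
      rw [Prod.mk.injEq] at h
      exact List.mem_map.2 ⟨⟨e, he⟩, List.mem_attach _ _, Prod.ext (Fin.ext h.1) (Fin.ext h.2)⟩
  k := k

theorem KPMFInstance.ofEdges_input {N : ℕ} {E : List (ℕ × ℕ × ℕ)} (hE : IsEdgeList N E) (k : ℕ) :
    (KPMFInstance.ofEdges hE k).input =
      N :: E.length :: k :: E.flatMap fun e => [e.1, e.2.1, e.2.2] := by
  simp only [KPMFInstance.input, KPMFInstance.m, KPMFInstance.ofEdges, List.length_map,
    List.length_attach, List.flatMap_map]
  congr 3
  conv_rhs => rw [← List.attach_map_subtype_val E, List.flatMap_map]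
  refine List.flatMap_congr fun e _ => ?_
  rw [capOf_of_mem hE.nodup e.2]

/-- The capacity of a cut can be computed edge by edge from the list. It is only an inequality
because triples with an end outside of `Fin N` are lost on the left. -/
theorem sum_capOf_le {N : ℕ} (E : List (ℕ × ℕ × ℕ)) (S : ℕ → Prop) [DecidablePred S] :
    ∑ u : Fin N, ∑ v : Fin N, (if S u ∧ ¬ S v then capOf E u v else 0) ≤
      (E.map fun e => if S e.1 ∧ ¬ S e.2.1 then e.2.2 else 0).sum := by
  induction E with
  | nil => simp [capOf]
  | cons e E ih =>
    have hc : ∀ u v, capOf (e :: E) u v =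
        (if e.1 = u ∧ e.2.1 = v then e.2.2 else 0) + capOf E u v := by
      simp [capOf]
    have h1 : ∑ u : Fin N, ∑ v : Fin N, (if S u ∧ ¬ S v then
        (if e.1 = (u : ℕ) ∧ e.2.1 = (v : ℕ) then e.2.2 else 0) else 0) ≤
        if S e.1 ∧ ¬ S e.2.1 then e.2.2 else 0 := by
      by_cases hu : e.1 < N
      · by_cases hv : e.2.1 < N
        · rw [Finset.sum_eq_single ⟨e.1, hu⟩, Finset.sum_eq_single ⟨e.2.1, hv⟩]
          · simp
          · intro b _ hb
            exact ite_eq_right_iff.2 fun _ => if_neg fun h => hb (Fin.ext h.2.symm)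
          · simp
          · intro b _ hb
            refine Finset.sum_eq_zero fun v _ => ?_
            exact ite_eq_right_iff.2 fun _ => if_neg fun h => hb (Fin.ext h.1.symm)
          · simp
        · rw [Finset.sum_eq_zero]
          · exact Nat.zero_le _
          · refine fun u _ => Finset.sum_eq_zero fun v _ => ?_
            exact ite_eq_right_iff.2 fun _ => if_neg
                (fun h : e.1 = (u : ℕ) ∧ e.2.1 = (v : ℕ) => hv (h.2 ▸ v.2))
      · rw [Finset.sum_eq_zero]
        · exact Nat.zero_le _
        · refine fun u _ => Finset.sum_eq_zero fun v _ => ?_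
          exact ite_eq_right_iff.2 fun _ => if_neg
            fun h : e.1 = (u : ℕ) ∧ e.2.1 = (v : ℕ) => hu (h.1 ▸ u.2)
    simp only [List.map_cons, List.sum_cons]
    refine le_trans (le_of_eq ?_) (add_le_add h1 ih)
    rw [← Finset.sum_add_distrib]
    refine Finset.sum_congr rfl fun u _ => ?_
    rw [← Finset.sum_add_distrib]
    refine Finset.sum_congr rfl fun v _ => ?_
    rw [hc]
    split_ifs <;> simp

/-! ## The network of a formula

The nodes are triples `(tag, i, p)`.  The sources are `(0, 0, p)`, the sinks are `(7, i, p)`.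
In the functions `ua`, `ub`, `ug` the first argument is a partial assignment, the second one is a
clause; the value says that the assignment leaves the clause unsatisfied. -/

/-- The number of the node `(tag, i, p)`. -/
def node (Q W tag i p : ℕ) : ℕ := (tag * W + i) * Q + p

/-- The node with a given number. -/
def unnode (Q W x : ℕ) : ℕ × ℕ × ℕ := (x / Q / W, x / Q % W, x % Q)

theorem unnode_node {Q W tag i p : ℕ} (hi : i < W) (hp : p < Q) :
    unnode Q W (node Q W tag i p) = (tag, i, p) := by
  have hQ : 0 < Q := by omega
  have hW : 0 < W := by omega
  have h1 : node Q W tag i p / Q = tag * W + i := by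
    rw [node, add_comm, Nat.add_mul_div_right _ _ hQ, Nat.div_eq_of_lt hp, zero_add]
  have h2 : node Q W tag i p % Q = p := by
    rw [node, add_comm, Nat.add_mul_mod_self_right, Nat.mod_eq_of_lt hp]
  rw [unnode, h1, h2, add_comm, Nat.add_mul_div_right _ _ hW, Nat.div_eq_of_lt hi, zero_add,
    Nat.add_mul_mod_self_right, Nat.mod_eq_of_lt hi]

theorem node_lt {Q W tag i p : ℕ} (ht : tag < 8) (hi : i < W) (hp : p < Q) :
    node Q W tag i p < 8 * W * Q := by
  have h1 : tag * W + i + 1 ≤ 8 * W := by nlinarith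
  calc node Q W tag i p < (tag * W + i + 1) * Q := by rw [node, Nat.succ_mul]; omega
    _ ≤ 8 * W * Q := Nat.mul_le_mul_right _ h1

/-- The edges that belong to the index `p` and the clause `i`, in triples; capacities may be
zero. -/
def gadgetTriples (M K : ℕ) (ua ub ug : ℕ → ℕ → Bool) (p i : ℕ) :
    List ((ℕ × ℕ × ℕ) × (ℕ × ℕ × ℕ) × ℕ) :=
  [((0, 0, p), (if ua p i then 1 else 2, i, 0), K),
    ((1, i, 0), (3, i, p), if p < K then 1 else 0),
    ((2, i, 0), (4, 0, p), if p < K then 1 else 0),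
    ((3, i, p), (6, i, 0), if p < K then (ub p i).toNat else 0),
    ((3, i, p), (4, 0, p), if p < K then 1 else 0),
    ((4, 0, p), (5, i, 0), if p < K then i else 0),
    ((5, i, 0), (7, i, p), K * M)] ++
  (List.range M).map fun j => ((6, j, 0), (7, i, p), if ug p j then K else 0)

/-- The edges in triples, without those of capacity zero. -/
def triples (Q M K : ℕ) (ua ub ug : ℕ → ℕ → Bool) : List ((ℕ × ℕ × ℕ) × (ℕ × ℕ × ℕ) × ℕ) :=
  (List.range Q).flatMap fun p => (List.range M).flatMap fun i =>
    (gadgetTriples M K ua ub ug p i).filter fun e => e.2.2 ≠ 0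

/-- The numbered edge of an edge in triples. -/
def numberEdge (Q W : ℕ) (e : (ℕ × ℕ × ℕ) × (ℕ × ℕ × ℕ) × ℕ) : ℕ × ℕ × ℕ :=
  (node Q W e.1.1 e.1.2.1 e.1.2.2, node Q W e.2.1.1 e.2.1.2.1 e.2.1.2.2, e.2.2)

/-- The list of edges of the network. -/
def edgeList (Q M K : ℕ) (ua ub ug : ℕ → ℕ → Bool) : List (ℕ × ℕ × ℕ) :=
  (triples Q M K ua ub ug).map (numberEdge Q (M + 1))

section

variable {Q M K : ℕ} {ua ub ug : ℕ → ℕ → Bool}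

theorem mem_triples {e : (ℕ × ℕ × ℕ) × (ℕ × ℕ × ℕ) × ℕ} :
    e ∈ triples Q M K ua ub ug ↔
      ∃ p < Q, ∃ i < M, e ∈ gadgetTriples M K ua ub ug p i ∧ e.2.2 ≠ 0 := by
  simp [triples]

theorem triples_valid (hQ : 0 < Q) {e : (ℕ × ℕ × ℕ) × (ℕ × ℕ × ℕ) × ℕ}
    (he : e ∈ triples Q M K ua ub ug) :
    (e.1.1 < 8 ∧ e.1.2.1 < M + 1 ∧ e.1.2.2 < Q) ∧
      (e.2.1.1 < 8 ∧ e.2.1.2.1 < M + 1 ∧ e.2.1.2.2 < Q) ∧ e.1.1 < e.2.1.1 := by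
  obtain ⟨p, hp, i, hi, he, -⟩ := mem_triples.1 he
  simp only [gadgetTriples, List.mem_append, List.mem_cons, List.not_mem_nil, or_false,
    List.mem_map, List.mem_range] at he
  rcases he with (rfl | rfl | rfl | rfl | rfl | rfl | rfl) | ⟨j, hj, rfl⟩
  · dsimp only
    split_ifs <;> omega
  all_goals
    dsimp only
    omega

/-- The gadget can be read off from the ends of an edge: an index that a node does not use is 0, so
the maximum of the two ends recovers it. The clause index needs an exception for edges into sinks,
since their tail may belong to another clause `j`. -/
theorem gadgetTriples_key {p i : ℕ} {e : (ℕ × ℕ × ℕ) × (ℕ × ℕ × ℕ) × ℕ}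
    (he : e ∈ gadgetTriples M K ua ub ug p i) :
    max e.1.2.2 e.2.1.2.2 = p ∧
      (if e.2.1.1 = 7 then e.2.1.2.1 else max e.1.2.1 e.2.1.2.1) = i := by
  simp only [gadgetTriples, List.mem_append, List.mem_cons, List.not_mem_nil, or_false,
    List.mem_map, List.mem_range] at he
  rcases he with (rfl | rfl | rfl | rfl | rfl | rfl | rfl) | ⟨j, hj, rfl⟩
  · dsimp only
    split_ifs <;> simp_all
  all_goals simp

/-- Inside a gadget the edges differ by inspection, and `gadgetTriples_key` shows that different
gadgets share no edge. -/
theorem triples_nodup : ((triples Q M K ua ub ug).map fun e => (e.1, e.2.1)).Nodup := by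
  rw [triples, List.map_flatMap, List.nodup_flatMap]
  refine ⟨fun p _ => ?_, List.nodup_range.imp ?_⟩
  · rw [List.map_flatMap, List.nodup_flatMap]
    refine ⟨fun i _ => ?_, List.nodup_range.imp ?_⟩
    · refine List.Nodup.sublist (List.Sublist.map _ List.filter_sublist) ?_
      rw [gadgetTriples, List.map_append, List.nodup_append, List.map_map]
      refine ⟨?_, ?_, ?_⟩
      · by_cases h : ua p i <;> simp [h]
      · refine List.Nodup.map_on ?_ List.nodup_range
        intro x _ y _ h
        simpa using h
      · intro a ha b hb
        obtain ⟨j, -, rfl⟩ := List.mem_map.1 hb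
        simp only [List.map_cons, List.map_nil, List.mem_cons, List.not_mem_nil, or_false] at ha
        rcases ha with rfl | rfl | rfl | rfl | rfl | rfl | rfl <;> simp
    · intro i i' hne a h h'
      obtain ⟨e, he, rfl⟩ := List.mem_map.1 h
      obtain ⟨e', he', h2⟩ := List.mem_map.1 h'
      rw [Prod.mk.injEq] at h2
      have k1 := (gadgetTriples_key (List.mem_of_mem_filter he)).2
      have k2 := (gadgetTriples_key (List.mem_of_mem_filter he')).2
      rw [h2.1, h2.2] at k2
      exact hne (k1.symm.trans k2)
  · intro p p' hne a h h'
    obtain ⟨e, he, rfl⟩ := List.mem_map.1 h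
    obtain ⟨e', he', h2⟩ := List.mem_map.1 h'
    rw [Prod.mk.injEq] at h2
    obtain ⟨i, -, he⟩ := List.mem_flatMap.1 he
    obtain ⟨i', -, he'⟩ := List.mem_flatMap.1 he'
    have k1 := (gadgetTriples_key (List.mem_of_mem_filter he)).1
    have k2 := (gadgetTriples_key (List.mem_of_mem_filter he')).1
    rw [h2.1, h2.2] at k2
    exact hne (k1.symm.trans k2)

theorem isEdgeList_edgeList (hQ : 0 < Q) {N : ℕ} (hN : 8 * (M + 1) * Q ≤ N) :
    IsEdgeList N (edgeList Q M K ua ub ug) := by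
  refine ⟨?_, ?_, ?_, ?_⟩
  -- Decoding the node numbers gives back the triples, so the numbering creates no coincidences.
  · have h1 : ((edgeList Q M K ua ub ug).map fun e => (e.1, e.2.1)).map
        (Prod.map (unnode Q (M + 1)) (unnode Q (M + 1))) =
        (triples Q M K ua ub ug).map fun e => (e.1, e.2.1) := by
      rw [edgeList, List.map_map, List.map_map]
      refine List.map_congr_left fun e he => ?_
      have h := triples_valid hQ he
      simp only [Function.comp, numberEdge, Prod.map]
      rw [unnode_node h.1.2.1 h.1.2.2, unnode_node h.2.1.2.1 h.2.1.2.2]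
    exact List.Nodup.of_map _ (h1 ▸ triples_nodup)
  · intro e he
    obtain ⟨e, he', rfl⟩ := List.mem_map.1 he
    have h := triples_valid hQ he'
    exact ⟨(node_lt h.1.1 h.1.2.1 h.1.2.2).trans_le hN,
      (node_lt h.2.1.1 h.2.1.2.1 h.2.1.2.2).trans_le hN⟩
  · intro e he
    obtain ⟨e, he', rfl⟩ := List.mem_map.1 he
    have h := triples_valid hQ he'
    intro h'
    have := congrArg (unnode Q (M + 1)) h'
    simp only [numberEdge] at this
    rw [unnode_node h.1.2.1 h.1.2.2, unnode_node h.2.1.2.1 h.2.1.2.2, Prod.mk.injEq] at this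
    omega
  · intro e he
    obtain ⟨e, he', rfl⟩ := List.mem_map.1 he
    obtain ⟨_, _, _, _, _, h⟩ := mem_triples.1 he'
    exact h

theorem length_edgeList_le : (edgeList Q M K ua ub ug).length ≤ Q * (M * (7 + M)) := by
  rw [edgeList, List.length_map, triples, List.length_flatMap]
  refine (List.sum_le_card_nsmul _ (M * (7 + M)) ?_).trans (by simp)
  intro x hx
  obtain ⟨p, -, rfl⟩ := List.mem_map.1 hx
  rw [List.length_flatMap]
  refine (List.sum_le_card_nsmul _ (7 + M) ?_).trans (by simp)
  intro x hx
  obtain ⟨i, -, rfl⟩ := List.mem_map.1 hx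
  refine (List.length_filter_le _ _).trans ?_
  simp [gadgetTriples]
  omega

theorem cap_le_of_mem_edgeList {e : ℕ × ℕ × ℕ} (he : e ∈ edgeList Q M K ua ub ug) :
    e.2.2 ≤ K * (M + 1) + M := by
  obtain ⟨e, he', rfl⟩ := List.mem_map.1 he
  obtain ⟨p, hp, i, hi, he, -⟩ := mem_triples.1 he'
  have h1 : K * (M + 1) = K * M + K := by ring
  simp only [gadgetTriples, List.mem_append, List.mem_cons, List.not_mem_nil, or_false,
    List.mem_map, List.mem_range] at he
  rcases he with (rfl | rfl | rfl | rfl | rfl | rfl | rfl) | ⟨j, hj, rfl⟩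
  · simp only [numberEdge]; omega
  · simp only [numberEdge]; split_ifs <;> omega
  · simp only [numberEdge]; split_ifs <;> omega
  · simp only [numberEdge]
    have := Bool.toNat_le (ub p i)
    split_ifs <;> omega
  · simp only [numberEdge]; split_ifs <;> omega
  · simp only [numberEdge]; split_ifs <;> omega
  · simp only [numberEdge]; omega
  · simp only [numberEdge]; split_ifs <;> omega

theorem capOf_edgeList (hQ : 0 < Q) {x y : ℕ × ℕ × ℕ} {c p i : ℕ} (hp : p < Q) (hi : i < M)
    (h : (x, y, c) ∈ gadgetTriples M K ua ub ug p i) (hc : c ≠ 0) :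
    capOf (edgeList Q M K ua ub ug) (node Q (M + 1) x.1 x.2.1 x.2.2)
      (node Q (M + 1) y.1 y.2.1 y.2.2) = c :=
  capOf_of_mem (isEdgeList_edgeList hQ le_rfl).nodup
    (List.mem_map.2 ⟨_, mem_triples.2 ⟨p, hp, i, hi, h, hc⟩, rfl⟩)

end

/-! ### The maximum flow from a source to a sink: the cut and the routing. -/

section

variable {Q M K : ℕ} {ua ub ug : ℕ → ℕ → Bool}

/-- The number of clauses that the three partial assignments leave unsatisfied. -/
def unsatCount (M : ℕ) (ua ub ug : ℕ → ℕ → Bool) (α β γ : ℕ) : ℕ :=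
  ((Finset.range M).filter fun i => ua α i = true ∧ ub β i = true ∧ ug γ i = true).card

/-- The source side of a minimum cut, in triples. -/
def cutSide (ua ug : ℕ → ℕ → Bool) (α γ σ : ℕ) (good : ℕ → Bool) : ℕ × ℕ × ℕ → Bool
  | (0, _, p) => decide (p = α)
  | (1, i, _) => ua α i
  | (2, i, _) => !ua α i
  | (3, i, p) => good p && ua α i
  | (4, _, p) => good p
  | (5, i, _) => !decide (i = σ)
  | (6, i, _) => !ug γ i
  | (_, i, p) => !(decide (i = σ) && decide (p = γ))

/-- Inspection of the crossing edges. For good `p` these are the edge from `(3, i, p)` to `(6, i,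
0)`, if all three parts leave clause `i` unsatisfied, and the overflow edge of capacity `σ` if `i =
σ`. For the other `p < K` exactly one unit edge is cut: the one that leaves `(1, i, 0)` or `(2, i,
0)`, whichever lies on the source side. Edges from `(6, j, 0)` into the sink never count, because
the tail is on the source side only if `γ` satisfies clause `j`, and then the capacity is 0. -/
theorem sum_cut_gadget (α γ σ : ℕ) (good : ℕ → Bool) (p i : ℕ) :
    ((gadgetTriples M K ua ub ug p i).map fun e =>
      if cutSide ua ug α γ σ good e.1 = true ∧ ¬ cutSide ua ug α γ σ good e.2.1 = true
        then e.2.2 else 0).sum ≤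
    if p < K then if good p = true then
      (if ua α i = true ∧ ub p i = true ∧ ug γ i = true then 1 else 0) +
        (if i = σ then σ else 0) else 1 else 0 := by
  have h7 : ((List.range M).map fun j => if (!ug γ j) = true ∧
      ¬ (!(decide (i = σ) && decide (p = γ))) = true then (if ug p j then K else 0) else 0).sum
        = 0 := by
    refine List.sum_eq_zero fun x hx => ?_
    obtain ⟨j, -, rfl⟩ := List.mem_map.1 hx
    split_ifs with h1 h2
    · simp only [Bool.not_eq_true', Bool.not_eq_true, Bool.not_eq_false', Bool.and_eq_true,
        decide_eq_true_eq, Bool.not_eq_false] at h1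
      simp [h1.2.2, h1.1] at h2
    · rfl
    · rfl
  rw [gadgetTriples, List.map_append, List.map_map, List.sum_append]
  have hif : ∀ b : Bool, cutSide ua ug α γ σ good (if b = true then 1 else 2, i, 0) =
      if b = true then ua α i else !ua α i := by
    intro b; cases b <;> rfl
  simp only [List.map_cons, List.map_nil, List.sum_cons, List.sum_nil, hif, Function.comp_def]
  simp only [cutSide, h7, add_zero]
  have h0 : (if decide (p = α) = true ∧ ¬ (if ua p i = true then ua α i else !ua α i) = true
      then K else 0) = 0 := by
    rw [if_neg]
    rintro ⟨h1, h2⟩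
    rw [decide_eq_true_eq] at h1
    subst h1
    cases h : ua p i <;> simp [h] at h2
  rw [h0]
  by_cases hp : p < K
  · simp only [hp, if_true]
    by_cases hi : i = σ
    · subst hi
      cases good p <;> cases ua α i <;> cases ub p i <;> cases ug γ i <;> simp
    · cases good p <;> cases ua α i <;> cases ub p i <;> cases ug γ i <;> simp [hi]
  · simp only [hp, if_false, ite_self, zero_add, add_zero]
    simp +contextual

/-- A `β` is called good if `σ` plus its number of unsatisfied clauses is below `M`. A good `β` then
costs this sum and a bad one costs `M`, one for each clause, so the choice realises the minimum
separately for every `β`. -/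
theorem sum_cut_edgeList (hQ : 0 < Q) (hKQ : K ≤ Q) {α γ σ : ℕ} (hσ : σ < M) :
    ((edgeList Q M K ua ub ug).map fun e =>
      if cutSide ua ug α γ σ (fun β => decide (σ + unsatCount M ua ub ug α β γ < M))
          (unnode Q (M + 1) e.1) = true ∧
        ¬ cutSide ua ug α γ σ (fun β => decide (σ + unsatCount M ua ub ug α β γ < M))
          (unnode Q (M + 1) e.2.1) = true then e.2.2 else 0).sum ≤
    ∑ β ∈ Finset.range K, min M (σ + unsatCount M ua ub ug α β γ) := by
  set S := cutSide ua ug α γ σ (fun β => decide (σ + unsatCount M ua ub ug α β γ < M)) with hS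
  have h1 : ((edgeList Q M K ua ub ug).map fun e => if S (unnode Q (M + 1) e.1) = true ∧
      ¬ S (unnode Q (M + 1) e.2.1) = true then e.2.2 else 0) =
      (triples Q M K ua ub ug).map fun e => if S e.1 = true ∧ ¬ S e.2.1 = true
        then e.2.2 else 0 := by
    rw [edgeList, List.map_map]
    refine List.map_congr_left fun e he => ?_
    have h := triples_valid hQ he
    simp only [Function.comp, numberEdge]
    simp only [unnode_node h.1.2.1 h.1.2.2, unnode_node h.2.1.2.1 h.2.1.2.2]
  have h2 : ∀ (l : List ((ℕ × ℕ × ℕ) × (ℕ × ℕ × ℕ) × ℕ)) (q : _ → Bool)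
      (g : _ → ℕ), ((l.filter q).map g).sum ≤ (l.map g).sum := fun l q g =>
    List.Sublist.sum_le_sum (List.Sublist.map _ List.filter_sublist) (by simp)
  have h3 : ∀ (n : ℕ) (f : ℕ → List ((ℕ × ℕ × ℕ) × (ℕ × ℕ × ℕ) × ℕ)) (g : _ → ℕ),
      (((List.range n).flatMap f).map g).sum = ∑ p ∈ Finset.range n, ((f p).map g).sum := by
    intro n f g
    induction n with
    | zero => simp
    | succ n ih =>
      rw [List.range_succ, List.flatMap_append, List.map_append, List.sum_append, ih,
        Finset.sum_range_succ]
      simp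
  rw [h1, triples, h3]
  calc _ ≤ ∑ p ∈ Finset.range Q, if p < K then min M (σ + unsatCount M ua ub ug α p γ)
        else 0 := by
        refine Finset.sum_le_sum fun p _ => ?_
        rw [h3]
        refine (Finset.sum_le_sum fun i _ =>
          (h2 _ _ _).trans (sum_cut_gadget α γ σ _ p i)).trans ?_
        by_cases hp : p < K
        · simp only [hp, if_true, decide_eq_true_eq]
          by_cases hg : σ + unsatCount M ua ub ug α p γ < M
          · simp only [hg, if_true, Finset.sum_add_distrib, Finset.sum_boole]
            rw [min_eq_right hg.le, Finset.sum_ite_eq', if_pos (Finset.mem_range.2 hσ), add_comm]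
            rfl
          · simp only [hg, if_false, Finset.sum_const, Finset.card_range, smul_eq_mul, mul_one]
            rw [min_eq_left (by omega)]
        · simp [hp]
    _ = _ := by
        rw [← Finset.sum_filter]
        congr 1
        ext p
        simp only [Finset.mem_filter, Finset.mem_range]
        omega

/-- The path for the pair `(β, j)`, in triples. -/
def flowPath (ua ub ug : ℕ → ℕ → Bool) (α γ σ : ℕ) (r : ℕ × ℕ) : List (ℕ × ℕ × ℕ) :=
  if ua α r.2 = true then
    if ub r.1 r.2 = true ∧ ug γ r.2 = true then
      [(0, 0, α), (1, r.2, 0), (3, r.2, r.1), (6, r.2, 0), (7, σ, γ)]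
    else [(0, 0, α), (1, r.2, 0), (3, r.2, r.1), (4, 0, r.1), (5, σ, 0), (7, σ, γ)]
  else [(0, 0, α), (2, r.2, 0), (4, 0, r.1), (5, σ, 0), (7, σ, γ)]

/-- For a fixed clause the routed pairs are distinguished by their `β < K`. This is the reason for
the capacity `K` next to the source and in front of the sink. -/
theorem sum_ite_fst_le {R : Finset (ℕ × ℕ)} (hR : R ⊆ Finset.range K ×ˢ Finset.range M) (j : ℕ)
    (f : ℕ × ℕ → ℕ) (hf : ∀ r, f r ≤ if r.2 = j then 1 else 0) : ∑ r ∈ R, f r ≤ K := by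
  refine (Finset.sum_le_sum fun r _ => hf r).trans ?_
  rw [Finset.sum_boole]
  refine le_trans (Finset.card_le_card_of_injOn Prod.fst (t := Finset.range K) ?_ ?_) (by simp)
  · intro r hr
    have := hR (Finset.mem_filter.1 hr).1
    exact (Finset.mem_product.1 this).1
  · intro r hr r' hr' h
    have h1 := (Finset.mem_filter.1 hr).2
    have h2 := (Finset.mem_filter.1 hr').2
    exact Prod.ext h (h1.trans h2.symm)

theorem sum_ite_eq_le_one {R : Finset (ℕ × ℕ)} (r₀ : ℕ × ℕ)
    (f : ℕ × ℕ → ℕ) (hf : ∀ r, f r ≤ if r = r₀ then 1 else 0) : ∑ r ∈ R, f r ≤ 1 := by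
  refine (Finset.sum_le_sum fun r _ => hf r).trans ?_
  rw [Finset.sum_ite_eq']
  split_ifs <;> omega

theorem List.mem_of_mem_steps {V : Type} {l : List V} {x y : V} (h : (x, y) ∈ l.steps) :
    x ∈ l ∧ y ∈ l := by
  induction l with
  | nil => simp [List.steps] at h
  | cons a l ih =>
    cases l with
    | nil => simp [List.steps] at h
    | cons b l =>
      simp only [List.steps, List.mem_cons, Prod.mk.injEq] at h
      rcases h with ⟨rfl, rfl⟩ | h
      · simp
      · have := ih (by simpa using h)
        exact ⟨List.mem_cons_of_mem _ this.1, List.mem_cons_of_mem _ this.2⟩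

/-- This and the following counts go through the three shapes of a path. Each of them says that an
edge is used at most once per path and only by the paths whose indices it carries. -/
theorem count_flowPath_source (α γ σ t j : ℕ) (ht : t = 1 ∨ t = 2) (r : ℕ × ℕ) :
    (flowPath ua ub ug α γ σ r).steps.count ((0, 0, α), (t, j, 0)) ≤ if r.2 = j then 1 else 0 := by
  obtain ⟨b, i⟩ := r
  rcases ht with rfl | rfl <;> by_cases hj : i = j <;> [subst hj; skip; subst hj; skip] <;>
  (by_cases h1 : ua α i = true <;> [by_cases h2 : ub b i = true ∧ ug γ i = true; skip]) <;>
    simp [flowPath, List.steps, *]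

theorem count_flowPath_sink (α γ σ j : ℕ) (r : ℕ × ℕ) :
    (flowPath ua ub ug α γ σ r).steps.count ((6, j, 0), (7, σ, γ)) ≤
      if r.2 = j then 1 else 0 := by
  obtain ⟨b, i⟩ := r
  by_cases hj : i = j <;> [subst hj; skip] <;>
  (by_cases h1 : ua α i = true <;> [by_cases h2 : ub b i = true ∧ ug γ i = true; skip]) <;>
    simp [flowPath, List.steps, *]

theorem count_flowPath_inner (α γ σ β j : ℕ) (r : ℕ × ℕ) {e : (ℕ × ℕ × ℕ) × (ℕ × ℕ × ℕ)}
    (he : e = ((1, j, 0), (3, j, β)) ∨ e = ((3, j, β), (6, j, 0)) ∨ e = ((3, j, β), (4, 0, β)) ∨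
      e = ((2, j, 0), (4, 0, β))) :
    (flowPath ua ub ug α γ σ r).steps.count e ≤ if r.1 = β ∧ r.2 = j then 1 else 0 := by
  obtain ⟨b, i⟩ := r
  rcases he with rfl | rfl | rfl | rfl <;>
  by_cases hr : b = β <;> by_cases hj : i = j <;>
    [(subst hr; subst hj); subst hr; subst hj; skip; (subst hr; subst hj); subst hr; subst hj; skip;
      (subst hr; subst hj); subst hr; subst hj; skip; (subst hr; subst hj); subst hr; subst hj;
      skip] <;>
  (by_cases h1 : ua α i = true <;> [by_cases h2 : ub b i = true ∧ ug γ i = true; skip]) <;>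
    simp [flowPath, List.steps, *]

/-- A path overflows exactly if some part of the assignment satisfies its clause, so the load of
this edge is the number of routed clauses of that kind. -/
theorem count_flowPath_overflow (α γ σ β : ℕ) (r : ℕ × ℕ) :
    (flowPath ua ub ug α γ σ r).steps.count ((4, 0, β), (5, σ, 0)) ≤
      if r.1 = β ∧ ¬ (ua α r.2 = true ∧ ub β r.2 = true ∧ ug γ r.2 = true) then 1 else 0 := by
  obtain ⟨b, i⟩ := r
  by_cases hr : b = β <;> [subst hr; skip] <;>
  (by_cases h1 : ua α i = true <;> [by_cases h2 : ub b i = true ∧ ug γ i = true; skip]) <;>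
    simp [flowPath, List.steps, *]

theorem count_flowPath_last (α γ σ : ℕ) (r : ℕ × ℕ) :
    (flowPath ua ub ug α γ σ r).steps.count ((5, σ, 0), (7, σ, γ)) ≤ 1 := by
  cases h1 : ua α r.2 <;> cases h2 : ub r.1 r.2 <;> cases h3 : ug γ r.2 <;>
    simp [flowPath, List.steps, h1, h2, h3]

/-- The paths respect the capacities. -/
theorem sum_count_flowPath_le (hQ : 0 < Q) (hKQ : K ≤ Q) {α γ σ : ℕ} (hα : α < Q) (hγ : γ < Q)
    (hσ : σ < M) {R : Finset (ℕ × ℕ)} (hR : R ⊆ Finset.range K ×ˢ Finset.range M)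
    (hRσ : ∀ β, (R.filter fun r => r.1 = β ∧
      ¬ (ua α r.2 = true ∧ ub β r.2 = true ∧ ug γ r.2 = true)).card ≤ σ)
    (u v : ℕ) :
    ∑ r ∈ R, ((flowPath ua ub ug α γ σ r).map fun x =>
      node Q (M + 1) x.1 x.2.1 x.2.2).steps.count (u, v) ≤ capOf (edgeList Q M K ua ub ug) u v := by
  set nd := fun x : ℕ × ℕ × ℕ => node Q (M + 1) x.1 x.2.1 x.2.2 with hnd
  -- Pairs that no path uses carry no load. Otherwise the pair is a step of a path, and its capacity
  -- is that of an edge of the gadgets.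
  by_cases h0 : ∃ r ∈ R, (u, v) ∈ ((flowPath ua ub ug α γ σ r).map nd).steps
  swap
  · push Not at h0
    rw [Finset.sum_eq_zero fun r hr => List.count_eq_zero.2 (h0 r hr)]
    exact Nat.zero_le _
  obtain ⟨⟨β₀, j₀⟩, hr₀, hm⟩ := h0
  have hKM : ∀ r ∈ R, r.1 < K ∧ r.2 < M := fun r hr => by
    simpa using hR hr
  have hlt := hKM _ hr₀
  dsimp only at hlt
  have hval : ∀ r ∈ R, ∀ x ∈ flowPath ua ub ug α γ σ r, unnode Q (M + 1) (nd x) = x := by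
    intro r hr x hx
    have h1 := hKM r hr
    refine unnode_node ?_ ?_
    · simp only [flowPath] at hx
      split_ifs at hx <;>
      · simp only [List.mem_cons, List.not_mem_nil, or_false] at hx
        rcases hx with rfl | rfl | rfl | hx <;> [skip; skip; skip; rcases hx with rfl | rfl | rfl] <;>
          dsimp only <;> omega
    · simp only [flowPath] at hx
      split_ifs at hx <;>
      · simp only [List.mem_cons, List.not_mem_nil, or_false] at hx
        rcases hx with rfl | rfl | rfl | hx <;> [skip; skip; skip; rcases hx with rfl | rfl | rfl] <;>
          dsimp only <;> omega
  rw [List.steps_map, List.mem_map] at hm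
  obtain ⟨⟨x, y⟩, hxy, he⟩ := hm
  rw [Prod.map_apply, Prod.mk.injEq] at he
  obtain ⟨rfl, rfl⟩ := he
  -- Decoding the numbers can only increase a count, so it is enough to count with triples as nodes.
  have hcount : ∀ r ∈ R, ((flowPath ua ub ug α γ σ r).map nd).steps.count (nd x, nd y) ≤
      (flowPath ua ub ug α γ σ r).steps.count
        (unnode Q (M + 1) (nd x), unnode Q (M + 1) (nd y)) := by
    intro r hr
    have h1 := List.count_le_count_map (f := Prod.map (unnode Q (M + 1)) (unnode Q (M + 1)))
      (x := (nd x, nd y)) (l := ((flowPath ua ub ug α γ σ r).map nd).steps)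
    rw [← List.steps_map, List.map_map] at h1
    rw [List.map_congr_left (f := unnode Q (M + 1) ∘ nd) (g := id)
      (fun a ha => hval r hr a ha), List.map_id] at h1
    exact h1
  have hx : unnode Q (M + 1) (nd x) = x ∧ unnode Q (M + 1) (nd y) = y :=
    ⟨hval _ hr₀ _ (List.mem_of_mem_steps hxy).1, hval _ hr₀ _ (List.mem_of_mem_steps hxy).2⟩
  rw [hx.1, hx.2] at hcount
  refine (Finset.sum_le_sum hcount).trans ?_
  have hcap := @capOf_edgeList Q M K ua ub ug hQ x y
  have hjj : ∀ (f : ℕ × ℕ → ℕ), (∀ r, f r ≤ if r.2 = j₀ then 1 else 0) → ∑ r ∈ R, f r ≤ K :=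
    fun f hf => sum_ite_fst_le hR j₀ f hf
  have hone : ∀ (f : ℕ × ℕ → ℕ), (∀ r, f r ≤ if r.1 = β₀ ∧ r.2 = j₀ then 1 else 0) →
      ∑ r ∈ R, f r ≤ 1 := fun f hf => sum_ite_eq_le_one (β₀, j₀) f fun r => by
    simpa [Prod.ext_iff] using hf r
  have hoq : ∑ r ∈ R, (flowPath ua ub ug α γ σ r).steps.count ((4, 0, β₀), (5, σ, 0)) ≤ σ := by
    refine le_trans ?_ (hRσ β₀)
    rw [Finset.card_filter]
    exact Finset.sum_le_sum fun r _ => count_flowPath_overflow α γ σ β₀ r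
  have hqt : ∑ r ∈ R, (flowPath ua ub ug α γ σ r).steps.count ((5, σ, 0), (7, σ, γ)) ≤
      K * M := by
    refine (Finset.sum_le_card_nsmul _ _ 1 fun r _ => count_flowPath_last α γ σ r).trans ?_
    simpa using Finset.card_le_card hR
  have c1 := fun r => count_flowPath_source (ua := ua) (ub := ub) (ug := ug) α γ σ 1 j₀
    (.inl rfl) r
  have c2 := fun r => count_flowPath_source (ua := ua) (ub := ub) (ug := ug) α γ σ 2 j₀
    (.inr rfl) r
  have c3 := fun r => count_flowPath_sink (ua := ua) (ub := ub) (ug := ug) α γ σ j₀ r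
  have d := fun r e he => count_flowPath_inner (ua := ua) (ub := ub) (ug := ug) α γ σ β₀ j₀ r
    (e := e) he
  have d1 := fun r => d r _ (.inl rfl)
  have d2 := fun r => d r _ (.inr (.inl rfl))
  have d3 := fun r => d r _ (.inr (.inr (.inl rfl)))
  have d4 := fun r => d r _ (.inr (.inr (.inr rfl)))
  have hK0 : K ≠ 0 := by omega
  have hβQ : β₀ < Q := by omega
  simp only [flowPath] at hxy
  split_ifs at hxy with h1 h2
  · simp only [List.steps, List.mem_cons, List.not_mem_nil, or_false, Prod.mk.injEq] at hxy
    rcases hxy with ⟨rfl, rfl⟩ | ⟨rfl, rfl⟩ | ⟨rfl, rfl⟩ | ⟨rfl, rfl⟩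
    · exact (hjj _ c1).trans (hcap hα hlt.2 (by simp [gadgetTriples, h1]) hK0).ge
    · exact (hone _ d1).trans (hcap hβQ hlt.2 (by simp [gadgetTriples, hlt.1]) one_ne_zero).ge
    · exact (hone _ d2).trans (hcap hβQ hlt.2 (by simp [gadgetTriples, hlt.1, h2.1])
        one_ne_zero).ge
    · exact (hjj _ c3).trans (hcap hγ hσ (by simp [gadgetTriples, hlt.2, h2.2]) hK0).ge
  · simp only [List.steps, List.mem_cons, List.not_mem_nil, or_false, Prod.mk.injEq] at hxy
    rcases hxy with ⟨rfl, rfl⟩ | ⟨rfl, rfl⟩ | ⟨rfl, rfl⟩ | ⟨rfl, rfl⟩ | ⟨rfl, rfl⟩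
    · exact (hjj _ c1).trans (hcap hα hlt.2 (by simp [gadgetTriples, h1]) hK0).ge
    · exact (hone _ d1).trans (hcap hβQ hlt.2 (by simp [gadgetTriples, hlt.1]) one_ne_zero).ge
    · exact (hone _ d3).trans (hcap hβQ hlt.2 (by simp [gadgetTriples, hlt.1]) one_ne_zero).ge
    -- For `σ = 0` the overflow edge has capacity zero and does not occur in the list, but then its
    -- load is zero as well.
    · rcases Nat.eq_zero_or_pos σ with h | h
      · exact hoq.trans (h.le.trans (Nat.zero_le _))
      · exact hoq.trans (hcap hβQ hσ (by simp [gadgetTriples, hlt.1]) h.ne').ge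
    · exact hqt.trans (hcap hγ hσ (by simp [gadgetTriples])
        (Nat.mul_ne_zero hK0 (by omega))).ge
  · simp only [List.steps, List.mem_cons, List.not_mem_nil, or_false, Prod.mk.injEq] at hxy
    rcases hxy with ⟨rfl, rfl⟩ | ⟨rfl, rfl⟩ | ⟨rfl, rfl⟩ | ⟨rfl, rfl⟩
    · exact (hjj _ c2).trans (hcap hα hlt.2 (by simp [gadgetTriples, h1]) hK0).ge
    · exact (hone _ d4).trans (hcap hβQ hlt.2 (by simp [gadgetTriples, hlt.1]) one_ne_zero).ge
    · rcases Nat.eq_zero_or_pos σ with h | h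
      · exact hoq.trans (h.le.trans (Nat.zero_le _))
      · exact hoq.trans (hcap hβQ hσ (by simp [gadgetTriples, hlt.1]) h.ne').ge
    · exact hqt.trans (hcap hγ hσ (by simp [gadgetTriples])
        (Nat.mul_ne_zero hK0 (by omega))).ge

end

section

variable {Q M K : ℕ} {ua ub ug : ℕ → ℕ → Bool}

/-- The routed clauses for `β` are all those that the three parts leave unsatisfied, filled up with
others to the size min(M, σ + u). At most `σ` are added, and these are the ones that overflow. -/
theorem exists_routed (M : ℕ) (ua ub ug : ℕ → ℕ → Bool) (α γ σ β : ℕ) :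
    ∃ T : Finset ℕ, T ⊆ Finset.range M ∧ T.card = min M (σ + unsatCount M ua ub ug α β γ) ∧
      (T.filter fun i => ¬ (ua α i = true ∧ ub β i = true ∧ ug γ i = true)).card ≤ σ := by
  obtain ⟨D, hD⟩ : ∃ D, D = (Finset.range M).filter fun i =>
    ua α i = true ∧ ub β i = true ∧ ug γ i = true := ⟨_, rfl⟩
  have hDM : D.card ≤ M := by
    rw [hD]; exact (Finset.card_filter_le _ _).trans (by simp)
  have hu : unsatCount M ua ub ug α β γ = D.card := by rw [hD]; rfl
  obtain ⟨T, h1, h2, h3⟩ := Finset.exists_subsuperset_card_eq (s := D) (t := Finset.range M)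
    (by rw [hD]; exact Finset.filter_subset _ _) (n := min M (σ + D.card)) (by omega) (by simp)
  refine ⟨T, h2, hu ▸ h3, ?_⟩
  have h4 : (T.filter fun i => ¬ (ua α i = true ∧ ub β i = true ∧ ug γ i = true)) ⊆ T \ D := by
    intro i hi
    rw [Finset.mem_filter] at hi
    rw [Finset.mem_sdiff]
    exact ⟨hi.1, fun h => by rw [hD] at h; exact hi.2 (Finset.mem_filter.1 h).2⟩
  have h5 := Finset.card_le_card h4
  rw [Finset.card_sdiff_of_subset h1, h3] at h5
  omega

/-- The maximum flow from the source of `α` to the sink of `γ` and `σ`. -/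
theorem isMaxFlow_edgeList (hKQ : K ≤ Q) {N k : ℕ} (hN : 8 * (M + 1) * Q ≤ N)
    (hE : IsEdgeList N (edgeList Q M K ua ub ug)) {α γ σ : ℕ} (hα : α < Q) (hγ : γ < Q)
    (hσ : σ < M) {u v : Fin N} (hu : (u : ℕ) = node Q (M + 1) 0 0 α)
    (hv : (v : ℕ) = node Q (M + 1) 7 σ γ) :
    (KPMFInstance.ofEdges hE k).G.IsMaxFlow u v
      ((∑ β ∈ Finset.range K, min M (σ + unsatCount M ua ub ug α β γ) : ℕ) : ℝ) := by
  have hQ : 0 < Q := by omega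
  have hcap : ∀ x y : Fin N, (KPMFInstance.ofEdges hE k).G.cap x y =
    capOf (edgeList Q M K ua ub ug) x y := fun _ _ => rfl
  have huu : unnode Q (M + 1) u = (0, 0, α) := by rw [hu, unnode_node (by omega) hα]
  have hvv : unnode Q (M + 1) v = (7, σ, γ) := by rw [hv, unnode_node (by omega) hγ]
  constructor
  · choose T hT1 hT2 hT3 using exists_routed M ua ub ug α γ σ
    set R := (Finset.range K ×ˢ Finset.range M).filter fun r => r.2 ∈ T r.1 with hR
    have hsub : R ⊆ Finset.range K ×ˢ Finset.range M := Finset.filter_subset _ _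
    have hcard : R.card = ∑ β ∈ Finset.range K, min M (σ + unsatCount M ua ub ug α β γ) := by
      rw [hR, Finset.card_filter, Finset.sum_product]
      refine Finset.sum_congr rfl fun β _ => ?_
      rw [← Finset.card_filter, ← hT2]
      congr 1
      ext i
      simp only [Finset.mem_filter]
      exact ⟨fun h => h.2, fun h => ⟨hT1 _ h, h⟩⟩
    have hN0 : 0 < N := lt_of_lt_of_le (by positivity) hN
    -- The remainder only makes the map total; nodes on the paths have numbers below `N`.
    let toFin : ℕ × ℕ × ℕ → Fin N := fun x =>
      ⟨node Q (M + 1) x.1 x.2.1 x.2.2 % N, Nat.mod_lt _ hN0⟩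
    have hval : ∀ r ∈ R, ∀ x ∈ flowPath ua ub ug α γ σ r,
        (toFin x : ℕ) = node Q (M + 1) x.1 x.2.1 x.2.2 := by
      intro r hr x hx
      have h1 : r.1 < K ∧ r.2 < M := by simpa using hsub hr
      refine Nat.mod_eq_of_lt (lt_of_lt_of_le ?_ hN)
      simp only [flowPath] at hx
      split_ifs at hx <;> simp only [List.mem_cons, List.not_mem_nil, or_false] at hx
      · rcases hx with rfl | rfl | rfl | rfl | rfl <;>
          exact node_lt (by norm_num) (by dsimp only; omega) (by dsimp only; omega)
      · rcases hx with rfl | rfl | rfl | rfl | rfl | rfl <;>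
          exact node_lt (by norm_num) (by dsimp only; omega) (by dsimp only; omega)
      · rcases hx with rfl | rfl | rfl | rfl | rfl <;>
          exact node_lt (by norm_num) (by dsimp only; omega) (by dsimp only; omega)
    have hhead : ∀ r, (flowPath ua ub ug α γ σ r).head? = some (0, 0, α) := by
      intro r
      simp only [flowPath]
      split_ifs <;> rfl
    have hlast : ∀ r, (flowPath ua ub ug α γ σ r).getLast? = some (7, σ, γ) := by
      intro r
      simp only [flowPath]
      split_ifs <;> rfl
    have hus : toFin (0, 0, α) = u := by
      refine Fin.ext ?_
      rw [hu]
      exact Nat.mod_eq_of_lt (hu ▸ u.2)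
    have hvt : toFin (7, σ, γ) = v := by
      refine Fin.ext ?_
      rw [hv]
      exact Nat.mod_eq_of_lt (hv ▸ v.2)
    rw [← hcard]
    refine Network.isFlow_of_paths (V := Fin N) _ ?_ R
      (fun r => (flowPath ua ub ug α γ σ r).map toFin) ?_ ?_ ?_
    · intro h
      rw [h, hvv] at huu
      simp at huu
    · intro r _
      rw [List.head?_map, hhead, Option.map_some, hus]
    · intro r _
      rw [List.getLast?_map, hlast, Option.map_some, hvt]
    · intro x y
      refine (Finset.sum_le_sum fun r hr => ?_).trans (sum_count_flowPath_le hQ hKQ hα hγ hσ hsub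
        (fun β => ?_) x y)
      · have h1 := List.count_le_count_map (f := Prod.map Fin.val Fin.val)
          (x := (x, y)) (l := ((flowPath ua ub ug α γ σ r).map toFin).steps)
        rw [← List.steps_map, List.map_map] at h1
        rw [List.map_congr_left (f := Fin.val ∘ toFin)
          (g := fun x => node Q (M + 1) x.1 x.2.1 x.2.2) (fun a ha => hval r hr a ha)] at h1
        exact h1
      -- For fixed `β` a routed pair is determined by its clause, so the overflowing pairs inject
      -- into the overflowing part of `T β`.
      · refine le_trans (Finset.card_le_card_of_injOn Prod.snd ?_ ?_) (hT3 β)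
        · intro r hr
          simp only [hR, Finset.coe_filter, Finset.mem_filter, Set.mem_ofPred_eq] at hr ⊢
          rw [← hr.2.1]
          exact ⟨hr.1.2, by rw [hr.2.1]; exact hr.2.2⟩
        · intro r hr r' hr' h
          simp only [Finset.coe_filter, Set.mem_ofPred_eq] at hr hr'
          exact Prod.ext (hr.2.1.trans hr'.2.1.symm) h
  · rintro y ⟨f, hf, rfl⟩
    refine (hf.flowValue_le_cut (fun x : Fin N => cutSide ua ug α γ σ
      (fun β => decide (σ + unsatCount M ua ub ug α β γ < M)) (unnode Q (M + 1) x) = true)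
      ?_ ?_).trans ?_
    · rw [huu]; simp [cutSide]
    · rw [hvv]; simp [cutSide]
    · have h1 := (sum_capOf_le (N := N) (edgeList Q M K ua ub ug) (fun x => cutSide ua ug α γ σ
        (fun β => decide (σ + unsatCount M ua ub ug α β γ < M)) (unnode Q (M + 1) x) = true)).trans
        (sum_cut_edgeList hQ hKQ hσ)
      refine le_trans (le_of_eq ?_) (Nat.cast_le.2 h1)
      push_cast
      rfl

theorem Network.IsMaxFlow.unique {V : Type} [Fintype V] {G : Network V} {s t : V} {x y : ℝ}
    (hx : G.IsMaxFlow s t x) (hy : G.IsMaxFlow s t y) : x = y :=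
  IsGreatest.unique hx hy

/-- Each of the `K` summands is at most `M`, so the sum falls short of `K * M` only if one of them
falls short of `M`. -/
theorem sum_min_lt_iff {M K σ : ℕ} {f : ℕ → ℕ} :
    ∑ β ∈ Finset.range K, min M (σ + f β) < K * M ↔ ∃ β < K, σ + f β < M := by
  constructor
  · intro h
    by_contra! hc
    refine absurd h (not_lt.2 (le_of_eq ?_))
    rw [Finset.sum_congr rfl fun β hβ => min_eq_left (hc β (Finset.mem_range.1 hβ))]
    simp
  · rintro ⟨β, hβ, h⟩
    calc ∑ β ∈ Finset.range K, min M (σ + f β) < ∑ _β ∈ Finset.range K, M :=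
          Finset.sum_lt_sum (fun _ _ => min_le_left _ _)
            ⟨β, Finset.mem_range.2 hβ, by rw [min_eq_right h.le]; exact h⟩
      _ = K * M := by simp

/-- What a correct output lists for the network. -/
theorem inOutput_edgeList (hKQ : K ≤ Q) {N k : ℕ} (hN : 8 * (M + 1) * Q ≤ N) (hk : K * M ≤ k)
    (hE : IsEdgeList N (edgeList Q M K ua ub ug)) {out : ℕ → ℕ}
    (hout : (KPMFInstance.ofEdges hE k).Correct out) {α γ σ : ℕ} (hα : α < Q) (hγ : γ < Q)
    (hσ : σ < M) :
    (∃ y < K * M, KPMFInstance.InOutput out (node Q (M + 1) 0 0 α) (node Q (M + 1) 7 σ γ) y) ↔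
      ∃ β < K, σ + unsatCount M ua ub ug α β γ < M := by
  have hu : node Q (M + 1) 0 0 α < N :=
    (node_lt (by norm_num) (by omega) hα).trans_le hN
  have hv : node Q (M + 1) 7 σ γ < N :=
    (node_lt (by norm_num) (by omega) hγ).trans_le hN
  have hmax := isMaxFlow_edgeList (k := k) hKQ hN hE hα hγ hσ (u := ⟨_, hu⟩) (v := ⟨_, hv⟩) rfl rfl
  rw [← sum_min_lt_iff]
  constructor
  · rintro ⟨y, hy, h⟩
    obtain ⟨u, v, h1, h2, -, h3, -⟩ := (hout _ _ _).1 h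
    have e1 : u = ⟨_, hu⟩ := Fin.ext h1
    have e2 : v = ⟨_, hv⟩ := Fin.ext h2
    rw [e1, e2] at h3
    have := h3.unique hmax
    rw [Nat.cast_inj] at this
    rwa [this] at hy
  -- A flow below `K * M` is at most the threshold, so the pair must be listed with its value.
  · intro h
    refine ⟨_, h, (hout _ _ _).2 ⟨⟨_, hu⟩, ⟨_, hv⟩, rfl, rfl, ?_, hmax, (h.le.trans hk)⟩⟩
    intro h'
    have := congrArg (fun x : Fin N => unnode Q (M + 1) x) h'
    simp only at this
    rw [unnode_node (by omega) hα, unnode_node (by omega) hγ] at this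
    simp at this

end

namespace WordRAM

/-! ## Structured programs -/

/-- Expressions over registers and arrays. -/
inductive Expr
  | var (x : ℕ)
  | lit (c : ℕ)
  | bin (o : Op) (a b : Expr)
  | get (A : ℕ) (i : Expr)

namespace Expr

/-- The value of an expression. -/
def eval (w : ℕ) (s : State) : Expr → ℕ
  | var x => s.reg x
  | lit c => c % 2 ^ w
  | bin o a b => o.eval w (a.eval w s) (b.eval w s)
  | get A i => s.mem A (i.eval w s)

/-- The register that holds the value after the evaluation with temporary registers from `d`. -/
def opd : Expr → ℕ → ℕ
  | var x, _ => x
  | lit _, d => 65 + 2 * d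
  | bin _ _ _, d => 65 + 2 * d
  | get _ _, d => 65 + 2 * d

/-- The code of an expression; temporary registers are odd and at least `65`. -/
def code : Expr → ℕ → Prog
  | var _, d => .const (65 + 2 * d) 0
  | lit c, d => .const (65 + 2 * d) c
  | bin o a b, d => .seq (a.code d) (.seq (b.code (d + 1))
      (.op o (65 + 2 * d) (a.opd d) (b.opd (d + 1))))
  | get A i, d => .seq (i.code d) (.load (65 + 2 * d) A (i.opd d))

/-- The number of steps of the code of an expression. -/
def cost : Expr → ℕ
  | var _ => 1
  | lit _ => 1
  | bin _ a b => a.cost + b.cost + 1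
  | get _ i => i.cost + 1

/-- The expression does not use the registers in `J`. -/
def avoids (J : ℕ → Bool) : Expr → Bool
  | var x => !J x
  | lit _ => true
  | bin _ a b => a.avoids J && b.avoids J
  | get _ i => i.avoids J

end Expr

/-- `J` contains the temporary registers. -/
def HasTemps (J : ℕ → Bool) : Prop := ∀ d, J (65 + 2 * d) = true

/-- The states agree except for the registers in `J`. -/
structure Agree (J : ℕ → Bool) (s₀ s : State) : Prop where
  reg : ∀ r, J r = false → s₀.reg r = s.reg r
  mem : s₀.mem = s.mem

theorem Agree.refl {J : ℕ → Bool} (s : State) : Agree J s s := ⟨fun _ _ => rfl, rfl⟩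

theorem Agree.trans {J : ℕ → Bool} {s s' s'' : State} (h : Agree J s s') (h' : Agree J s' s'') :
    Agree J s s'' := ⟨fun r hr => (h.reg r hr).trans (h'.reg r hr), h.mem.trans h'.mem⟩

theorem Agree.mono {J J' : ℕ → Bool} (hJ : ∀ r, J r = true → J' r = true) {s s' : State}
    (h : Agree J s s') : Agree J' s s' := by
  refine ⟨fun r hr => h.reg r ?_, h.mem⟩
  cases h1 : J r
  · rfl
  · rw [hJ r h1] at hr
    exact absurd hr (by simp)

theorem Agree.setReg {J : ℕ → Bool} {s₀ s : State} (h : Agree J s₀ s) (r v : ℕ) :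
    Agree J (s₀.setReg r v) (s.setReg r v) := by
  refine ⟨fun q hq => ?_, h.mem⟩
  rw [State.setReg_reg, State.setReg_reg, h.reg q hq]

theorem Agree.setMem {J : ℕ → Bool} {s₀ s : State} (h : Agree J s₀ s) (A i v : ℕ) :
    Agree J (s₀.setMem A i v) (s.setMem A i v) := by
  refine ⟨h.reg, ?_⟩
  simp only [State.setMem, h.mem]

theorem Agree.setReg_left {J : ℕ → Bool} {s₀ s : State} (h : Agree J s₀ s) {r : ℕ} (v : ℕ)
    (hr : J r = true) : Agree J (s₀.setReg r v) s := by
  refine ⟨fun q hq => ?_, h.mem⟩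
  rw [State.setReg_reg, if_neg, h.reg q hq]
  rintro rfl
  simp [hr] at hq

theorem Expr.eval_congr {J : ℕ → Bool} {w : ℕ} {s₀ s : State} (h : Agree J s₀ s) {e : Expr}
    (he : e.avoids J = true) : e.eval w s₀ = e.eval w s := by
  induction e with
  | var x => exact h.reg x (by simpa [Expr.avoids] using he)
  | lit c => rfl
  | bin o a b iha ihb =>
    simp only [Expr.avoids, Bool.and_eq_true] at he
    simp only [Expr.eval, iha he.1, ihb he.2]
  | get A i ih => simp only [Expr.eval, ih he, h.mem]

/-- The last clause of the conclusion is what binary operations need: the second operand is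
evaluated with temporaries from `d + 1` on and hence does not destroy the value of the first one in
temporary `d`. -/
theorem Expr.exec_code {J : ℕ → Bool} (hJ : HasTemps J) {w : ℕ} (e : Expr) (d : ℕ) (s : State)
    (he : e.avoids J = true) :
    ∃ s', Exec w (e.code d) s e.cost s' ∧ Agree J s' s ∧ s'.reg (e.opd d) = e.eval w s ∧
      ∀ d' < d, s'.reg (65 + 2 * d') = s.reg (65 + 2 * d') := by
  induction e generalizing d s with
  | var x =>
    have hx : x ≠ 65 + 2 * d := by
      rintro rfl
      simp [Expr.avoids, hJ d] at he
    refine ⟨_, .const _ _ _, (Agree.refl s).setReg_left _ (hJ d), ?_, fun d' hd' => ?_⟩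
    · rw [State.setReg_reg, Expr.opd, if_neg hx]; rfl
    · rw [State.setReg_reg, if_neg (by omega)]
  | lit c =>
    refine ⟨_, .const _ _ _, (Agree.refl s).setReg_left _ (hJ d), ?_, fun d' hd' => ?_⟩
    · rw [State.setReg_reg, Expr.opd, if_pos rfl]; rfl
    · rw [State.setReg_reg, if_neg (by omega)]
  | bin o a b iha ihb =>
    simp only [Expr.avoids, Bool.and_eq_true] at he
    obtain ⟨s₁, e₁, a₁, v₁, k₁⟩ := iha d s he.1
    obtain ⟨s₂, e₂, a₂, v₂, k₂⟩ := ihb (d + 1) s₁ he.2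
    have h1 : s₂.reg (a.opd d) = a.eval w s := by
      rw [← v₁]
      cases a with
      | var x => exact a₂.reg x (by simpa [Expr.avoids] using he.1)
      | lit c => exact k₂ d (by omega)
      | bin o a b => exact k₂ d (by omega)
      | get A i => exact k₂ d (by omega)
    have h2 : s₂.reg (b.opd (d + 1)) = b.eval w s := by
      rw [v₂, Expr.eval_congr a₁ he.2]
    have := Exec.seq e₁ (.seq e₂ (.op o (65 + 2 * d) (a.opd d) (b.opd (d + 1)) s₂))
    rw [← add_assoc] at this
    refine ⟨_, this, (a₂.trans a₁).setReg_left _ (hJ d), ?_, fun d' hd' => ?_⟩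
    · rw [h1, h2, State.setReg_reg, Expr.opd, if_pos rfl]
      rfl
    · rw [State.setReg_reg, if_neg (by omega), k₂ d' (by omega), k₁ d' hd']
  | get A i ih =>
    obtain ⟨s₁, e₁, a₁, v₁, k₁⟩ := ih d s he
    refine ⟨_, .seq e₁ (.load _ _ _ _), a₁.setReg_left _ (hJ d), ?_, fun d' hd' => ?_⟩
    · rw [v₁, State.setReg_reg, Expr.opd, if_pos rfl, a₁.mem]
      rfl
    · rw [State.setReg_reg, if_neg (by omega), k₁ d' hd']

/-- From every state that agrees with `s`, the program halts within `T` steps in a state that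
agrees with a state in `R`. -/
def Runs (J : ℕ → Bool) (w : ℕ) (p : Prog) (s : State) (T : ℕ) (R : State → Prop) : Prop :=
  ∀ s₀, Agree J s₀ s → ∃ t s₁ s', Exec w p s₀ t s₁ ∧ t ≤ T ∧ Agree J s₁ s' ∧ R s'

namespace Runs

variable {J : ℕ → Bool} {w : ℕ}

theorem mono {p : Prog} {s : State} {T T' : ℕ} {R R' : State → Prop} (h : Runs J w p s T R)
    (hT : T ≤ T') (hR : ∀ s', R s' → R' s') : Runs J w p s T' R' := fun s₀ hs₀ =>
  let ⟨t, s₁, s', e, ht, a, r⟩ := h s₀ hs₀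
  ⟨t, s₁, s', e, ht.trans hT, a, hR _ r⟩

theorem seq {p q : Prog} {s : State} {T₁ T₂ : ℕ} {R₁ R : State → Prop} (h : Runs J w p s T₁ R₁)
    (h' : ∀ s', R₁ s' → Runs J w q s' T₂ R) : Runs J w (.seq p q) s (T₁ + T₂) R := by
  intro s₀ hs₀
  obtain ⟨t₁, s₁, s', e₁, ht₁, a₁, r₁⟩ := h s₀ hs₀
  obtain ⟨t₂, s₂, s'', e₂, ht₂, a₂, r₂⟩ := h' s' r₁ s₁ a₁
  exact ⟨_, _, _, .seq e₁ e₂, by omega, a₂, r₂⟩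

/-- Registers may be added to `J` if the final values outside of `J` are known. -/
theorem forget {J' : ℕ → Bool} (hJ : ∀ r, J r = true → J' r = true) {p : Prog} {s : State} {T : ℕ}
    {s₁ : State} (h : ∀ s₀, Agree J' s₀ s → Runs J w p s₀ T fun s' => Agree J' s' s₁)
    {R : State → Prop} (hR : R s₁) : Runs J' w p s T R := by
  intro s₀ hs₀
  obtain ⟨t, s₂, s', e, ht, a, r⟩ := h s₀ hs₀ s₀ (.refl _)
  exact ⟨t, s₂, s₁, e, ht, (a.mono hJ).trans r, hR⟩

end Runs

/-- Simple instructions. -/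
inductive Instr
  | op (x : ℕ) (o : Op) (a b : Expr)
  | get (x A : ℕ) (i : Expr)
  | lit (x c : ℕ)
  | put (A : ℕ) (i v : Expr)

namespace Instr

/-- The effect of an instruction. -/
def run (w : ℕ) (s : State) : Instr → State
  | op x o a b => s.setReg x (o.eval w (a.eval w s) (b.eval w s))
  | get x A i => s.setReg x (s.mem A (i.eval w s))
  | lit x c => s.setReg x (c % 2 ^ w)
  | put A i v => s.setMem A (i.eval w s) (v.eval w s)

/-- The code of an instruction. -/
def code : Instr → Prog
  | op x o a b => .seq (a.code 0) (.seq (b.code 1) (.op o x (a.opd 0) (b.opd 1)))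
  | get x A i => .seq (i.code 0) (.load x A (i.opd 0))
  | lit x c => .const x c
  | put A i v => .seq (i.code 0) (.seq (v.code 1) (.store A (i.opd 0) (v.opd 1)))

/-- The number of steps of an instruction. -/
def cost : Instr → ℕ
  | op _ _ a b => a.cost + b.cost + 1
  | get _ _ i => i.cost + 1
  | lit _ _ => 1
  | put _ i v => i.cost + v.cost + 1

/-- The instruction does not use the registers in `J`. -/
def avoids (J : ℕ → Bool) : Instr → Bool
  | op _ _ a b => a.avoids J && b.avoids J
  | get _ _ i => i.avoids J
  | lit _ _ => true
  | put _ i v => i.avoids J && v.avoids J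

theorem exec_code {J : ℕ → Bool} (hJ : HasTemps J) {w : ℕ} (i : Instr) {s₀ s : State}
    (hs : Agree J s₀ s) (hi : i.avoids J = true) :
    ∃ s₁, Exec w i.code s₀ i.cost s₁ ∧ Agree J s₁ (i.run w s) := by
  have two : ∀ a b : Expr, a.avoids J = true → b.avoids J = true → ∃ s₁ s₂,
      Exec w (a.code 0) s₀ a.cost s₁ ∧ Exec w (b.code 1) s₁ b.cost s₂ ∧ Agree J s₂ s ∧
      s₂.reg (a.opd 0) = a.eval w s ∧ s₂.reg (b.opd 1) = b.eval w s := by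
    intro a b ha hb
    obtain ⟨s₁, e₁, a₁, v₁, k₁⟩ := Expr.exec_code hJ (w := w) a 0 s₀ ha
    obtain ⟨s₂, e₂, a₂, v₂, k₂⟩ := Expr.exec_code hJ (w := w) b 1 s₁ hb
    refine ⟨s₁, s₂, e₁, e₂, (a₂.trans a₁).trans hs, ?_, ?_⟩
    · rw [← Expr.eval_congr hs ha, ← v₁]
      cases a with
      | var x => exact a₂.reg x (by simpa [Expr.avoids] using ha)
      | lit c => exact k₂ 0 (by omega)
      | bin o a b => exact k₂ 0 (by omega)
      | get A i => exact k₂ 0 (by omega)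
    · rw [v₂, Expr.eval_congr a₁ hb, Expr.eval_congr hs hb]
  cases i with
  | op x o a b =>
    simp only [avoids, Bool.and_eq_true] at hi
    obtain ⟨s₁, s₂, e₁, e₂, h, h1, h2⟩ := two a b hi.1 hi.2
    have := Exec.seq e₁ (.seq e₂ (.op o x (a.opd 0) (b.opd 1) s₂))
    rw [← add_assoc] at this
    refine ⟨_, this, ?_⟩
    rw [h1, h2]
    exact h.setReg _ _
  | get x A i =>
    obtain ⟨s₁, e₁, a₁, v₁, k₁⟩ := Expr.exec_code hJ (w := w) i 0 s₀ hi
    refine ⟨_, .seq e₁ (.load _ _ _ _), ?_⟩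
    rw [v₁, Expr.eval_congr hs hi, a₁.mem, hs.mem]
    exact (a₁.trans hs).setReg _ _
  | lit x c => exact ⟨_, .const _ _ _, hs.setReg _ _⟩
  | put A i v =>
    simp only [avoids, Bool.and_eq_true] at hi
    obtain ⟨s₁, s₂, e₁, e₂, h, h1, h2⟩ := two i v hi.1 hi.2
    have := Exec.seq e₁ (.seq e₂ (.store A (i.opd 0) (v.opd 1) s₂))
    rw [← add_assoc] at this
    refine ⟨_, this, ?_⟩
    rw [h1, h2]
    exact h.setMem _ _ _

end Instr

/-- A list of instructions, followed by one idle step. -/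
def block : List Instr → Prog
  | [] => .const 65 0
  | i :: l => .seq i.code (block l)

/-- The number of steps of a list of instructions. -/
def blockCost : List Instr → ℕ
  | [] => 1
  | i :: l => i.cost + blockCost l

/-- The effect of a list of instructions. -/
def runBlock (w : ℕ) : List Instr → State → State
  | [], s => s
  | i :: l, s => runBlock w l (i.run w s)

theorem Runs.block {J : ℕ → Bool} (hJ : HasTemps J) {w : ℕ} {l : List Instr} {s : State}
    (hl : l.all (·.avoids J) = true) {R : State → Prop} (hR : R (runBlock w l s)) :
    Runs J w (block l) s (blockCost l) R := by
  induction l generalizing s with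
  | nil =>
    exact fun s₀ hs₀ => ⟨_, _, s, .const _ _ _, le_rfl, hs₀.setReg_left _ (hJ 0), hR⟩
  | cons i l ih =>
    simp only [List.all_cons, Bool.and_eq_true] at hl
    intro s₀ hs₀
    obtain ⟨s₁, e₁, a₁⟩ := Instr.exec_code hJ (w := w) i hs₀ hl.1
    obtain ⟨t, s₂, s', e₂, ht, a₂, r⟩ := ih hl.2 hR s₁ a₁
    exact ⟨_, _, s', .seq e₁ e₂, Nat.add_le_add_left ht _, a₂, r⟩

/-- Conditional execution. -/
def cond (e : Expr) (p q : Prog) : Prog := .seq (e.code 0) (.ite (e.opd 0) p q)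

/-- Both branches are charged the same bound, with one further step for the test in addition to the
cost of the condition. -/
theorem Runs.cond {J : ℕ → Bool} (hJ : HasTemps J) {w : ℕ} {e : Expr} {p q : Prog} {s : State}
    (he : e.avoids J = true) {T : ℕ} {R : State → Prop}
    (hp : e.eval w s ≠ 0 → Runs J w p s T R) (hq : e.eval w s = 0 → Runs J w q s T R) :
    Runs J w (cond e p q) s (e.cost + 1 + T) R := by
  intro s₀ hs₀
  obtain ⟨s₁, e₁, a₁, v₁, -⟩ := Expr.exec_code hJ (w := w) e 0 s₀ he
  rw [Expr.eval_congr hs₀ he] at v₁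
  by_cases h : e.eval w s = 0
  · obtain ⟨t, s₂, s', e₂, ht, a₂, r⟩ := hq h s₁ (a₁.trans hs₀)
    exact ⟨_, _, s', .seq e₁ (.ite_false (v₁.trans h) e₂), by omega, a₂, r⟩
  · obtain ⟨t, s₂, s', e₂, ht, a₂, r⟩ := hp h s₁ (a₁.trans hs₀)
    exact ⟨_, _, s', .seq e₁ (.ite_true (by rwa [v₁]) e₂), by omega, a₂, r⟩

/-- `for x in [0, e) do p`; the bound is evaluated before every iteration. -/
def forLoop (x : ℕ) (e : Expr) (p : Prog) : Prog :=
  .seq (.const x 0) (.seq ((Expr.bin .lt (.var x) e).code 0) (.loop 65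
    (.seq p (.seq (Instr.op x .add (.var x) (.lit 1)).code
      ((Expr.bin .lt (.var x) e).code 0)))))

/-- The invariant rule. The bound may be any expression, provided that the invariant keeps its value
at `n`. An iteration costs the body, 3 steps for the increment, `e.cost + 2` for the comparison and
1 for the loop. Register `65` is temporary `0`, where the comparison leaves its result. -/
theorem Runs.forLoop {J : ℕ → Bool} (hJ : HasTemps J) {w : ℕ} {x : ℕ} {e : Expr} {p : Prog}
    {s : State} (hx : J x = false) (he : e.avoids J = true) {n T : ℕ} (hn : n < 2 ^ w)
    (I : ℕ → State → Prop) (h0 : I 0 (s.setReg x 0))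
    (hxI : ∀ i s, i ≤ n → I i s → s.reg x = i ∧ e.eval w s = n)
    (hstep : ∀ i s, i < n → I i s → Runs J w p s T fun s' => s'.reg x = i ∧
      I (i + 1) (s'.setReg x (i + 1))) :
    Runs J w (forLoop x e p) s (n * (T + e.cost + 6) + e.cost + 4) (I n) := by
  have hlt : (Expr.bin .lt (.var x) e).avoids J = true := by simp [Expr.avoids, hx, he]
  have htest : ∀ (i : ℕ) (s : State), i ≤ n → I i s → ∀ s₀, Agree J s₀ s → ∃ s₁,
      Exec w ((Expr.bin .lt (.var x) e).code 0) s₀ (e.cost + 2) s₁ ∧ Agree J s₁ s ∧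
      s₁.reg 65 = if i < n then 1 else 0 := by
    intro i s hi hI s₀ hs₀
    obtain ⟨s₁, e₁, a₁, v₁, -⟩ := Expr.exec_code hJ (w := w) (Expr.bin .lt (.var x) e) 0 s₀ hlt
    obtain ⟨h1, h2⟩ := hxI i s hi hI
    refine ⟨s₁, ?_, a₁.trans hs₀, ?_⟩
    · convert e₁ using 1
      simp only [Expr.cost]
      omega
    · rw [Expr.eval_congr hs₀ hlt] at v₁
      simp only [Expr.eval, h1, h2, Op.eval] at v₁
      refine v₁.trans ?_
      split_ifs with h
      · exact Nat.mod_eq_of_lt (by omega)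
      · exact Nat.zero_mod _
  have main : ∀ (m i : ℕ) (s s₀ : State), i + m = n → I i s → Agree J s₀ s →
      s₀.reg 65 = (if i < n then 1 else 0) → ∃ t s₁ s',
      Exec w (.loop 65 (.seq p (.seq (Instr.op x .add (.var x) (.lit 1)).code
        ((Expr.bin .lt (.var x) e).code 0)))) s₀ t s₁ ∧ t ≤ m * (T + e.cost + 6) + 1 ∧
        Agree J s₁ s' ∧ I n s' := by
    intro m
    induction m with
    | zero =>
      intro i s s₀ him hI hs₀ h65
      obtain rfl : i = n := by omega
      exact ⟨_, _, s, .loop_done (by simpa using h65), by omega, hs₀, hI⟩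
    | succ m ih =>
      intro i s s₀ him hI hs₀ h65
      obtain ⟨t₁, s₁, s', e₁, ht₁, a₁, hx', hI'⟩ := hstep i s (by omega) hI s₀ hs₀
      obtain ⟨s₂, e₂, a₂⟩ := Instr.exec_code hJ (w := w) (.op x .add (.var x) (.lit 1)) a₁
        (by simp [Instr.avoids, Expr.avoids, hx])
      have h2 : (Instr.op x .add (.var x) (.lit 1)).run w s' = s'.setReg x (i + 1) := by
        simp only [Instr.run, Expr.eval, Op.eval, hx']
        rw [Nat.mod_eq_of_lt (a := 1) (by omega), Nat.mod_eq_of_lt (by omega)]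
      rw [h2] at a₂
      obtain ⟨s₃, e₃, a₃, v₃⟩ := htest (i + 1) _ (by omega) hI' s₂ a₂
      obtain ⟨t₄, s₄, s'', e₄, ht₄, a₄, hI''⟩ := ih (i + 1) _ s₃ (by omega) hI' a₃ v₃
      refine ⟨_, s₄, s'', .loop_step (by rw [h65, if_pos (by omega)]; exact one_ne_zero)
        (.seq e₁ (.seq e₂ e₃)) e₄, ?_, a₄, hI''⟩
      simp only [Instr.cost, Expr.cost]
      rw [Nat.succ_mul]
      omega
  intro s₀ hs₀
  have a₀ : Agree J (s₀.setReg x 0) (s.setReg x 0) := hs₀.setReg _ _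
  obtain ⟨s₁, e₁, a₁, v₁⟩ := htest 0 _ (Nat.zero_le _) h0 _ a₀
  obtain ⟨t, s₂, s', e₂, ht, a₂, hI⟩ := main n 0 _ s₁ (by omega) h0 a₁ v₁
  have e0 := Exec.const (w := w) x 0 s₀
  rw [Nat.zero_mod] at e0
  exact ⟨_, s₂, s', .seq e0 (.seq e₁ e₂), by omega, a₂, hI⟩

end WordRAM

/-! ## Partial assignments -/

/-- The assignment whose values are the bits of `a` satisfies the clause by a variable in
`[lo, hi)`. -/
def partSat {n : ℕ} (a lo hi : ℕ) (C : List (Fin n × Bool)) : Bool :=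
  C.any fun l => decide (lo ≤ (l.1 : ℕ)) && decide ((l.1 : ℕ) < hi) && (a.testBit l.1 == l.2)

/-- The words of a clause. -/
def clauseWords {n : ℕ} (C : List (Fin n × Bool)) : List ℕ :=
  C.length :: C.map fun l => 2 * (l.1 : ℕ) + l.2.toNat

theorem List.length_le_of_nodup_literals {n : ℕ} {C : List (Fin n × Bool)} (h : C.Nodup) :
    C.length ≤ 2 * n := by
  have := h.length_le_card
  simpa [mul_comm] using this

namespace CNF

theorem input_eq (F : CNF) : F.input = F.n :: F.m :: F.clauses.flatMap clauseWords := rfl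

/-- The words of the input from clause `j` on. -/
theorem drop_flatMap_clauseWords {n : ℕ} {l : List (List (Fin n × Bool))} {j : ℕ}
    (hj : j < l.length) : (l.drop j).flatMap clauseWords =
      l[j].length :: ((l[j].map fun l => 2 * (l.1 : ℕ) + l.2.toNat) ++
        (l.drop (j + 1)).flatMap clauseWords) := by
  rw [List.drop_eq_getElem_cons hj, List.flatMap_cons]
  rfl

/-- The words of the clause at position `pos` of the input. -/
theorem clause_at (F : CNF) {pos j : ℕ} (hj : j < F.clauses.length)
    (h : F.input.drop pos = (F.clauses.drop j).flatMap clauseWords) :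
    F.input.getD pos 0 = F.clauses[j].length ∧
      (∀ (l : ℕ) (hl : l < F.clauses[j].length), F.input.getD (pos + (l + 1)) 0 =
        2 * (F.clauses[j][l].1 : ℕ) + F.clauses[j][l].2.toNat) ∧
      pos + (F.clauses[j].length + 1) ≤ F.input.length ∧
      F.input.drop (pos + (F.clauses[j].length + 1)) =
        (F.clauses.drop (j + 1)).flatMap clauseWords := by
  rw [drop_flatMap_clauseWords hj] at h
  have hget : ∀ i, F.input.getD (pos + i) 0 = (F.input.drop pos).getD i 0 := by
    intro i
    rw [List.getD_eq_getElem?_getD, List.getD_eq_getElem?_getD, List.getElem?_drop]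
  refine ⟨?_, fun l hl => ?_, ?_, ?_⟩
  · have := hget 0
    rw [add_zero] at this
    rw [this, h]
    rfl
  · rw [hget, h, List.getD_cons_succ, List.getD_append _ _ _ _ (by simpa using hl),
      List.getD_eq_getElem _ _ (by simpa using hl), List.getElem_map]
  · have := congrArg List.length h
    simp only [List.length_drop, List.length_cons, List.length_append, List.length_map] at this
    omega
  · rw [← List.drop_drop, h, List.drop_succ_cons, List.drop_append_of_le_length (by simp)]
    simp

theorem le_length_input (F : CNF) : F.m + 2 ≤ F.input.length := by
  rw [input_eq, List.length_cons, List.length_cons, List.length_flatMap]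
  have := List.length_le_sum_of_one_le (F.clauses.map fun C => (clauseWords C).length) ?_
  · rw [List.length_map] at this
    exact Nat.add_le_add_right this 2
  · intro x hx
    obtain ⟨C, hC, rfl⟩ := List.mem_map.1 hx
    simp [clauseWords]

theorem length_input_le (F : CNF) : F.input.length ≤ 2 + F.m * (2 * F.n + 1) := by
  rw [input_eq, List.length_cons, List.length_cons, List.length_flatMap]
  have := List.sum_le_card_nsmul (F.clauses.map fun C => (clauseWords C).length) (2 * F.n + 1) ?_
  · rw [List.length_map, smul_eq_mul] at this
    change _ ≤ 2 + F.clauses.length * _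
    omega
  · intro x hx
    obtain ⟨C, hC, rfl⟩ := List.mem_map.1 hx
    have := List.length_le_of_nodup_literals (F.nodup C hC)
    simp only [clauseWords, List.length_cons, List.length_map]
    omega

end CNF

/-! ### Arithmetic without overflow, and the evaluation of a clause. -/

namespace WordRAM

theorem Runs.block_le {J : ℕ → Bool} (hJ : HasTemps J) {w : ℕ} {l : List Instr} {s : State} {T : ℕ}
    (hl : l.all (·.avoids J) = true) (hT : blockCost l ≤ T) {R : State → Prop}
    (hR : R (runBlock w l s)) : Runs J w (WordRAM.block l) s T R :=
  (Runs.block hJ hl hR).mono hT fun _ h => h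

theorem Runs.forLoop_le {J : ℕ → Bool} (hJ : HasTemps J) {w : ℕ} {x : ℕ} {e : Expr} {p : Prog}
    {s : State} (hx : J x = false) (he : e.avoids J = true) {n T T' : ℕ} (hn : n < 2 ^ w)
    (I : ℕ → State → Prop) (h0 : I 0 (s.setReg x 0))
    (hxI : ∀ i s, i ≤ n → I i s → s.reg x = i ∧ e.eval w s = n)
    (hstep : ∀ i s, i < n → I i s → Runs J w p s T fun s' => s'.reg x = i ∧
      I (i + 1) (s'.setReg x (i + 1))) (hT : n * (T + e.cost + 6) + e.cost + 4 ≤ T') :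
    Runs J w (WordRAM.forLoop x e p) s T' (I n) :=
  (Runs.forLoop hJ hx he hn I h0 hxI hstep).mono hT fun _ h => h

theorem Op.eval_add {w x y : ℕ} (h : x + y < 2 ^ w) : Op.eval w .add x y = x + y :=
  Nat.mod_eq_of_lt h

theorem Op.eval_mul {w x y : ℕ} (h : x * y < 2 ^ w) : Op.eval w .mul x y = x * y :=
  Nat.mod_eq_of_lt h

theorem Op.eval_sub {w x y : ℕ} (h : y ≤ x) (hx : x < 2 ^ w) : Op.eval w .sub x y = x - y := by
  rw [Op.eval, show x + (2 ^ w - y) = x - y + 2 ^ w by omega, Nat.add_mod_right,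
    Nat.mod_eq_of_lt (by omega)]

theorem Op.eval_div {w x y : ℕ} (hx : x < 2 ^ w) : Op.eval w .div x y = x / y :=
  Nat.mod_eq_of_lt ((Nat.div_le_self _ _).trans_lt hx)

theorem Op.eval_mod {w x y : ℕ} (hx : x < 2 ^ w) : Op.eval w .mod x y = x % y :=
  Nat.mod_eq_of_lt ((Nat.mod_le _ _).trans_lt hx)

theorem Op.eval_shr {w x y : ℕ} (hx : x < 2 ^ w) : Op.eval w .shr x y = x / 2 ^ y :=
  Nat.mod_eq_of_lt ((Nat.div_le_self _ _).trans_lt hx)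

theorem Op.eval_shl {w x y : ℕ} (hx : x * 2 ^ y < 2 ^ w) : Op.eval w .shl x y = x * 2 ^ y :=
  Nat.mod_eq_of_lt hx

theorem Op.eval_lt {w x y : ℕ} (hw : 1 < 2 ^ w) :
    Op.eval w .lt x y = (decide (x < y)).toNat := by
  by_cases h : x < y <;> simp [Op.eval, h, Nat.mod_eq_of_lt hw]

theorem Op.eval_eq {w x y : ℕ} (hw : 1 < 2 ^ w) :
    Op.eval w .eq x y = (decide (x = y)).toNat := by
  by_cases h : x = y <;> simp [Op.eval, h, Nat.mod_eq_of_lt hw]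

theorem Op.eval_band {w : ℕ} (hw : 1 < 2 ^ w) (a b : Bool) :
    Op.eval w .band a.toNat b.toNat = (a && b).toNat := by
  cases a <;> cases b <;> simp [Op.eval, Nat.mod_eq_of_lt hw]

theorem Op.eval_bor {w : ℕ} (hw : 1 < 2 ^ w) (a b : Bool) :
    Op.eval w .bor a.toNat b.toNat = (a || b).toNat := by
  cases a <;> cases b <;> simp [Op.eval, Nat.mod_eq_of_lt hw]

theorem Op.eval_band_one {w x : ℕ} (hw : 1 < 2 ^ w) : Op.eval w .band x 1 = x % 2 := by
  rw [Op.eval, Nat.and_one_is_mod, Nat.mod_eq_of_lt (by omega)]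

/-- The temporary registers. -/
def temps (r : ℕ) : Bool := decide (64 < r) && decide (r % 2 = 1)

/-- The temporary registers and the ones used in the evaluation of clauses and in the output of
edges. -/
def scratch (r : ℕ) : Bool := temps r || (decide (24 ≤ r) && decide (r ≠ 27) && decide (r ≠ 28) &&
  decide (r ≠ 29) && decide (r < 40))

theorem hasTemps_temps : HasTemps temps := fun d => by
  simp only [temps, Bool.and_eq_true, decide_eq_true_eq]
  omega

theorem hasTemps_scratch : HasTemps scratch := fun d => by
  rw [scratch, hasTemps_temps d]
  rfl

theorem scratch_of_temps : ∀ r, temps r = true → scratch r = true := fun r h => by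
  rw [scratch, h]
  rfl

namespace Expr

/-- `a + b` -/
abbrev add (a b : Expr) : Expr := bin .add a b
/-- `a * b` -/
abbrev mul (a b : Expr) : Expr := bin .mul a b

end Expr

open WordRAM.Expr

/-- Register `28` becomes `1` or `0` according to whether the assignment given by the bits of `a`
satisfies clause number `c` by a variable in `[lo, hi)`. -/
def satProg (a lo hi c : Expr) : Prog :=
  .seq (block [.op 36 .add a (lit 0), .op 37 .add lo (lit 0), .op 38 .add hi (lit 0),
    .op 39 .add c (lit 0), .lit 30 2])
  (.seq (forLoop 34 (var 39) (block [.op 30 .add (var 30) (add (get 0 (var 30)) (lit 1))]))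
  (.seq (block [.lit 28 0, .get 35 0 (var 30)])
  (forLoop 31 (var 35) (block [.get 33 0 (add (var 30) (add (var 31) (lit 1))),
    .op 28 .bor (var 28) (bin .band
      (bin .band (bin .eq (bin .lt (bin .shr (var 33) (lit 1)) (var 37)) (lit 0))
        (bin .lt (bin .shr (var 33) (lit 1)) (var 38)))
      (bin .eq (bin .band (bin .shr (var 36) (bin .shr (var 33) (lit 1))) (lit 1))
        (bin .band (var 33) (lit 1))))]))))

theorem Expr.avoids_mono {J J' : ℕ → Bool} (hJ : ∀ r, J r = true → J' r = true) {e : Expr}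
    (he : e.avoids J' = true) : e.avoids J = true := by
  induction e with
  | var x =>
    simp only [Expr.avoids, Bool.not_eq_true'] at he ⊢
    cases h : J x
    · rfl
    · rw [hJ x h] at he
      exact absurd he (by simp)
  | lit c => rfl
  | bin o a b iha ihb =>
    simp only [Expr.avoids, Bool.and_eq_true] at he ⊢
    exact ⟨iha he.1, ihb he.2⟩
  | get A i ih => exact ih he

/-- In the word `2 * i + b` of a literal the shift by one gives the variable and the lowest bit
gives the sign. The test `lo ≤ i` is expressed by comparing the bit of `i < lo` with 0. -/
theorem literal_eval {w a lo hi i : ℕ} {b : Bool} (hw : 2 < 2 ^ w) (ha : a < 2 ^ w)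
    (hi' : 2 * i + b.toNat < 2 ^ w) :
    Op.eval w .band
      (Op.eval w .band (Op.eval w .eq (Op.eval w .lt (Op.eval w .shr (2 * i + b.toNat) 1) lo) 0)
        (Op.eval w .lt (Op.eval w .shr (2 * i + b.toNat) 1) hi))
      (Op.eval w .eq (Op.eval w .band (Op.eval w .shr a (Op.eval w .shr (2 * i + b.toNat) 1)) 1)
        (Op.eval w .band (2 * i + b.toNat) 1)) =
      (decide (lo ≤ i) && decide (i < hi) && (a.testBit i == b)).toNat := by
  have hb := Bool.toNat_lt b
  have h1 : Op.eval w .shr (2 * i + b.toNat) 1 = i := by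
    rw [Op.eval_shr hi', pow_one]
    omega
  have hw1 : 1 < 2 ^ w := by omega
  rw [h1, Op.eval_lt hw1, Op.eval_eq hw1, Op.eval_lt hw1, Op.eval_band hw1, Op.eval_shr ha,
    Op.eval_band_one hw1, Op.eval_band_one hw1, Op.eval_eq hw1, Op.eval_band hw1]
  congr 2
  · congr 1
    by_cases h : i < lo
    · simp [h]
    · simp [h, not_lt.1 h]
  · rw [Nat.mul_add_mod, Nat.mod_eq_of_lt (a := b.toNat) hb, Nat.testBit_eq_decide_div_mod_eq]
    rcases Nat.mod_two_eq_zero_or_one (a / 2 ^ i) with h | h <;> cases b <;> simp [h]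

theorem run_copy {w x v : ℕ} {e : Expr} {s : State} (h : e.eval w s = v) (hv : v < 2 ^ w) :
    Instr.run w s (.op x .add e (Expr.lit 0)) = s.setReg x v := by
  rw [Instr.run, h, Expr.eval, Nat.zero_mod, Op.eval_add (by omega), add_zero]

/-- Clause records have different lengths, so the program walks along the lengths from the start of
the input to the clause and then takes the disjunction over its literals. Both loops are linear,
since a clause without repetitions has at most `2 * F.n` literals. -/
theorem runs_satProg {w : ℕ} {F : CNF} {a lo hi c : Expr} {s : State}
    (hmem : ∀ i, s.mem 0 i = F.input.getD i 0) (hw : F.input.length < 2 ^ w)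
    (hnw : 2 * F.n + 2 < 2 ^ w) (ha : a.avoids scratch = true) (hlo : lo.avoids scratch = true)
    (hhi : hi.avoids scratch = true) (hc : c.avoids scratch = true)
    (haw : a.eval w s < 2 ^ w) (hlow : lo.eval w s < 2 ^ w) (hhiw : hi.eval w s < 2 ^ w)
    (hcm : c.eval w s < F.clauses.length) {R : State → Prop}
    (hR : R (s.setReg 28 (partSat (a.eval w s) (lo.eval w s) (hi.eval w s)
      F.clauses[c.eval w s]).toNat)) :
    Runs scratch w (satProg a lo hi c) s
      (a.cost + lo.cost + hi.cost + c.cost + 100 * (F.m + F.n + 1)) R := by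
  obtain ⟨av, hav⟩ : ∃ v, v = a.eval w s := ⟨_, rfl⟩
  obtain ⟨lv, hlv⟩ : ∃ v, v = lo.eval w s := ⟨_, rfl⟩
  obtain ⟨hv, hhv⟩ : ∃ v, v = hi.eval w s := ⟨_, rfl⟩
  obtain ⟨cv, hcv⟩ : ∃ v, v = c.eval w s := ⟨_, rfl⟩
  simp only [← hav, ← hlv, ← hhv, ← hcv] at haw hlow hhiw hcm hR
  have hmono := @Expr.avoids_mono temps scratch scratch_of_temps
  have hw2 : 2 < 2 ^ w := by omega
  have hcle : cv < F.input.length := hcm.trans (by have := F.le_length_input; rw [CNF.m] at this; omega)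
  have hclen := List.length_le_of_nodup_literals (F.nodup _ (List.getElem_mem hcm))
  set C := F.clauses[cv] with hC
  -- Inside the program only the odd temporaries are unknown. Its working registers become unknown
  -- on leaving it, so that the caller sees a change of register `28` alone.
  refine Runs.forget scratch_of_temps (s₁ := s.setReg 28 (partSat av lv hv C).toNat) ?_ hR
  intro s₀ hs₀
  have hvals : ∀ s₁, Agree scratch s₁ s →
      a.eval w s₁ = av ∧ lo.eval w s₁ = lv ∧ hi.eval w s₁ = hv ∧ c.eval w s₁ = cv := fun s₁ h =>
    ⟨hav ▸ Expr.eval_congr h ha, hlv ▸ Expr.eval_congr h hlo, hhv ▸ Expr.eval_congr h hhi,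
      hcv ▸ Expr.eval_congr h hc⟩
  have j36 : scratch 36 = true := rfl
  have j37 : scratch 37 = true := rfl
  have j38 : scratch 38 = true := rfl
  have j39 : scratch 39 = true := rfl
  have j30 : scratch 30 = true := rfl
  have j34 : scratch 34 = true := rfl
  have j35 : scratch 35 = true := rfl
  have j31 : scratch 31 = true := rfl
  have j33 : scratch 33 = true := rfl
  have part₁ : Runs temps w (block [.op 36 .add a (lit 0), .op 37 .add lo (lit 0),
      .op 38 .add hi (lit 0), .op 39 .add c (lit 0), .lit 30 2]) s₀
      (a.cost + lo.cost + hi.cost + c.cost + 10) fun s₁ =>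
      Agree scratch s₁ s ∧ s₁.reg 36 = av ∧ s₁.reg 37 = lv ∧ s₁.reg 38 = hv ∧ s₁.reg 39 = cv ∧
        s₁.reg 30 = 2 := by
    refine Runs.block_le hasTemps_temps (by simp [Instr.avoids, Expr.avoids, hmono, *])
      (by simp only [blockCost, Instr.cost, Expr.cost]; omega) ?_
    have a₁ := hs₀.setReg_left av j36
    have a₂ := a₁.setReg_left lv j37
    have a₃ := a₂.setReg_left hv j38
    have a₄ := a₃.setReg_left cv j39
    simp only [runBlock]
    rw [run_copy (hvals _ hs₀).1 haw, run_copy (hvals _ a₁).2.1 hlow,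
      run_copy (hvals _ a₂).2.2.1 hhiw, run_copy (hvals _ a₃).2.2.2 (hcle.trans hw)]
    refine ⟨a₄.setReg_left _ j30, ?_⟩
    simp [Instr.run, State.setReg_reg, Nat.mod_eq_of_lt hw2]
  -- Register `30` points to the record of clause `i`; this is expressed by the remaining input,
  -- which determines the lengths still to be read.
  let I₁ : ℕ → State → Prop := fun i s₁ => Agree scratch s₁ s ∧ s₁.reg 36 = av ∧ s₁.reg 37 = lv ∧
    s₁.reg 38 = hv ∧ s₁.reg 39 = cv ∧ s₁.reg 34 = i ∧
      F.input.drop (s₁.reg 30) = (F.clauses.drop i).flatMap clauseWords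
  have part₂ : ∀ s₁, (Agree scratch s₁ s ∧ s₁.reg 36 = av ∧ s₁.reg 37 = lv ∧ s₁.reg 38 = hv ∧
      s₁.reg 39 = cv ∧ s₁.reg 30 = 2) → Runs temps w (forLoop 34 (var 39)
        (block [.op 30 .add (var 30) (add (get 0 (var 30)) (lit 1))])) s₁
        (cv * (7 + 1 + 6) + 1 + 4) (I₁ cv) := by
    rintro s₁ ⟨a₁, h36, h37, h38, h39, h30⟩
    refine Runs.forLoop hasTemps_temps rfl rfl (hcle.trans hw) I₁ ?_ ?_ ?_
    · refine ⟨a₁.setReg_left _ j34, ?_⟩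
      simp [State.setReg_reg, h36, h37, h38, h39, h30, CNF.input_eq]
    · rintro i s₂ hi ⟨-, -, -, -, h39, h34, -⟩
      exact ⟨h34, h39⟩
    · rintro i s₂ hi ⟨a₂, h36, h37, h38, h39, h34, h30⟩
      obtain ⟨g1, -, g3, g4⟩ := F.clause_at (hi.trans hcm) h30
      refine Runs.block_le hasTemps_temps rfl (by decide) ?_
      have hval : Op.eval w .add (s₂.reg 30) (Op.eval w .add (s₂.mem 0 (s₂.reg 30)) (1 % 2 ^ w)) =
          s₂.reg 30 + ((F.clauses[i]'(hi.trans hcm)).length + 1) := by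
        rw [a₂.mem, hmem, g1, Nat.mod_eq_of_lt (by omega : 1 < 2 ^ w),
          Op.eval_add (show (F.clauses[i]'(hi.trans hcm)).length + 1 < 2 ^ w by omega),
          Op.eval_add (by omega)]
      simp only [runBlock, Instr.run, Expr.eval, hval]
      refine ⟨by simp [State.setReg_reg, h34], (a₂.setReg_left _ j30).setReg_left _ j34, ?_⟩
      simp [State.setReg_reg, h36, h37, h38, h39, g4]
  have part₃ : ∀ s₁, I₁ cv s₁ → Runs temps w (block [.lit 28 0, .get 35 0 (var 30)]) s₁ 4
      fun s₂ => Agree scratch s₂ (s.setReg 28 0) ∧ s₂.reg 36 = av ∧ s₂.reg 37 = lv ∧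
        s₂.reg 38 = hv ∧ s₂.reg 35 = C.length ∧
        F.input.drop (s₂.reg 30) = (F.clauses.drop cv).flatMap clauseWords := by
    rintro s₁ ⟨a₁, h36, h37, h38, -, -, h30⟩
    refine Runs.block_le hasTemps_temps rfl (by decide) ?_
    simp only [runBlock, Instr.run, Expr.eval, Nat.zero_mod]
    refine ⟨(a₁.setReg 28 0).setReg_left _ j35, ?_⟩
    have g1 := (F.clause_at hcm h30).1
    rw [← hC, List.getD_eq_getElem?_getD] at g1
    simp [State.setReg_reg, h36, h37, h38, h30, a₁.mem, hmem, g1]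
  let I₂ : ℕ → State → Prop := fun i s₂ =>
    Agree scratch s₂ (s.setReg 28 (partSat av lv hv (C.take i)).toNat) ∧ s₂.reg 36 = av ∧
      s₂.reg 37 = lv ∧ s₂.reg 38 = hv ∧ s₂.reg 35 = C.length ∧ s₂.reg 31 = i ∧
        F.input.drop (s₂.reg 30) = (F.clauses.drop cv).flatMap clauseWords
  have part₄ : ∀ s₂, (Agree scratch s₂ (s.setReg 28 0) ∧ s₂.reg 36 = av ∧ s₂.reg 37 = lv ∧
        s₂.reg 38 = hv ∧ s₂.reg 35 = C.length ∧
        F.input.drop (s₂.reg 30) = (F.clauses.drop cv).flatMap clauseWords) →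
      Runs temps w (forLoop 31 (var 35) (block [.get 33 0 (add (var 30) (add (var 31) (lit 1))),
    .op 28 .bor (var 28) (bin .band
      (bin .band (bin .eq (bin .lt (bin .shr (var 33) (lit 1)) (var 37)) (lit 0))
        (bin .lt (bin .shr (var 33) (lit 1)) (var 38)))
      (bin .eq (bin .band (bin .shr (var 36) (bin .shr (var 33) (lit 1))) (lit 1))
        (bin .band (var 33) (lit 1))))])) s₂
        (C.length * (34 + 1 + 6) + 1 + 4) (I₂ C.length) := by
    rintro s₂ ⟨a₂, h36, h37, h38, h35, h30⟩
    refine Runs.forLoop hasTemps_temps rfl rfl (by omega) I₂ ?_ ?_ ?_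
    · refine ⟨a₂.setReg_left _ j31, ?_⟩
      simp [State.setReg_reg, h36, h37, h38, h35, h30]
    · rintro i s₂ hi ⟨-, -, -, -, h35, h31, -⟩
      exact ⟨h31, h35⟩
    · rintro i s₃ hi ⟨a₃, h36, h37, h38, h35, h31, h30⟩
      obtain ⟨-, g2, g3, -⟩ := F.clause_at hcm h30
      rw [← hC] at g3
      have g2 := g2 i (hC ▸ hi)
      simp only [← hC] at g2
      refine Runs.block_le hasTemps_temps rfl (by decide) ?_
      have hpos : Op.eval w .add (s₃.reg 30) (Op.eval w .add (s₃.reg 31) 1) =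
          s₃.reg 30 + (i + 1) := by
        rw [h31, Op.eval_add (show i + 1 < 2 ^ w by omega), Op.eval_add (by omega)]
      have h28 : s₃.reg 28 = (partSat av lv hv (C.take i)).toNat := by
        rw [a₃.reg 28 rfl, State.setReg_reg, if_pos rfl]
      have hb := Bool.toNat_lt (C[i].2)
      have hlit := literal_eval (lo := lv) (hi := hv) (i := C[i].1) (b := C[i].2) hw2 haw
        (by have := C[i].1.2; omega)
      have htake : partSat av lv hv (C.take (i + 1)) = (partSat av lv hv (C.take i) ||
          (decide (lv ≤ (C[i].1 : ℕ)) && decide ((C[i].1 : ℕ) < hv) &&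
            (av.testBit C[i].1 == C[i].2))) := by
        rw [partSat, partSat, ← List.take_concat_get' C i hi, List.any_append, List.any_cons,
          List.any_nil, Bool.or_false]
      have hget : s₃.mem 0 (s₃.reg 30 + (i + 1)) = 2 * (C[i].1 : ℕ) + C[i].2.toNat := by
        rw [a₃.mem, State.setReg_mem, hmem, g2]
      simp only [runBlock, Instr.run, Expr.eval, hpos, State.setReg_reg, hget, Nat.reduceEqDiff,
        if_true, if_false, h36, h37, h38, h28, Nat.zero_mod,
        Nat.mod_eq_of_lt (by omega : 1 < 2 ^ w), hlit, Op.eval_bor (by omega : 1 < 2 ^ w), ← htake]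
      refine ⟨h31, ⟨fun r hr => ?_, a₃.mem⟩, ?_⟩
      · have h := a₃.reg r hr
        have h33 : r ≠ 33 := by rintro rfl; exact absurd hr (by decide)
        have h31 : r ≠ 31 := by rintro rfl; exact absurd hr (by decide)
        simp only [State.setReg_reg] at h ⊢
        rw [if_neg h31, if_neg h33]
        by_cases h28 : r = 28
        · rw [if_pos h28, if_pos h28]
        · rwa [if_neg h28, if_neg h28] at *
      · simp [State.setReg_reg, h36, h37, h38, h35, h30]
  refine Runs.mono (Runs.seq part₁ fun s₁ h₁ => Runs.seq (part₂ s₁ h₁) fun s₂ h₂ =>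
    Runs.seq (part₃ s₂ h₂) fun s₃ h₃ => part₄ s₃ h₃) ?_ ?_
  · rw [CNF.m]
    omega
  · rintro s' ⟨h, -⟩
    rwa [List.take_length] at h

end WordRAM

namespace WordRAM

open WordRAM.Expr

/-! ## Writing the list of edges -/

/-- The words of a list of edges. -/
def edgeWords (L : List (ℕ × ℕ × ℕ)) : List ℕ := L.flatMap fun e => [e.1, e.2.1, e.2.2]

theorem length_edgeWords (L : List (ℕ × ℕ × ℕ)) : (edgeWords L).length = 3 * L.length := by
  simp [edgeWords, mul_comm]

theorem getD_edgeWords_concat (L : List (ℕ × ℕ × ℕ)) (e : ℕ × ℕ × ℕ) (i : ℕ) :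
    (edgeWords (L ++ [e])).getD i 0 = if i = 3 * L.length then e.1 else
      if i = 3 * L.length + 1 then e.2.1 else if i = 3 * L.length + 2 then e.2.2 else
        (edgeWords L).getD i 0 := by
  have h : edgeWords (L ++ [e]) = edgeWords L ++ [e.1, e.2.1, e.2.2] := by simp [edgeWords]
  have hl := length_edgeWords L
  rw [h]
  by_cases hi : i < 3 * L.length
  · rw [List.getD_append _ _ _ _ (by omega), if_neg (by omega), if_neg (by omega),
      if_neg (by omega)]
  · obtain ⟨d, rfl⟩ := Nat.exists_eq_add_of_le (not_lt.1 hi)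
    rw [List.getD_append_right _ _ _ _ (by omega), hl, Nat.add_sub_cancel_left,
      List.getD_eq_default (edgeWords L) 0 (by omega)]
    rcases d with _ | _ | _ | d <;> simp

/-- The state after an edge is appended to the list of edges in the simulated array `0`. -/
def State.pushEdge (s : State) (e : ℕ × ℕ × ℕ) : State :=
  if e.2.2 = 0 then s else
    ((((((s.setMem 2 (3 * s.reg 17 + 3) e.1).setMem 3 (3 * s.reg 17 + 3) (s.reg 13)).setMem
      2 (3 * s.reg 17 + 4) e.2.1).setMem 3 (3 * s.reg 17 + 4) (s.reg 13)).setMem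
      2 (3 * s.reg 17 + 5) e.2.2).setMem 3 (3 * s.reg 17 + 5) (s.reg 13)).setReg
      17 (s.reg 17 + 1)

/-- Append an edge to the list of edges, unless its capacity is zero. -/
def emit (e : Expr × Expr × Expr) : Prog :=
  .seq (block [.op 24 .add e.1 (lit 0), .op 25 .add e.2.1 (lit 0), .op 26 .add e.2.2 (lit 0)])
    (cond (var 26) (block [
      .put 2 (add (mul (lit 3) (var 17)) (lit 3)) (var 24),
      .put 3 (add (mul (lit 3) (var 17)) (lit 3)) (var 13),
      .put 2 (add (mul (lit 3) (var 17)) (lit 4)) (var 25),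
      .put 3 (add (mul (lit 3) (var 17)) (lit 4)) (var 13),
      .put 2 (add (mul (lit 3) (var 17)) (lit 5)) (var 26),
      .put 3 (add (mul (lit 3) (var 17)) (lit 5)) (var 13),
      .op 17 .add (var 17) (lit 1)]) (block []))

/-- Tail, head and capacity are copied before the test, so each expression is evaluated only once
and before register `17` changes. The bound on register `17` keeps the cell addresses below the word
size. -/
theorem runs_emit {w : ℕ} {s : State} {e : Expr × Expr × Expr} {v : ℕ × ℕ × ℕ}
    (h₁ : e.1.avoids scratch = true) (h₂ : e.2.1.avoids scratch = true)
    (h₃ : e.2.2.avoids scratch = true) (e₁ : e.1.eval w s = v.1) (e₂ : e.2.1.eval w s = v.2.1)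
    (e₃ : e.2.2.eval w s = v.2.2) (v₁ : v.1 < 2 ^ w) (v₂ : v.2.1 < 2 ^ w) (v₃ : v.2.2 < 2 ^ w)
    (hcnt : 3 * s.reg 17 + 5 < 2 ^ w) {R : State → Prop} (hR : R (s.pushEdge v)) :
    Runs scratch w (emit e) s (e.1.cost + e.2.1.cost + e.2.2.cost + 100) R := by
  refine Runs.forget scratch_of_temps ?_ hR
  intro s₀ hs₀
  have j24 : scratch 24 = true := rfl
  have j25 : scratch 25 = true := rfl
  have j26 : scratch 26 = true := rfl
  have hmono := @Expr.avoids_mono temps scratch scratch_of_temps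
  have part₁ : Runs temps w (block [.op 24 .add e.1 (lit 0), .op 25 .add e.2.1 (lit 0),
      .op 26 .add e.2.2 (lit 0)]) s₀ (e.1.cost + e.2.1.cost + e.2.2.cost + 7) fun s₁ =>
      Agree scratch s₁ s ∧ s₁.reg 24 = v.1 ∧ s₁.reg 25 = v.2.1 ∧ s₁.reg 26 = v.2.2 := by
    refine Runs.block_le hasTemps_temps (by simp [Instr.avoids, Expr.avoids, hmono, *])
      (by simp only [blockCost, Instr.cost, Expr.cost]; omega) ?_
    have a₁ := hs₀.setReg_left v.1 j24
    have a₂ := a₁.setReg_left v.2.1 j25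
    simp only [runBlock]
    rw [run_copy ((Expr.eval_congr hs₀ h₁).trans e₁) v₁,
      run_copy ((Expr.eval_congr a₁ h₂).trans e₂) v₂,
      run_copy ((Expr.eval_congr a₂ h₃).trans e₃) v₃]
    refine ⟨a₂.setReg_left _ j26, ?_⟩
    simp [State.setReg_reg]
  refine Runs.mono (T := e.1.cost + e.2.1.cost + e.2.2.cost + 7 + (1 + 1 + 60))
    (Runs.seq part₁ ?_) (by omega) fun _ h => h
  rintro s₁ ⟨a₁, h24, h25, h26⟩
  have h17 : s₁.reg 17 = s.reg 17 := a₁.reg 17 rfl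
  have h13 : s₁.reg 13 = s.reg 13 := a₁.reg 13 rfl
  have hv : (var 26).eval w s₁ = v.2.2 := h26
  refine Runs.cond hasTemps_temps rfl (fun h0 => ?_) (fun h0 => ?_)
  · refine Runs.block_le hasTemps_temps rfl (by decide) ?_
    have hm : Op.eval w .mul 3 (s.reg 17) = 3 * s.reg 17 := Op.eval_mul (by omega)
    simp only [runBlock, Instr.run, Expr.eval, State.setMem_reg, h17, h13, h24, h25, h26, hm,
      Nat.mod_eq_of_lt (show 3 < 2 ^ w by omega), Nat.mod_eq_of_lt (show 4 < 2 ^ w by omega),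
      Nat.mod_eq_of_lt (show 5 < 2 ^ w by omega), Nat.mod_eq_of_lt (show 1 < 2 ^ w by omega),
      Op.eval_add (show 3 * s.reg 17 + 3 < 2 ^ w by omega),
      Op.eval_add (show 3 * s.reg 17 + 4 < 2 ^ w by omega),
      Op.eval_add (show 3 * s.reg 17 + 5 < 2 ^ w by omega),
      Op.eval_add (show s.reg 17 + 1 < 2 ^ w by omega)]
    rw [State.pushEdge, if_neg (by rwa [hv] at h0)]
    exact ((((((a₁.setMem _ _ _).setMem _ _ _).setMem _ _ _).setMem _ _ _).setMem _ _ _).setMem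
      _ _ _).setReg _ _
  · refine Runs.block_le hasTemps_temps rfl (by decide) ?_
    rw [State.pushEdge, if_pos (by rwa [hv] at h0)]
    exact a₁

/-- The simulated array `0` contains the list `L` of edges from cell `3` on, and otherwise the
simulated memory is empty. -/
structure Holds (L : List (ℕ × ℕ × ℕ)) (s : State) : Prop where
  count : s.reg 17 = L.length
  cell : ∀ B j, s.stamped B j = if B = 0 ∧ 3 ≤ j then (edgeWords L).getD (j - 3) 0 else 0
  stamp : ∀ B j, s.mem (3 + 2 * B) j ≤ s.reg 13

theorem State.stamped_setReg (s : State) {r v : ℕ} (hr : r ≠ 13) (A i : ℕ) :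
    (s.setReg r v).stamped A i = s.stamped A i := by
  simp only [State.stamped, State.setReg_mem, State.setReg_reg]
  rw [if_neg (Ne.symm hr)]

theorem Holds.setReg {L : List (ℕ × ℕ × ℕ)} {s : State} (h : Holds L s) {r : ℕ} (v : ℕ)
    (h13 : r ≠ 13) (h17 : r ≠ 17) : Holds L (s.setReg r v) := by
  refine ⟨?_, fun B j => ?_, fun B j => ?_⟩
  · rw [State.setReg_reg, if_neg (Ne.symm h17), h.count]
  · rw [State.stamped_setReg _ h13, h.cell]
  · rw [State.setReg_reg, if_neg (Ne.symm h13)]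
    exact h.stamp B j

theorem Holds.pushEdge {L : List (ℕ × ℕ × ℕ)} {s : State} (h : Holds L s) (e : ℕ × ℕ × ℕ) :
    Holds (L ++ [e].filter fun e => e.2.2 ≠ 0) (s.pushEdge e) := by
  rw [State.pushEdge]
  split_ifs with h0
  · simpa [h0] using h
  · have hf : ([e].filter fun e => e.2.2 ≠ 0) = [e] := by simp [h0]
    rw [hf]
    refine ⟨by simp [State.setReg_reg, h.count], fun B j => ?_, fun B j => ?_⟩
    · rw [State.stamped_setReg _ (by norm_num)]
      have k₁ := State.stamped_store s 0 (3 * s.reg 17 + 3) e.1 B j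
      have k₂ := State.stamped_store ((s.setMem 2 (3 * s.reg 17 + 3) e.1).setMem 3
        (3 * s.reg 17 + 3) (s.reg 13)) 0 (3 * s.reg 17 + 4) e.2.1 B j
      have k₃ := State.stamped_store ((((s.setMem 2 (3 * s.reg 17 + 3) e.1).setMem 3
        (3 * s.reg 17 + 3) (s.reg 13)).setMem 2 (3 * s.reg 17 + 4) e.2.1).setMem 3
        (3 * s.reg 17 + 4) (s.reg 13)) 0 (3 * s.reg 17 + 5) e.2.2 B j
      refine k₃.trans ?_
      rw [show (((s.setMem 2 (3 * s.reg 17 + 3) e.1).setMem 3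
        (3 * s.reg 17 + 3) (s.reg 13)).setMem 2 (3 * s.reg 17 + 4) e.2.1).setMem 3
        (3 * s.reg 17 + 4) (s.reg 13) = ((((s.setMem 2 (3 * s.reg 17 + 3) e.1).setMem 3
        (3 * s.reg 17 + 3) (s.reg 13)).setMem (2 + 2 * 0) (3 * s.reg 17 + 4) e.2.1).setMem
        (3 + 2 * 0) (3 * s.reg 17 + 4) (((s.setMem 2 (3 * s.reg 17 + 3) e.1).setMem 3
        (3 * s.reg 17 + 3) (s.reg 13)).reg 13)) from rfl, k₂,
        show ((s.setMem 2 (3 * s.reg 17 + 3) e.1).setMem 3 (3 * s.reg 17 + 3) (s.reg 13)) =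
          ((s.setMem (2 + 2 * 0) (3 * s.reg 17 + 3) e.1).setMem (3 + 2 * 0) (3 * s.reg 17 + 3)
            (s.reg 13)) from rfl, k₁, h.cell, getD_edgeWords_concat, h.count]
      by_cases hB : B = 0
      · subst hB
        by_cases h3 : 3 ≤ j
        · obtain ⟨i, rfl⟩ := Nat.exists_eq_add_of_le h3
          simp only [Nat.add_sub_cancel_left, h3, and_self, true_and, if_true]
          split_ifs <;> first | rfl | omega
        · simp only [h3, and_false, if_false, true_and]
          rw [if_neg (by omega), if_neg (by omega), if_neg (by omega)]
      · simp [hB]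
    · have := h.stamp B j
      simp only [State.setReg_mem, State.setReg_reg, State.setMem_mem, State.setMem_reg]
      simp only [Nat.reduceEqDiff, if_false]
      split_ifs <;> omega

theorem State.pushEdge_reg (s : State) (e : ℕ × ℕ × ℕ) {r : ℕ} (hr : r ≠ 17) :
    (s.pushEdge e).reg r = s.reg r := by
  rw [State.pushEdge]
  split_ifs
  · rfl
  · simp [State.setReg_reg, hr]

theorem State.pushEdge_mem (s : State) (e : ℕ × ℕ × ℕ) {A : ℕ} (hA : A < 2) :
    (s.pushEdge e).mem A = s.mem A := by
  rw [State.pushEdge]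
  split_ifs
  · rfl
  · funext i
    simp only [State.setReg_mem, State.setMem_mem]
    rw [if_neg (by omega), if_neg (by omega), if_neg (by omega), if_neg (by omega),
      if_neg (by omega), if_neg (by omega)]

/-- Append edges to the list of edges. -/
def emits : List (Expr × Expr × Expr) → Prog
  | [] => block []
  | e :: l => .seq (emit e) (emits l)

/-- The number of steps of the output of edges. -/
def emitsCost : List (Expr × Expr × Expr) → ℕ
  | [] => 1
  | e :: l => e.1.cost + e.2.1.cost + e.2.2.cost + 100 + emitsCost l

/-- The values of the expressions are required in every state that differs from `b` only in the edge
counter, register `17`. This is the only register outside `scratch` that changes between one edge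
and the next. -/
theorem runs_emits {w : ℕ} {l : List (Expr × Expr × Expr)} {v : List (ℕ × ℕ × ℕ)} {b s : State}
    (hl : l.all (fun e => e.1.avoids scratch && e.2.1.avoids scratch && e.2.2.avoids scratch) = true)
    (hlv : List.Forall₂ (fun e v => ∀ s' : State, (∀ r, r ≠ 17 → s'.reg r = b.reg r) →
      e.1.eval w s' = v.1 ∧ e.2.1.eval w s' = v.2.1 ∧ e.2.2.eval w s' = v.2.2) l v)
    (hs : ∀ r, r ≠ 17 → s.reg r = b.reg r)
    (hv : ∀ e ∈ v, e.1 < 2 ^ w ∧ e.2.1 < 2 ^ w ∧ e.2.2 < 2 ^ w)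
    (hcnt : 3 * (s.reg 17 + v.length) + 5 < 2 ^ w) {R : State → Prop}
    (hR : R (v.foldl State.pushEdge s)) : Runs scratch w (emits l) s (emitsCost l) R := by
  induction hlv generalizing s with
  | nil => exact Runs.block hasTemps_scratch rfl hR
  | @cons e v l v' h h' ih =>
    simp only [List.all_cons, Bool.and_eq_true, List.length_cons] at hl hcnt
    obtain ⟨e₁, e₂, e₃⟩ := h s hs
    obtain ⟨v₁, v₂, v₃⟩ := hv v (by simp)
    refine Runs.seq (R₁ := fun s' => s' = s.pushEdge v)
      (runs_emit hl.1.1.1 hl.1.1.2 hl.1.2 e₁ e₂ e₃ v₁ v₂ v₃ (by omega) rfl) ?_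
    rintro _ rfl
    refine ih hl.2 (fun r hr => (State.pushEdge_reg _ _ hr).trans (hs r hr))
      (fun e he => hv e (List.mem_cons_of_mem _ he)) ?_ hR
    have : (s.pushEdge v).reg 17 ≤ s.reg 17 + 1 := by
      rw [State.pushEdge]
      split_ifs <;> simp [State.setReg_reg]
    omega

theorem Holds.foldl_pushEdge {L : List (ℕ × ℕ × ℕ)} {s : State} (h : Holds L s)
    (v : List (ℕ × ℕ × ℕ)) :
    Holds (L ++ v.filter fun e => e.2.2 ≠ 0) (v.foldl State.pushEdge s) := by
  induction v generalizing L s with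
  | nil => simpa using h
  | cons e v ih =>
    have := ih (h.pushEdge e)
    rwa [List.append_assoc, ← List.filter_append] at this

theorem State.foldl_pushEdge_reg (v : List (ℕ × ℕ × ℕ)) (s : State) {r : ℕ} (hr : r ≠ 17) :
    (v.foldl State.pushEdge s).reg r = s.reg r := by
  induction v generalizing s with
  | nil => rfl
  | cons e v ih => rw [List.foldl_cons, ih, State.pushEdge_reg _ _ hr]

theorem State.foldl_pushEdge_mem (v : List (ℕ × ℕ × ℕ)) (s : State) {A : ℕ} (hA : A < 2) :
    (v.foldl State.pushEdge s).mem A = s.mem A := by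
  induction v generalizing s with
  | nil => rfl
  | cons e v ih => rw [List.foldl_cons, ih, State.pushEdge_mem _ _ hA]

end WordRAM

/-! ## Constructing the network -/

namespace CNF

/-- The partial assignment `p` of the variables in `[0, h)` leaves clause `j` unsatisfied. -/
def unsatLow (F : CNF) (h p j : ℕ) : Bool := !partSat p 0 h (F.clauses.getD j [])

/-- The partial assignment `p` of the variables in `[2 * h, n)` leaves clause `j` unsatisfied. -/
def unsatHigh (F : CNF) (h p j : ℕ) : Bool :=
  !partSat (p * 2 ^ (2 * h)) (2 * h) F.n (F.clauses.getD j [])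

/-- The partial assignment `p` of the variables in `[h, 2 * h)` leaves clause `j` unsatisfied. -/
def unsatMid (F : CNF) (h p j : ℕ) : Bool := !partSat (p * 2 ^ h) h (2 * h) (F.clauses.getD j [])

/-- The edges of the network of a formula. -/
def edges (F : CNF) (h K : ℕ) : List (ℕ × ℕ × ℕ) :=
  edgeList (2 ^ h) F.m K (F.unsatLow h) (F.unsatHigh h) (F.unsatMid h)

/-- `m + n + 1` -/
def size (F : CNF) : ℕ := F.m + F.n + 1

end CNF

namespace WordRAM

open WordRAM.Expr

/-- The registers `1` to `8` contain the parameters of the construction, and array `0` contains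
the formula. -/
structure Setup (F : CNF) (h K N f : ℕ) (b : State) : Prop where
  n : b.reg 1 = F.n
  m : b.reg 2 = F.m
  W : b.reg 3 = F.m + 1
  Q : b.reg 4 = 2 ^ h
  half : b.reg 5 = h
  K : b.reg 6 = K
  N : b.reg 7 = N
  f : b.reg 8 = f
  mem₀ : ∀ i, b.mem 0 i = F.input.getD i 0
  mem₁ : ∀ i, b.mem 1 i = 0

/-- The numbers that occur in the computation are words. -/
structure Fits (w : ℕ) (F : CNF) (h K N f : ℕ) : Prop where
  input : F.input.length < 2 ^ w
  n : 2 * F.n + 2 < 2 ^ w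
  shift : 2 ^ (3 * h) < 2 ^ w
  assign : 2 ^ F.n < 2 ^ w
  half : 2 * h < 2 ^ w
  nodes : 8 * (F.m + 1) * 2 ^ h ≤ N
  N : N < 2 ^ w
  le_Q : K ≤ 2 ^ h
  cap : K * (F.m + 1) + F.m < 2 ^ w
  edges : 3 * (2 ^ h * (F.m * (7 + F.m))) + 8 < 2 ^ w
  f : 3 * f + 6 < 2 ^ w

/-- The registers below `14` and the arrays `0` and `1` are unchanged. -/
structure Keeps (b s : State) : Prop where
  reg : ∀ r < 14, s.reg r = b.reg r
  mem₀ : s.mem 0 = b.mem 0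
  mem₁ : s.mem 1 = b.mem 1

theorem Keeps.refl (s : State) : Keeps s s := ⟨fun _ _ => rfl, rfl, rfl⟩

theorem Keeps.trans {a b c : State} (h : Keeps a b) (h' : Keeps b c) : Keeps a c :=
  ⟨fun r hr => (h'.reg r hr).trans (h.reg r hr), h'.mem₀.trans h.mem₀, h'.mem₁.trans h.mem₁⟩

theorem Keeps.setReg {b s : State} (h : Keeps b s) {r : ℕ} (v : ℕ) (hr : 14 ≤ r) :
    Keeps b (s.setReg r v) := by
  refine ⟨fun q hq => ?_, h.mem₀, h.mem₁⟩
  rw [State.setReg_reg, if_neg (by omega), h.reg q hq]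

theorem Keeps.foldl_pushEdge {b s : State} (h : Keeps b s) (v : List (ℕ × ℕ × ℕ)) :
    Keeps b (v.foldl State.pushEdge s) :=
  ⟨fun r hr => (State.foldl_pushEdge_reg v s (by omega)).trans (h.reg r hr),
    (State.foldl_pushEdge_mem v s (by omega)).trans h.mem₀,
    (State.foldl_pushEdge_mem v s (by omega)).trans h.mem₁⟩

theorem Setup.of_keeps {F : CNF} {h K N f : ℕ} {b s : State} (hb : Setup F h K N f b)
    (hs : Keeps b s) : Setup F h K N f s := by
  constructor
  · rw [hs.reg _ (by norm_num), hb.n]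
  · rw [hs.reg _ (by norm_num), hb.m]
  · rw [hs.reg _ (by norm_num), hb.W]
  · rw [hs.reg _ (by norm_num), hb.Q]
  · rw [hs.reg _ (by norm_num), hb.half]
  · rw [hs.reg _ (by norm_num), hb.K]
  · rw [hs.reg _ (by norm_num), hb.N]
  · rw [hs.reg _ (by norm_num), hb.f]
  · rw [hs.mem₀]
    exact hb.mem₀
  · rw [hs.mem₁]
    exact hb.mem₁

/-- Register `x` says whether an assignment leaves a clause unsatisfied. -/
def unsatProg (x : ℕ) (a lo hi c : Expr) : Prog :=
  .seq (satProg a lo hi c) (block [.op x .eq (var 28) (lit 0)])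

theorem runs_unsatProg {w : ℕ} {F : CNF} {h K N f : ℕ} {s : State} (hs : Setup F h K N f s)
    (hw : Fits w F h K N f) (x : ℕ) {a lo hi c : Expr} (ha : a.avoids scratch = true)
    (hlo : lo.avoids scratch = true) (hhi : hi.avoids scratch = true)
    (hc : c.avoids scratch = true) {av lv hv cv : ℕ} (hav : a.eval w s = av)
    (hlv : lo.eval w s = lv) (hhv : hi.eval w s = hv) (hcv : c.eval w s = cv) (haw : av < 2 ^ w)
    (hlw : lv < 2 ^ w) (hhw : hv < 2 ^ w) (hcm : cv < F.m) {R : State → Prop}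
    (hR : ∀ v, R ((s.setReg 28 v).setReg x (!partSat av lv hv (F.clauses.getD cv [])).toNat)) :
    Runs scratch w (unsatProg x a lo hi c) s
      (a.cost + lo.cost + hi.cost + c.cost + 100 * F.size + 4) R := by
  subst hav hlv hhv hcv
  have h1 : 1 < 2 ^ w := by have := hw.n; omega
  refine Runs.seq (runs_satProg (R := fun s' => s' = _) hs.mem₀ hw.input hw.n ha hlo hhi hc haw hlw
    hhw hcm rfl) ?_
  rintro _ rfl
  refine Runs.block_le hasTemps_scratch rfl (by simp [blockCost, Instr.cost, Expr.cost]) ?_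
  rw [← List.getD_eq_getElem _ [] hcm]
  simp only [runBlock, Instr.run, Expr.eval, State.setReg_reg, if_true, Nat.zero_mod,
    Op.eval_eq h1]
  convert hR _ using 3
  generalize partSat _ _ _ _ = v
  cases v <;> rfl

/-- The number of the node `(tag, i, p)`. -/
def nodeExpr (tag i p : Expr) : Expr := add (mul (add (mul tag (var 3)) i) (var 4)) p

theorem eval_nodeExpr {w : ℕ} {s : State} {Q W N : ℕ} (hW : s.reg 3 = W) (hQ : s.reg 4 = Q)
    (hN : 8 * W * Q ≤ N) (hw : N < 2 ^ w) {tag i p : Expr} {tv iv pv : ℕ}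
    (ht : tag.eval w s = tv) (hi : i.eval w s = iv) (hp : p.eval w s = pv) (ht8 : tv < 8)
    (hiW : iv < W) (hpQ : pv < Q) :
    (nodeExpr tag i p).eval w s = node Q W tv iv pv ∧ node Q W tv iv pv < 2 ^ w := by
  have h1 := node_lt ht8 hiW hpQ
  have h2 : tv * W + iv ≤ (tv * W + iv) * Q := Nat.le_mul_of_pos_right _ (by omega)
  have h3 : (tv * W + iv) * Q ≤ node Q W tv iv pv := Nat.le_add_right _ _
  refine ⟨?_, by omega⟩
  simp only [nodeExpr, Expr.eval, ht, hi, hp, hW, hQ]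
  rw [Op.eval_mul (x := tv) (by omega), Op.eval_add (x := tv * W) (by omega),
    Op.eval_mul (by omega),
    Op.eval_add (by unfold node at h1; omega)]
  rfl

/-- The edges that belong to the partial assignment in register `18` and the clause in register
`19`, except for those that come from the clauses. -/
def gadgetExprs : List (Expr × Expr × Expr) :=
  [(nodeExpr (lit 0) (lit 0) (var 18),
      nodeExpr (add (lit 1) (bin .eq (var 21) (lit 0))) (var 19) (lit 0), var 6),
    (nodeExpr (lit 1) (var 19) (lit 0), nodeExpr (lit 3) (var 19) (var 18), var 27),
    (nodeExpr (lit 2) (var 19) (lit 0), nodeExpr (lit 4) (lit 0) (var 18), var 27),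
    (nodeExpr (lit 3) (var 19) (var 18), nodeExpr (lit 6) (var 19) (lit 0),
      mul (var 27) (var 22)),
    (nodeExpr (lit 3) (var 19) (var 18), nodeExpr (lit 4) (lit 0) (var 18), var 27),
    (nodeExpr (lit 4) (lit 0) (var 18), nodeExpr (lit 5) (var 19) (lit 0),
      mul (var 27) (var 19)),
    (nodeExpr (lit 5) (var 19) (lit 0), nodeExpr (lit 7) (var 19) (var 18),
      mul (var 6) (var 2))]

/-- The edge that comes from the clause in register `20`. -/
def clauseExprs : List (Expr × Expr × Expr) :=
  [(nodeExpr (lit 6) (var 20) (lit 0), nodeExpr (lit 7) (var 19) (var 18),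
    mul (var 23) (var 6))]

/-- Append the edges that belong to the partial assignment in register `18` and the clause in
register `19`. -/
def gadgetProg : Prog :=
  .seq (unsatProg 21 (var 18) (lit 0) (var 5) (var 19))
  (.seq (unsatProg 22 (bin .shl (var 18) (mul (lit 2) (var 5))) (mul (lit 2) (var 5)) (var 1)
    (var 19))
  (.seq (block [.op 27 .lt (var 18) (var 6)])
  (.seq (emits gadgetExprs)
  (forLoop 20 (var 2)
    (.seq (unsatProg 23 (bin .shl (var 18) (var 5)) (var 5) (mul (lit 2) (var 5)) (var 20))
      (emits clauseExprs))))))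

section

variable {w : ℕ} {F : CNF} {h K N f : ℕ} {b : State}

/-- The numbered edges of the gadget of `p` and `i`, of which the last kind is given for the
clauses `j < J`. -/
def gadgetEdges (F : CNF) (h K p i J : ℕ) : List (ℕ × ℕ × ℕ) :=
  let Q := 2 ^ h
  let W := F.m + 1
  [(node Q W 0 0 p, node Q W (if F.unsatLow h p i then 1 else 2) i 0, K),
    (node Q W 1 i 0, node Q W 3 i p, if p < K then 1 else 0),
    (node Q W 2 i 0, node Q W 4 0 p, if p < K then 1 else 0),
    (node Q W 3 i p, node Q W 6 i 0, if p < K then (F.unsatHigh h p i).toNat else 0),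
    (node Q W 3 i p, node Q W 4 0 p, if p < K then 1 else 0),
    (node Q W 4 0 p, node Q W 5 i 0, if p < K then i else 0),
    (node Q W 5 i 0, node Q W 7 i p, K * F.m)] ++
  (List.range J).map fun j => (node Q W 6 j 0, node Q W 7 i p, if F.unsatMid h p j then K else 0)

/-- Connects the program with the abstract network: with all clauses `j < F.m`, the numbers that are
written are those of the gadget. -/
theorem gadgetEdges_eq (F : CNF) (h K p i : ℕ) :
    gadgetEdges F h K p i F.m = (gadgetTriples F.m K (F.unsatLow h) (F.unsatHigh h) (F.unsatMid h)
      p i).map (numberEdge (2 ^ h) (F.m + 1)) := by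
  simp [gadgetEdges, gadgetTriples, numberEdge]

theorem gadgetEdges_succ (F : CNF) (h K p i J : ℕ) :
    gadgetEdges F h K p i (J + 1) = gadgetEdges F h K p i J ++
      [(node (2 ^ h) (F.m + 1) 6 J 0, node (2 ^ h) (F.m + 1) 7 i p,
        if F.unsatMid h p J then K else 0)] := by
  simp [gadgetEdges, List.range_succ]

theorem runs_gadgetExprs (hb : Setup F h K N f b) (hw : Fits w F h K N f) {p i : ℕ}
    (hp : p < 2 ^ h) (hi : i < F.m) {s : State} (hs : Keeps b s) (h18 : s.reg 18 = p)
    (h19 : s.reg 19 = i) (h21 : s.reg 21 = (F.unsatLow h p i).toNat)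
    (h22 : s.reg 22 = (F.unsatHigh h p i).toNat) (h27 : s.reg 27 = (decide (p < K)).toNat)
    (hcnt : 3 * (s.reg 17 + 7) + 5 < 2 ^ w) {R : State → Prop}
    (hR : R ((gadgetEdges F h K p i 0).foldl State.pushEdge s)) :
    Runs scratch w (emits gadgetExprs) s 1000 R := by
  have hN := hw.nodes
  have hNw := hw.N
  have hcap := hw.cap
  have hK1 : K * (F.m + 1) = K * F.m + K := by ring
  have hQ : 0 < 2 ^ h := by positivity
  -- Hence the tags 0 to 7 are smaller than the number of nodes and fit into words.
  have h8 : 8 ≤ 8 * (F.m + 1) * 2 ^ h := by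
    have : 1 ≤ (F.m + 1) * 2 ^ h := Nat.mul_pos (by omega) hQ
    rw [mul_assoc]
    omega
  have hS := hb.of_keeps hs
  have nd : ∀ s' : State, (∀ r, r ≠ 17 → s'.reg r = s.reg r) → ∀ {tag i p : Expr} {tv iv pv : ℕ},
      tag.eval w s' = tv → i.eval w s' = iv → p.eval w s' = pv → tv < 8 → iv < F.m + 1 →
      pv < 2 ^ h → (nodeExpr tag i p).eval w s' = node (2 ^ h) (F.m + 1) tv iv pv := by
    intro s' hs' tag i p tv iv pv h1 h2 h3 h4 h5 h6
    refine (eval_nodeExpr ?_ ?_ hN hNw h1 h2 h3 h4 h5 h6).1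
    · rw [hs' _ (by norm_num), hS.W]
    · rw [hs' _ (by norm_num), hS.Q]
  refine Runs.mono (T := emitsCost gadgetExprs)
    (runs_emits (b := s) (v := gadgetEdges F h K p i 0) rfl ?_ (fun _ _ => rfl) ?_ hcnt hR)
    (by decide) fun _ h => h
  · simp only [gadgetEdges, gadgetExprs, List.range_zero, List.map_nil, List.append_nil]
    have e18 : ∀ s' : State, (∀ r, r ≠ 17 → s'.reg r = s.reg r) → (var 18).eval w s' = p :=
      fun s' hs' => (hs' 18 (by norm_num)).trans h18
    have e19 : ∀ s' : State, (∀ r, r ≠ 17 → s'.reg r = s.reg r) → (var 19).eval w s' = i :=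
      fun s' hs' => (hs' 19 (by norm_num)).trans h19
    have e27 : ∀ s' : State, (∀ r, r ≠ 17 → s'.reg r = s.reg r) →
        (var 27).eval w s' = if p < K then 1 else 0 := fun s' hs' => by
      refine (hs' 27 (by norm_num)).trans (h27.trans ?_)
      by_cases hpK : p < K <;> simp [hpK]
    have el : ∀ (s' : State) (c : ℕ), c < 8 → (lit c).eval w s' = c := fun s' c hc =>
      Nat.mod_eq_of_lt (by omega)
    refine .cons ?_ (.cons ?_ (.cons ?_ (.cons ?_ (.cons ?_ (.cons ?_ (.cons ?_ .nil))))))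
    · intro s' hs'
      refine ⟨nd s' hs' (el _ _ (by omega)) (el _ _ (by omega)) (e18 _ hs') (by omega) (by omega)
        hp, nd s' hs' ?_ (e19 _ hs') (el _ _ (by omega)) (by split_ifs <;> omega) (by omega) hQ, ?_⟩
      · simp only [Expr.eval, hs' 21 (by norm_num), h21]
        rw [Nat.zero_mod, Nat.mod_eq_of_lt (show 1 < 2 ^ w by omega), Op.eval_eq (by omega)]
        cases F.unsatLow h p i <;> simp <;> rw [Op.eval_add (by omega)]
      · exact (hs' 6 (by norm_num)).trans hS.K
    · intro s' hs'
      exact ⟨nd s' hs' (el _ _ (by omega)) (e19 _ hs') (el _ _ (by omega)) (by omega) (by omega) hQ,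
        nd s' hs' (el _ _ (by omega)) (e19 _ hs') (e18 _ hs') (by omega) (by omega) hp, e27 _ hs'⟩
    · intro s' hs'
      exact ⟨nd s' hs' (el _ _ (by omega)) (e19 _ hs') (el _ _ (by omega)) (by omega) (by omega) hQ,
        nd s' hs' (el _ _ (by omega)) (el _ _ (by omega)) (e18 _ hs') (by omega) (by omega) hp,
        e27 _ hs'⟩
    · intro s' hs'
      refine ⟨nd s' hs' (el _ _ (by omega)) (e19 _ hs') (e18 _ hs') (by omega) (by omega) hp,
        nd s' hs' (el _ _ (by omega)) (e19 _ hs') (el _ _ (by omega)) (by omega) (by omega) hQ, ?_⟩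
      have := e27 _ hs'
      simp only [Expr.eval] at this ⊢
      rw [this, hs' 22 (by norm_num), h22]
      have hbool := Bool.toNat_le (F.unsatHigh h p i)
      split_ifs
      · rw [Op.eval_mul (by omega), one_mul]
      · rw [Op.eval_mul (by omega), zero_mul]
    · intro s' hs'
      exact ⟨nd s' hs' (el _ _ (by omega)) (e19 _ hs') (e18 _ hs') (by omega) (by omega) hp,
        nd s' hs' (el _ _ (by omega)) (el _ _ (by omega)) (e18 _ hs') (by omega) (by omega) hp,
        e27 _ hs'⟩
    · intro s' hs'
      refine ⟨nd s' hs' (el _ _ (by omega)) (el _ _ (by omega)) (e18 _ hs') (by omega) (by omega)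
        hp, nd s' hs' (el _ _ (by omega)) (e19 _ hs') (el _ _ (by omega)) (by omega) (by omega) hQ,
        ?_⟩
      have h1 := e27 _ hs'
      have h2 := e19 _ hs'
      simp only [Expr.eval] at h1 h2 ⊢
      rw [h1, h2]
      split_ifs
      · rw [Op.eval_mul (by omega), one_mul]
      · rw [Op.eval_mul (by omega), zero_mul]
    · intro s' hs'
      refine ⟨nd s' hs' (el _ _ (by omega)) (e19 _ hs') (el _ _ (by omega)) (by omega) (by omega)
        hQ, nd s' hs' (el _ _ (by omega)) (e19 _ hs') (e18 _ hs') (by omega) (by omega) hp, ?_⟩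
      simp only [Expr.eval]
      rw [hs' 6 (by norm_num), hs' 2 (by norm_num), hS.K, hS.m, Op.eval_mul (by omega)]
  · have lt : ∀ {tv iv pv : ℕ}, tv < 8 → iv < F.m + 1 → pv < 2 ^ h →
        node (2 ^ h) (F.m + 1) tv iv pv < 2 ^ w := fun h1 h2 h3 =>
      ((node_lt h1 h2 h3).trans_le hN).trans hNw
    have l0 : ∀ tv, tv < 8 → node (2 ^ h) (F.m + 1) tv 0 p < 2 ^ w := fun tv ht => lt ht (by omega) hp
    have l1 : ∀ tv, tv < 8 → node (2 ^ h) (F.m + 1) tv i p < 2 ^ w := fun tv ht => lt ht (by omega) hp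
    have l2 : ∀ tv, tv < 8 → node (2 ^ h) (F.m + 1) tv i 0 < 2 ^ w := fun tv ht => lt ht (by omega) hQ
    have hbool := Bool.toNat_le (F.unsatHigh h p i)
    simp only [gadgetEdges, List.range_zero, List.map_nil, List.append_nil, List.mem_cons,
      List.not_mem_nil, or_false, forall_eq_or_imp, forall_eq]
    refine ⟨⟨l0 _ (by omega), l2 _ (by split_ifs <;> omega), by omega⟩,
      ⟨l2 _ (by omega), l1 _ (by omega), by split_ifs <;> omega⟩,
      ⟨l2 _ (by omega), l0 _ (by omega), by split_ifs <;> omega⟩,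
      ⟨l1 _ (by omega), l2 _ (by omega), by split_ifs <;> omega⟩,
      ⟨l1 _ (by omega), l0 _ (by omega), by split_ifs <;> omega⟩,
      ⟨l0 _ (by omega), l2 _ (by omega), by split_ifs <;> omega⟩,
      ⟨l2 _ (by omega), l1 _ (by omega), by omega⟩⟩

theorem runs_clauseExprs (hb : Setup F h K N f b) (hw : Fits w F h K N f) {p i j : ℕ}
    (hp : p < 2 ^ h) (hi : i < F.m) (hj : j < F.m) {s : State} (hs : Keeps b s)
    (h18 : s.reg 18 = p) (h19 : s.reg 19 = i) (h20 : s.reg 20 = j)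
    (h23 : s.reg 23 = (F.unsatMid h p j).toNat) (hcnt : 3 * (s.reg 17 + 1) + 5 < 2 ^ w)
    {R : State → Prop} (hR : R (s.pushEdge (node (2 ^ h) (F.m + 1) 6 j 0,
      node (2 ^ h) (F.m + 1) 7 i p, if F.unsatMid h p j then K else 0))) :
    Runs scratch w (emits clauseExprs) s 150 R := by
  have hN := hw.nodes
  have hNw := hw.N
  have hcap := hw.cap
  have hK1 : K * (F.m + 1) = K * F.m + K := by ring
  have hQ : 0 < 2 ^ h := by positivity
  have h8 : 8 ≤ 8 * (F.m + 1) * 2 ^ h := by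
    have : 1 ≤ (F.m + 1) * 2 ^ h := Nat.mul_pos (by omega) hQ
    rw [mul_assoc]
    omega
  have hS := hb.of_keeps hs
  refine Runs.mono (T := emitsCost clauseExprs)
    (runs_emits (b := s) (v := [_]) rfl (.cons ?_ .nil) (fun _ _ => rfl) ?_ hcnt hR)
    (by decide) fun _ h => h
  · intro s' hs'
    have el : ∀ (s' : State) (c : ℕ), c < 8 → (lit c).eval w s' = c := fun s' c hc =>
      Nat.mod_eq_of_lt (by omega)
    have g3 : s'.reg 3 = F.m + 1 := (hs' _ (by norm_num)).trans hS.W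
    have g4 : s'.reg 4 = 2 ^ h := (hs' _ (by norm_num)).trans hS.Q
    have e18 : (var 18).eval w s' = p := (hs' 18 (by norm_num)).trans h18
    have e19 : (var 19).eval w s' = i := (hs' 19 (by norm_num)).trans h19
    have e20 : (var 20).eval w s' = j := (hs' 20 (by norm_num)).trans h20
    refine ⟨(eval_nodeExpr g3 g4 hN hNw (el _ _ (by omega)) e20 (el _ _ (by omega)) (by omega)
      (by omega) hQ).1, (eval_nodeExpr g3 g4 hN hNw (el _ _ (by omega)) e19 e18 (by omega)
      (by omega) hp).1, ?_⟩
    simp only [Expr.eval]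
    rw [hs' 6 (by norm_num), hs' 23 (by norm_num), hS.K, h23]
    cases F.unsatMid h p j
    · simp [Op.eval]
    · simp only [Bool.toNat_true, if_true]
      rw [Op.eval_mul (by omega), one_mul]
  · have lt : ∀ {tv iv pv : ℕ}, tv < 8 → iv < F.m + 1 → pv < 2 ^ h →
        node (2 ^ h) (F.m + 1) tv iv pv < 2 ^ w := fun h1 h2 h3 =>
      ((node_lt h1 h2 h3).trans_le hN).trans hNw
    simp only [List.mem_cons, List.not_mem_nil, or_false, forall_eq]
    exact ⟨lt (by omega) (by omega) hQ, lt (by omega) (by omega) hp, by split_ifs <;> omega⟩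

end

end WordRAM

/-! ### Output of the whole list of edges. -/

namespace WordRAM

open WordRAM.Expr

section

variable {w : ℕ} {F : CNF} {h K N f : ℕ} {b : State}

/-- The cost is quadratic in `F.size`, because the last kind of edges evaluates a further clause for
each of the `F.m` values of `j`. -/
theorem runs_gadgetProg (hb : Setup F h K N f b) (hw : Fits w F h K N f) {p i : ℕ}
    (hp : p < 2 ^ h) (hi : i < F.m) {L : List (ℕ × ℕ × ℕ)}
    (hcnt : 3 * (L.length + (7 + F.m)) + 5 < 2 ^ w) {s : State} (hs : Keeps b s) (hL : Holds L s)
    (h18 : s.reg 18 = p) (h19 : s.reg 19 = i) :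
    Runs scratch w gadgetProg s (3000 * F.size ^ 2) fun s' => Keeps b s' ∧
      Holds (L ++ (gadgetEdges F h K p i F.m).filter fun e => e.2.2 ≠ 0) s' ∧
      s'.reg 18 = p ∧ s'.reg 19 = i := by
  have hnw := hw.n
  have hhalf := hw.half
  have hsh := hw.shift
  have h1w : 1 < 2 ^ w := by omega
  have hQle : 2 ^ h ≤ 2 ^ (3 * h) := Nat.pow_le_pow_right (by norm_num) (by omega)
  have hp2 : p * 2 ^ (2 * h) < 2 ^ w := by
    refine lt_of_le_of_lt ?_ hsh
    rw [show 3 * h = h + 2 * h by ring, pow_add]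
    exact Nat.mul_le_mul_right _ hp.le
  have hp1 : p * 2 ^ h < 2 ^ w := lt_of_le_of_lt (Nat.mul_le_mul_left _
    (Nat.pow_le_pow_right (by norm_num) (by omega))) hp2
  have eh : ∀ s', Keeps b s' → (var 5).eval w s' = h := fun s' hs' => (hb.of_keeps hs').half
  have e2h : ∀ s', Keeps b s' → (mul (lit 2) (var 5)).eval w s' = 2 * h := fun s' hs' => by
    have := eh s' hs'
    simp only [Expr.eval] at this ⊢
    rw [this, Nat.mod_eq_of_lt (by omega), Op.eval_mul (by omega)]
  have part₁ : Runs scratch w (unsatProg 21 (var 18) (lit 0) (var 5) (var 19)) s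
      (100 * F.size + 8) fun s' => Keeps b s' ∧ Holds L s' ∧ s'.reg 18 = p ∧ s'.reg 19 = i ∧
        s'.reg 21 = (F.unsatLow h p i).toNat := by
    refine Runs.mono (runs_unsatProg (a := var 18) (lo := lit 0) (hi := var 5) (c := var 19)
      (hb.of_keeps hs) hw 21 rfl rfl rfl rfl h18 (Nat.zero_mod _)
      (eh s hs) h19 (by omega) (by omega) (by omega) hi (fun v => ?_))
      (by simp only [Expr.cost]; omega) fun _ h => h
    refine ⟨(hs.setReg _ (by norm_num)).setReg _ (by norm_num), (hL.setReg _ (by norm_num)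
      (by norm_num)).setReg _ (by norm_num) (by norm_num), ?_⟩
    simp [State.setReg_reg, h18, h19, CNF.unsatLow]
  have part₂ : ∀ s₁, (Keeps b s₁ ∧ Holds L s₁ ∧ s₁.reg 18 = p ∧ s₁.reg 19 = i ∧
      s₁.reg 21 = (F.unsatLow h p i).toNat) → Runs scratch w (unsatProg 22
        (bin .shl (var 18) (mul (lit 2) (var 5))) (mul (lit 2) (var 5)) (var 1) (var 19)) s₁
      (100 * F.size + 14) fun s' => Keeps b s' ∧ Holds L s' ∧ s'.reg 18 = p ∧ s'.reg 19 = i ∧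
        s'.reg 21 = (F.unsatLow h p i).toNat ∧ s'.reg 22 = (F.unsatHigh h p i).toNat := by
    rintro s₁ ⟨hs, hL, h18, h19, h21⟩
    refine Runs.mono (runs_unsatProg (a := bin .shl (var 18) (mul (lit 2) (var 5)))
      (lo := mul (lit 2) (var 5)) (hi := var 1) (c := var 19) (av := p * 2 ^ (2 * h)) (hb.of_keeps hs) hw 22 rfl rfl rfl
      rfl ?_ (e2h _ hs) (hb.of_keeps hs).n h19 (by omega) (by omega) (by omega) hi (fun v => ?_))
      (by simp only [Expr.cost]; omega) fun _ h => h
    · have := e2h _ hs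
      rw [Expr.eval, this]
      simp only [Expr.eval, h18]
      rw [Op.eval_shl hp2]
    · refine ⟨(hs.setReg _ (by norm_num)).setReg _ (by norm_num), (hL.setReg _ (by norm_num)
        (by norm_num)).setReg _ (by norm_num) (by norm_num), ?_⟩
      simp [State.setReg_reg, h18, h19, h21, CNF.unsatHigh]
  have part₃ : ∀ s₁, (Keeps b s₁ ∧ Holds L s₁ ∧ s₁.reg 18 = p ∧ s₁.reg 19 = i ∧
      s₁.reg 21 = (F.unsatLow h p i).toNat ∧ s₁.reg 22 = (F.unsatHigh h p i).toNat) →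
      Runs scratch w (block [.op 27 .lt (var 18) (var 6)]) s₁ 4
      fun s' => Keeps b s' ∧ Holds L s' ∧ s'.reg 18 = p ∧ s'.reg 19 = i ∧
        s'.reg 21 = (F.unsatLow h p i).toNat ∧ s'.reg 22 = (F.unsatHigh h p i).toNat ∧
        s'.reg 27 = (decide (p < K)).toNat := by
    rintro s₁ ⟨hs, hL, h18, h19, h21, h22⟩
    refine Runs.block_le hasTemps_scratch rfl (by decide) ?_
    simp only [runBlock, Instr.run, Expr.eval, Op.eval_lt h1w, h18, (hb.of_keeps hs).K]
    refine ⟨hs.setReg _ (by norm_num), hL.setReg _ (by norm_num) (by norm_num), ?_⟩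
    simp [State.setReg_reg, h18, h19, h21, h22]
  -- The list after the edges from the first `J` clauses to the sink; it serves as the invariant of
  -- the inner loop.
  let L' : ℕ → List (ℕ × ℕ × ℕ) := fun J => L ++ (gadgetEdges F h K p i J).filter fun e => e.2.2 ≠ 0
  have hL' : ∀ J, (L' J).length ≤ L.length + (7 + J) := fun J => by
    simp only [L', List.length_append]
    have := List.length_filter_le (fun e : ℕ × ℕ × ℕ => e.2.2 ≠ 0) (gadgetEdges F h K p i J)
    have h2 : (gadgetEdges F h K p i J).length = 7 + J := by simp [gadgetEdges]; omega
    omega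
  have part₄ : ∀ s₁, (Keeps b s₁ ∧ Holds L s₁ ∧ s₁.reg 18 = p ∧ s₁.reg 19 = i ∧
      s₁.reg 21 = (F.unsatLow h p i).toNat ∧ s₁.reg 22 = (F.unsatHigh h p i).toNat ∧
      s₁.reg 27 = (decide (p < K)).toNat) → Runs scratch w (emits gadgetExprs) s₁ 1000 fun s' =>
      Keeps b s' ∧ Holds (L' 0) s' ∧ s'.reg 18 = p ∧ s'.reg 19 = i := by
    rintro s₁ ⟨hs, hL, h18, h19, h21, h22, h27⟩
    refine runs_gadgetExprs hb hw hp hi hs h18 h19 h21 h22 h27 (by rw [hL.count]; omega) ?_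
    refine ⟨hs.foldl_pushEdge _, hL.foldl_pushEdge _, ?_, ?_⟩
    · rw [State.foldl_pushEdge_reg _ _ (by norm_num), h18]
    · rw [State.foldl_pushEdge_reg _ _ (by norm_num), h19]
  have part₅ : ∀ s₁, (Keeps b s₁ ∧ Holds (L' 0) s₁ ∧ s₁.reg 18 = p ∧ s₁.reg 19 = i) →
      Runs scratch w (forLoop 20 (var 2) (.seq
        (unsatProg 23 (bin .shl (var 18) (var 5)) (var 5) (mul (lit 2) (var 5)) (var 20))
        (emits clauseExprs))) s₁ (F.m * (100 * F.size + 12 + 150 + 1 + 6) + 1 + 4) fun s' =>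
      Keeps b s' ∧ Holds (L' F.m) s' ∧ s'.reg 18 = p ∧ s'.reg 19 = i ∧ s'.reg 20 = F.m := by
    rintro s₁ ⟨hs, hL, h18, h19⟩
    refine Runs.forLoop (T := 100 * F.size + 12 + 150) hasTemps_scratch rfl rfl (hw.input.trans' (by
      have := F.le_length_input; omega)) (fun j s' => Keeps b s' ∧ Holds (L' j) s' ∧
        s'.reg 18 = p ∧ s'.reg 19 = i ∧ s'.reg 20 = j) ?_ ?_ ?_
    · exact ⟨hs.setReg _ (by norm_num), hL.setReg _ (by norm_num) (by norm_num),
        by simp [State.setReg_reg, h18, h19]⟩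
    · rintro j s₂ - ⟨hs, -, -, -, h20⟩
      exact ⟨h20, (hb.of_keeps hs).m⟩
    · rintro j s₂ hj ⟨hs, hL, h18, h19, h20⟩
      refine Runs.seq (T₁ := 100 * F.size + 12) (T₂ := 150)
        (R₁ := fun s' => Keeps b s' ∧ Holds (L' j) s' ∧ s'.reg 18 = p ∧
        s'.reg 19 = i ∧ s'.reg 20 = j ∧ s'.reg 23 = (F.unsatMid h p j).toNat) ?_ ?_
      · refine Runs.mono (runs_unsatProg (a := bin .shl (var 18) (var 5)) (lo := var 5)
          (hi := mul (lit 2) (var 5)) (c := var 20) (av := p * 2 ^ h) (hb.of_keeps hs) hw 23 rfl rfl rfl rfl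
          ?_ (eh _ hs) (e2h _ hs) h20 (by omega) (by omega) (by omega) hj (fun v => ?_))
          (by simp only [Expr.cost]; omega) fun _ h => h
        · have := eh _ hs
          rw [Expr.eval, this]
          simp only [Expr.eval, h18]
          rw [Op.eval_shl hp1]
        · refine ⟨(hs.setReg _ (by norm_num)).setReg _ (by norm_num), (hL.setReg _ (by norm_num)
            (by norm_num)).setReg _ (by norm_num) (by norm_num), ?_⟩
          simp [State.setReg_reg, h18, h19, h20, CNF.unsatMid]
      · rintro s₃ ⟨hs, hL, h18, h19, h20, h23⟩
        have := hL' j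
        refine runs_clauseExprs hb hw hp hi hj hs h18 h19 h20 h23 (by rw [hL.count]; omega) ?_
        have k1 := hs.foldl_pushEdge [(node (2 ^ h) (F.m + 1) 6 j 0, node (2 ^ h) (F.m + 1) 7 i p,
          if F.unsatMid h p j then K else 0)]
        have k2 := hL.pushEdge (node (2 ^ h) (F.m + 1) 6 j 0, node (2 ^ h) (F.m + 1) 7 i p,
          if F.unsatMid h p j then K else 0)
        simp only [L', List.append_assoc, ← List.filter_append, ← gadgetEdges_succ] at k2
        refine ⟨?_, k1.setReg _ (by norm_num), k2.setReg _ (by norm_num) (by norm_num), ?_⟩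
        · rw [State.pushEdge_reg _ _ (by norm_num), h20]
        · simp [State.setReg_reg, State.pushEdge_reg, h18, h19]
  refine Runs.mono (Runs.seq part₁ fun s₁ h₁ => Runs.seq (part₂ s₁ h₁) fun s₂ h₂ =>
    Runs.seq (part₃ s₂ h₂) fun s₃ h₃ => Runs.seq (part₄ s₃ h₃) fun s₄ h₄ => part₅ s₄ h₄) ?_ ?_
  · have hm : F.m ≤ F.size := by rw [CNF.size]; omega
    have h1 : 1 ≤ F.size := by rw [CNF.size]; omega
    nlinarith [Nat.mul_le_mul_right F.size hm]
  · rintro s' ⟨k1, k2, k3, k4, -⟩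
    exact ⟨k1, k2, k3, k4⟩

/-- Write the edges of the network. -/
def buildProg : Prog :=
  .seq (block [.lit 17 0]) (forLoop 18 (var 4) (forLoop 19 (var 2) gadgetProg))

/-- The edges of the first gadgets. -/
def prefixEdges (F : CNF) (h K : ℕ) (P I : ℕ) : List (ℕ × ℕ × ℕ) :=
  ((List.range P).flatMap fun p => (List.range F.m).flatMap fun i =>
    (gadgetEdges F h K p i F.m).filter fun e => e.2.2 ≠ 0) ++
  (List.range I).flatMap fun i => (gadgetEdges F h K P i F.m).filter fun e => e.2.2 ≠ 0

theorem prefixEdges_eq (F : CNF) (h K : ℕ) : prefixEdges F h K (2 ^ h) 0 = F.edges h K := by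
  simp only [prefixEdges, List.range_zero, List.flatMap_nil, List.append_nil, CNF.edges, edgeList,
    triples, List.map_flatMap, gadgetEdges_eq, List.filter_map]
  rfl

theorem prefixEdges_succ_right (F : CNF) (h K P I : ℕ) : prefixEdges F h K P (I + 1) =
    prefixEdges F h K P I ++ (gadgetEdges F h K P I F.m).filter fun e => e.2.2 ≠ 0 := by
  simp [prefixEdges, List.range_succ]

theorem prefixEdges_succ_left (F : CNF) (h K P : ℕ) :
    prefixEdges F h K (P + 1) 0 = prefixEdges F h K P F.m := by
  simp [prefixEdges, List.range_succ]

theorem length_prefixEdges_le (F : CNF) (h K P I : ℕ) :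
    (prefixEdges F h K P I).length ≤ (P * F.m + I) * (7 + F.m) := by
  have hg : ∀ p i, ((gadgetEdges F h K p i F.m).filter fun e => e.2.2 ≠ 0).length ≤ 7 + F.m := by
    intro p i
    refine (List.length_filter_le _ _).trans ?_
    simp [gadgetEdges]
    omega
  have hI : ∀ P I, (prefixEdges F h K P I).length ≤
      (prefixEdges F h K P 0).length + I * (7 + F.m) := by
    intro P I
    induction I with
    | zero => simp
    | succ I ih =>
      rw [prefixEdges_succ_right, List.length_append, Nat.succ_mul]
      have := hg P I
      omega
  have hP : ∀ P, (prefixEdges F h K P 0).length ≤ P * F.m * (7 + F.m) := by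
    intro P
    induction P with
    | zero => simp [prefixEdges]
    | succ P ih =>
      rw [prefixEdges_succ_left, Nat.succ_mul, Nat.add_mul]
      exact (hI P F.m).trans (Nat.add_le_add_right ih _)
  rw [Nat.add_mul]
  exact (hI P I).trans (Nat.add_le_add_right (hP P) _)

theorem runs_buildProg (hb : Setup F h K N f b) (hw : Fits w F h K N f)
    (hs : Holds [] (b.setReg 17 0)) :
    Runs scratch w buildProg b (2 ^ h * (4000 * F.size ^ 3) + 20) fun s' => Keeps b s' ∧
      Holds (F.edges h K) s' := by
  have hnw := hw.n
  have hed := hw.edges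
  have hm : F.m < 2 ^ w := hw.input.trans' (by have := F.le_length_input; omega)
  have hQ : 2 ^ h < 2 ^ w := lt_of_le_of_lt
    (Nat.pow_le_pow_right (by norm_num) (by omega)) hw.shift
  have part₁ : Runs scratch w (block [.lit 17 0]) b 2 fun s' => Keeps b s' ∧
      Holds (prefixEdges F h K 0 0) s' := by
    refine Runs.block_le hasTemps_scratch rfl (by decide) ?_
    simp only [runBlock, Instr.run, Nat.zero_mod]
    exact ⟨(Keeps.refl b).setReg _ (by norm_num), hs⟩
  have part₂ : ∀ s₁, (Keeps b s₁ ∧ Holds (prefixEdges F h K 0 0) s₁) →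
      Runs scratch w (forLoop 18 (var 4) (forLoop 19 (var 2) gadgetProg)) s₁
        (2 ^ h * (F.m * (3000 * F.size ^ 2 + 1 + 6) + 1 + 4 + 1 + 6) + 1 + 4) fun s' =>
        Keeps b s' ∧ Holds (prefixEdges F h K (2 ^ h) 0) s' ∧ s'.reg 18 = 2 ^ h := by
    rintro s₁ ⟨hs, hL⟩
    refine Runs.forLoop_le (T := F.m * (3000 * F.size ^ 2 + 1 + 6) + 1 + 4) hasTemps_scratch rfl rfl
      hQ (fun p s' => Keeps b s' ∧ Holds (prefixEdges F h K p 0) s' ∧ s'.reg 18 = p) ?_ ?_ ?_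
      (by simp only [Expr.cost]; exact le_rfl)
    · exact ⟨hs.setReg _ (by norm_num), hL.setReg _ (by norm_num) (by norm_num),
        by simp [State.setReg_reg]⟩
    · rintro p s₂ - ⟨hs, -, h18⟩
      exact ⟨h18, (hb.of_keeps hs).Q⟩
    · rintro p s₂ hp ⟨hs, hL, h18⟩
      refine Runs.mono (Runs.forLoop (x := 19) (e := var 2) (T := 3000 * F.size ^ 2) hasTemps_scratch
        rfl rfl hm
        (fun i s' => Keeps b s' ∧ Holds (prefixEdges F h K p i) s' ∧ s'.reg 18 = p ∧
          s'.reg 19 = i) ?_ ?_ ?_) (by simp only [Expr.cost]; exact le_rfl) ?_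
      · exact ⟨hs.setReg _ (by norm_num), hL.setReg _ (by norm_num) (by norm_num),
          by simp [State.setReg_reg, h18]⟩
      · rintro i s₃ - ⟨hs, -, -, h19⟩
        exact ⟨h19, (hb.of_keeps hs).m⟩
      · rintro i s₃ hi ⟨hs, hL, h18, h19⟩
        have hlen := length_prefixEdges_le F h K p i
        -- There is room for one more complete gadget below the bound on the total number of edges.
        have hlen' : (p * F.m + i) * (7 + F.m) + (7 + F.m) ≤ 2 ^ h * (F.m * (7 + F.m)) := by
          rw [← Nat.succ_mul, ← mul_assoc]
          refine Nat.mul_le_mul_right _ ?_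
          have := Nat.mul_le_mul_right F.m (Nat.succ_le_of_lt hp)
          rw [Nat.succ_mul] at this
          omega
        refine Runs.mono (runs_gadgetProg hb hw hp hi (by omega) hs hL h18 h19) le_rfl ?_
        rintro s' ⟨k1, k2, k3, k4⟩
        rw [← prefixEdges_succ_right] at k2
        exact ⟨k4, k1.setReg _ (by norm_num), k2.setReg _ (by norm_num) (by norm_num),
          by simp [State.setReg_reg, k3]⟩
      · rintro s' ⟨k1, k2, k3, -⟩
        rw [← prefixEdges_succ_left] at k2
        exact ⟨k3, k1.setReg _ (by norm_num), k2.setReg _ (by norm_num) (by norm_num),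
          by simp [State.setReg_reg]⟩
  refine Runs.mono (Runs.seq part₁ part₂) ?_ ?_
  · have hm : F.m ≤ F.size := by rw [CNF.size]; omega
    have h1 : 1 ≤ F.size := by rw [CNF.size]; omega
    have h2 : F.m * (3000 * F.size ^ 2 + 1 + 6) + 1 + 4 + 1 + 6 ≤ 4000 * F.size ^ 3 := by
      have h3 : F.m * (3000 * F.size ^ 2 + 1 + 6) ≤ F.size * (3000 * F.size ^ 2 + 1 + 6) :=
        Nat.mul_le_mul_right _ hm
      have h4 : F.size ≤ F.size ^ 3 := Nat.le_self_pow (by norm_num) _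
      have h5 : F.size * (3000 * F.size ^ 2 + 1 + 6) = 3000 * F.size ^ 3 + 7 * F.size := by ring
      omega
    have := Nat.mul_le_mul_left (2 ^ h) h2
    omega
  · rintro s' ⟨k1, k2, -⟩
    exact ⟨k1, prefixEdges_eq F h K ▸ k2⟩

end

end WordRAM

/-! ## Assignments as numbers -/

namespace CNF

/-- The assignment given by the bits of a number. -/
def assignment (F : CNF) (g : ℕ) : Fin F.n → Bool := fun i => g.testBit i

theorem exists_assignment (F : CNF) (a : Fin F.n → Bool) : ∃ g < 2 ^ F.n, F.assignment g = a := by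
  refine ⟨Nat.ofBits a, Nat.ofBits_lt_two_pow a, funext fun i => ?_⟩
  simp [assignment, Nat.testBit_ofBits_lt]

theorem satisfies_assignment (F : CNF) (g : ℕ) (C : List (Fin F.n × Bool)) :
    satisfies (F.assignment g) C = partSat g 0 F.n C := by
  simp [satisfies, partSat, assignment]

theorem partSat_congr {n a a' lo hi : ℕ} {C : List (Fin n × Bool)}
    (h : ∀ i, lo ≤ i → i < hi → a.testBit i = a'.testBit i) :
    partSat a lo hi C = partSat a' lo hi C := by
  rw [partSat, partSat, Bool.eq_iff_iff, List.any_eq_true, List.any_eq_true]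
  refine exists_congr fun l => and_congr_right fun _ => ?_
  simp only [Bool.and_eq_true, decide_eq_true_eq]
  refine and_congr_right fun hl => ?_
  rw [h _ hl.1 hl.2]

/-- The number of the assignment that is composed of three partial assignments. -/
def compose (h α β γ : ℕ) : ℕ := α + γ * 2 ^ h + β * 2 ^ (2 * h)

theorem compose_lt {h α β γ : ℕ} (hα : α < 2 ^ h) (hβ : β < 2 ^ h) (hγ : γ < 2 ^ h) :
    compose h α β γ < 2 ^ (3 * h) := by
  have h1 : 2 ^ (3 * h) = 2 ^ h * 2 ^ (2 * h) := by rw [← pow_add]; congr 1; omega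
  have h2 : 2 ^ (2 * h) = 2 ^ h * 2 ^ h := by rw [← pow_add]; congr 1; omega
  have h3 : (β + 1) * 2 ^ (2 * h) ≤ 2 ^ h * 2 ^ (2 * h) := Nat.mul_le_mul_right _ hβ
  have h4 : (γ + 1) * 2 ^ h ≤ 2 ^ h * 2 ^ h := Nat.mul_le_mul_right _ hγ
  rw [Nat.succ_mul] at h3 h4
  rw [compose]
  omega

/-- The bits of the composed number in the three windows are those of `α`, `γ` and `β`, in this
order: `β` occupies the high part. A clause is satisfied if it is satisfied by a variable of one of
the windows. -/
theorem partSat_compose (F : CNF) {h α β γ : ℕ} (hα : α < 2 ^ h) (hγ : γ < 2 ^ h) (j : ℕ) :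
    partSat (compose h α β γ) 0 F.n (F.clauses.getD j []) =
      !(F.unsatLow h α j && F.unsatHigh h β j && F.unsatMid h γ j) := by
  have h2 : 2 ^ (2 * h) = 2 ^ h * 2 ^ h := by rw [← pow_add]; congr 1; omega
  have low : ∀ i, 0 ≤ i → i < h → (compose h α β γ).testBit i = α.testBit i := fun i _ hi => by
    rw [show compose h α β γ = 2 ^ h * (γ + β * 2 ^ h) + α by rw [compose, h2]; ring,
      Nat.testBit_two_pow_mul_add _ hα, if_pos hi]
  have mid : ∀ i, h ≤ i → i < 2 * h → (compose h α β γ).testBit i = (γ * 2 ^ h).testBit i := by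
    intro i hi hi'
    rw [show compose h α β γ = 2 ^ h * (2 ^ h * β + γ) + α by rw [compose, h2]; ring,
      Nat.testBit_two_pow_mul_add _ hα, if_neg (by omega), Nat.testBit_two_pow_mul_add _ hγ,
      if_pos (by omega), mul_comm, Nat.testBit_two_pow_mul]
    simp [hi]
  have high : ∀ i, 2 * h ≤ i → i < F.n →
      (compose h α β γ).testBit i = (β * 2 ^ (2 * h)).testBit i := by
    intro i hi _
    have hlt : γ * 2 ^ h + α < 2 ^ (2 * h) := by
      have := Nat.mul_le_mul_right (2 ^ h) (Nat.succ_le_of_lt hγ)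
      rw [Nat.succ_mul] at this
      omega
    rw [show compose h α β γ = 2 ^ (2 * h) * β + (γ * 2 ^ h + α) by rw [compose]; ring,
      Nat.testBit_two_pow_mul_add _ hlt, if_neg (by omega), mul_comm β, Nat.testBit_two_pow_mul]
    simp [hi]
  have hs : partSat (compose h α β γ) 0 F.n (F.clauses.getD j []) =
      (partSat (compose h α β γ) 0 h (F.clauses.getD j []) ||
      (partSat (compose h α β γ) h (2 * h) (F.clauses.getD j []) ||
        partSat (compose h α β γ) (2 * h) F.n (F.clauses.getD j []))) := by
    rw [Bool.eq_iff_iff]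
    simp only [partSat, Bool.or_eq_true, List.any_eq_true, Bool.and_eq_true, decide_eq_true_eq]
    constructor
    · rintro ⟨l, hl, ⟨h3, h4⟩, h5⟩
      by_cases h6 : (l.1 : ℕ) < h
      · exact .inl ⟨l, hl, ⟨h3, h6⟩, h5⟩
      · by_cases h7 : (l.1 : ℕ) < 2 * h
        · exact .inr (.inl ⟨l, hl, ⟨by omega, h7⟩, h5⟩)
        · exact .inr (.inr ⟨l, hl, ⟨by omega, h4⟩, h5⟩)
    · rintro (⟨l, hl, -, h5⟩ | ⟨l, hl, -, h5⟩ | ⟨l, hl, -, h5⟩) <;>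
        exact ⟨l, hl, ⟨by omega, l.1.2⟩, h5⟩
  rw [hs, partSat_congr low, partSat_congr mid, partSat_congr high, unsatLow, unsatMid, unsatHigh]
  generalize partSat _ _ _ _ = x
  generalize partSat _ _ _ _ = y
  generalize partSat _ _ _ _ = z
  cases x <;> cases y <;> cases z <;> rfl

theorem countP_eq_card_filter {α : Type*} (l : List α) (p : α → Bool) (d : α) :
    l.countP p = ((Finset.range l.length).filter fun j => p (l.getD j d) = true).card := by
  induction l using List.reverseRecOn with
  | nil => simp
  | append_singleton l a ih =>
    rw [List.countP_append, ih, List.length_append, List.length_singleton, Finset.range_add_one,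
      Finset.filter_insert]
    have h1 : ((Finset.range l.length).filter fun j => p ((l ++ [a]).getD j d) = true) =
        (Finset.range l.length).filter fun j => p (l.getD j d) = true := by
      refine Finset.filter_congr fun j hj => ?_
      rw [List.getD_append _ _ _ _ (Finset.mem_range.1 hj)]
    rw [h1, List.getD_append_right _ _ _ _ le_rfl, Nat.sub_self]
    by_cases ha : p a
    · simp [ha]
    · simp [ha]

theorem numSat_compose (F : CNF) {h α β γ : ℕ} (hα : α < 2 ^ h) (hγ : γ < 2 ^ h) :
    F.numSat (F.assignment (compose h α β γ)) +
      unsatCount F.m (F.unsatLow h) (F.unsatHigh h) (F.unsatMid h) α β γ = F.m := by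
  rw [numSat, countP_eq_card_filter _ _ [], unsatCount, m]
  have h1 := Finset.card_filter_add_card_filter_not (s := Finset.range F.clauses.length) fun j =>
    satisfies (F.assignment (compose h α β γ)) (F.clauses.getD j []) = true
  rw [Finset.card_range] at h1
  refine Eq.trans ?_ h1
  congr 2
  refine Finset.filter_congr fun j _ => ?_
  rw [satisfies_assignment, partSat_compose F hα hγ]
  cases F.unsatLow h α j <;> cases F.unsatHigh h β j <;> cases F.unsatMid h γ j <;> simp

/-- Two divisions by `2 ^ h` with remainder. If `2 * h` exceeds the number of variables, the
truncated exponent is 0, and `β = 0` is the only choice. -/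
theorem exists_compose (F : CNF) (h : ℕ) (a : Fin F.n → Bool) : ∃ α < 2 ^ h, ∃ β < 2 ^ (F.n - 2 * h),
    ∃ γ < 2 ^ h, F.assignment (compose h α β γ) = a := by
  obtain ⟨g, hg, rfl⟩ := F.exists_assignment a
  have hpos : 0 < 2 ^ h := by positivity
  refine ⟨g % 2 ^ h, Nat.mod_lt _ hpos, g / 2 ^ h / 2 ^ h, ?_, g / 2 ^ h % 2 ^ h,
    Nat.mod_lt _ hpos, ?_⟩
  · rw [Nat.div_div_eq_div_mul, ← pow_add, Nat.div_lt_iff_lt_mul (by positivity), ← pow_add]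
    exact hg.trans_le (Nat.pow_le_pow_right (by norm_num) (by omega))
  · congr 1
    have h1 := Nat.mod_add_div g (2 ^ h)
    have h2 := Nat.mod_add_div (g / 2 ^ h) (2 ^ h)
    rw [compose, show 2 * h = h + h by ring, pow_add]
    generalize g / 2 ^ h / 2 ^ h = c at *
    generalize g / 2 ^ h % 2 ^ h = d at *
    rw [← h2] at h1
    refine Eq.trans ?_ h1
    ring

end CNF

namespace WordRAM

open WordRAM.Expr

/-! ## Running the simulated program -/

/-- The instruction changes at most the registers in `S`. -/
def Instr.only (S : ℕ → Bool) : Instr → Bool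
  | .op x _ _ _ => S x
  | .get x _ _ => S x
  | .lit x _ => S x
  | .put _ _ _ => false

theorem runBlock_only {S : ℕ → Bool} {w : ℕ} {l : List Instr} (hl : l.all (·.only S) = true)
    (s : State) : (runBlock w l s).mem = s.mem ∧ ∀ r, S r = false → (runBlock w l s).reg r = s.reg r := by
  induction l generalizing s with
  | nil => exact ⟨rfl, fun _ _ => rfl⟩
  | cons i l ih =>
    simp only [List.all_cons, Bool.and_eq_true] at hl
    obtain ⟨h1, h2⟩ := ih hl.2 (i.run w s)
    have h3 : (i.run w s).mem = s.mem ∧ ∀ r, S r = false → (i.run w s).reg r = s.reg r := by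
      cases i with
      | put A i v => exact absurd hl.1 (by simp [Instr.only])
      | op x o a b | get x A i | lit x c =>
        refine ⟨rfl, fun r hr => ?_⟩
        rw [Instr.run, State.setReg_reg, if_neg]
        rintro rfl
        exact absurd hl.1 (by simp [Instr.only, hr])
    exact ⟨h1.trans h3.1, fun r hr => (h2 r hr).trans (h3.2 r hr)⟩

theorem runBlock_clear {w : ℕ} (R : ℕ) (s : State) :
    (runBlock w ((List.range R).map fun r => Instr.lit (64 + 2 * r) 0) s).mem = s.mem ∧
      (∀ r < 64, (runBlock w ((List.range R).map fun r => Instr.lit (64 + 2 * r) 0) s).reg r =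
        s.reg r) ∧
      ∀ r < R, (runBlock w ((List.range R).map fun r => Instr.lit (64 + 2 * r) 0) s).reg
        (64 + 2 * r) = 0 := by
  have happ : ∀ (l : List Instr) (i : Instr) (s : State),
      runBlock w (l ++ [i]) s = i.run w (runBlock w l s) := by
    intro l i s
    induction l generalizing s with
    | nil => rfl
    | cons i' l ih => exact ih _
  induction R with
  | zero => exact ⟨rfl, fun _ _ => rfl, fun r hr => absurd hr (Nat.not_lt_zero _)⟩
  | succ R ih =>
    obtain ⟨h1, h2, h3⟩ := ih
    rw [List.range_succ, List.map_append, List.map_singleton, happ]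
    generalize runBlock w _ s = s' at *
    refine ⟨h1, fun r hr => ?_, fun r hr => ?_⟩
    · rw [Instr.run, State.setReg_reg, if_neg (by omega), h2 r hr]
    · rw [Instr.run, State.setReg_reg]
      split_ifs with h
      · exact Nat.zero_mod _
      · exact h3 r (by omega)

theorem Keeps.of_agree {b s s' : State} (h : Keeps b s) (h' : Agree scratch s' s) : Keeps b s' := by
  refine ⟨fun r hr => (h'.reg r ?_).trans (h.reg r hr), ?_, ?_⟩
  · simp only [scratch, temps]
    rw [decide_eq_false (by omega : ¬ 64 < r), decide_eq_false (by omega : ¬ 24 ≤ r)]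
    rfl
  · rw [h'.mem, h.mem₀]
  · rw [h'.mem, h.mem₁]

/-- Complete the simulated input, and set the fuel and the simulated registers. -/
def headerProg (R : ℕ) : Prog :=
  .seq (block [.put 2 (lit 0) (var 7), .put 3 (lit 0) (var 13), .put 2 (lit 1) (var 17),
    .put 3 (lit 1) (var 13), .put 2 (lit 2) (var 12), .put 3 (lit 2) (var 13),
    .op 14 .add (var 8) (lit 0)])
  (block ((List.range R).map fun r => Instr.lit (64 + 2 * r) 0))

section

variable {w : ℕ} {F : CNF} {h K N f : ℕ} {b : State}

theorem CNF.isEdgeList_edges (F : CNF) {h K N : ℕ} (hN : 8 * (F.m + 1) * 2 ^ h ≤ N) :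
    IsEdgeList N (F.edges h K) := isEdgeList_edgeList (by positivity) hN

/-- The first three words of the simulated input are written after the edges, since the number of
edges is known only then. All words are below `2 ^ w`, so the reduction of the input in `initial`
has no effect. The simulated registers have to be cleared explicitly, as they carry no stamps. -/
theorem runs_headerProg (R : ℕ) (hb : Setup F h K N f b) (hw : Fits w F h K N f)
    (hk : b.reg 12 < 2 ^ w) (hE : IsEdgeList N (F.edges h K)) {s : State} (hs : Keeps b s)
    (hL : Holds (F.edges h K) s) :
    Runs scratch w (headerProg R) s (40 + R) fun s' => Keeps b s' ∧ s'.reg 14 = f ∧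
      (∀ B j, s'.mem (3 + 2 * B) j ≤ b.reg 13) ∧
      Simulates R (initial w (KPMFInstance.ofEdges hE (b.reg 12)).input) s' := by
  have hnw := hw.n
  have hNw := hw.N
  have hcap := hw.cap
  have hf := hw.f
  have hed := hw.edges
  have hlen : (F.edges h K).length ≤ 2 ^ h * (F.m * (7 + F.m)) := length_edgeList_le
  have hS := hb.of_keeps hs
  have hwords : ∀ i, (edgeWords (F.edges h K)).getD i 0 < 2 ^ w := by
    intro i
    by_cases hi : i < (edgeWords (F.edges h K)).length
    · rw [List.getD_eq_getElem _ _ hi]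
      obtain ⟨e, he, hm⟩ := List.mem_flatMap.1 (List.getElem_mem hi)
      have h1 := hE.lt e he
      have h2 := cap_le_of_mem_edgeList he
      simp only [List.mem_cons, List.not_mem_nil, or_false] at hm
      rcases hm with hm | hm | hm <;> omega
    · rw [List.getD_eq_default _ _ (by omega)]
      positivity
  have part₁ : Runs scratch w (block [.put 2 (lit 0) (var 7), .put 3 (lit 0) (var 13),
      .put 2 (lit 1) (var 17), .put 3 (lit 1) (var 13), .put 2 (lit 2) (var 12),
      .put 3 (lit 2) (var 13), .op 14 .add (var 8) (lit 0)]) s 30 fun s' => Keeps b s' ∧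
      s'.reg 14 = f ∧ (∀ B j, s'.mem (3 + 2 * B) j ≤ b.reg 13) ∧ ∀ A i, s'.stamped A i =
        (initial w (KPMFInstance.ofEdges hE (b.reg 12)).input).mem A i := by
    refine Runs.block_le hasTemps_scratch rfl (by decide) ?_
    have h14 : Op.eval w .add (s.reg 8) 0 = f := by
      rw [hS.f, Op.eval_add (by omega), add_zero]
    simp only [runBlock, Instr.run, Expr.eval, Nat.zero_mod, State.setMem_reg,
      Nat.mod_eq_of_lt (show 1 < 2 ^ w by omega), Nat.mod_eq_of_lt (show 2 < 2 ^ w by omega),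
      h14]
    refine ⟨?_, ?_, ?_, ?_⟩
    · refine ⟨fun r hr => ?_, ?_, ?_⟩
      · simp only [State.setReg_reg, State.setMem_reg]
        rw [if_neg (by omega), hs.reg r hr]
      · rw [← hs.mem₀]
        funext i
        simp [State.setMem_mem]
      · rw [← hs.mem₁]
        funext i
        simp [State.setMem_mem]
    · simp [State.setReg_reg]
    · intro B j
      have h1 := hL.stamp B j
      rw [hs.reg 13 (by norm_num)] at h1
      simp only [State.setReg_mem, State.setMem_mem, hs.reg 13 (by norm_num : 13 < 14)]
      rw [if_neg (by omega : ¬ (3 + 2 * B = 2 ∧ j = 2)), if_neg (by omega : ¬ (3 + 2 * B = 2 ∧ j = 1)),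
        if_neg (by omega : ¬ (3 + 2 * B = 2 ∧ j = 0))]
      split_ifs <;> omega
    · intro A i
      rw [State.stamped_setReg _ (by norm_num)]
      have k₁ := State.stamped_store s 0 0 (s.reg 7) A i
      have k₂ := State.stamped_store ((s.setMem 2 0 (s.reg 7)).setMem 3 0 (s.reg 13)) 0 1
        (s.reg 17) A i
      have k₃ := State.stamped_store ((((s.setMem 2 0 (s.reg 7)).setMem 3 0 (s.reg 13)).setMem
        2 1 (s.reg 17)).setMem 3 1 (s.reg 13)) 0 2 (s.reg 12) A i
      simp only [State.setMem_reg, mul_zero, add_zero] at k₁ k₂ k₃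
      rw [k₃, k₂, k₁, hL.cell, hS.N, hL.count, hs.reg 12 (by norm_num)]
      simp only [initial, KPMFInstance.ofEdges_input]
      by_cases hA : A = 0
      · subst hA
        have hk' := hwords (i - 3)
        rcases i with _ | _ | _ | i
        · simp [Nat.mod_eq_of_lt hNw]
        · simp [Nat.mod_eq_of_lt (show (F.edges h K).length < 2 ^ w by omega)]
        · simp [Nat.mod_eq_of_lt hk]
        · rw [show i + 1 + 1 + 1 - 3 = i by omega] at hk' ⊢
          rw [if_neg (by omega), if_neg (by omega), if_neg (by omega), if_pos (by omega),
            if_pos rfl]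
          exact (Nat.mod_eq_of_lt hk').symm
      · simp [hA]
  have part₂ : ∀ s₁, (Keeps b s₁ ∧ s₁.reg 14 = f ∧ (∀ B j, s₁.mem (3 + 2 * B) j ≤ b.reg 13) ∧
      ∀ A i, s₁.stamped A i = (initial w (KPMFInstance.ofEdges hE (b.reg 12)).input).mem A i) →
      Runs scratch w (block ((List.range R).map fun r => Instr.lit (64 + 2 * r) 0)) s₁ (R + 1)
      fun s' => Keeps b s' ∧ s'.reg 14 = f ∧ (∀ B j, s'.mem (3 + 2 * B) j ≤ b.reg 13) ∧
      Simulates R (initial w (KPMFInstance.ofEdges hE (b.reg 12)).input) s' := by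
    rintro s₁ ⟨k1, k2, k3, k4⟩
    obtain ⟨h1, h2, h3⟩ := runBlock_clear (w := w) R s₁
    refine Runs.block_le hasTemps_scratch ?_ (le_of_eq ?_) ⟨?_, ?_, ?_, ?_⟩
    · rw [List.all_eq_true]
      intro i hi
      obtain ⟨r, -, rfl⟩ := List.mem_map.1 hi
      rfl
    · have : ∀ l : List ℕ, blockCost (l.map fun r => Instr.lit (64 + 2 * r) 0) = l.length + 1 := by
        intro l
        induction l with
        | nil => rfl
        | cons r l ih => rw [List.map_cons, blockCost, ih, Instr.cost, List.length_cons]; omega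
      rw [this, List.length_range]
    · exact ⟨fun r hr => (h2 r (by omega)).trans (k1.reg r hr), by rw [h1, k1.mem₀],
        by rw [h1, k1.mem₁]⟩
    · rw [h2 _ (by norm_num), k2]
    · rw [h1]
      exact k3
    · refine ⟨h3, fun A i => ?_⟩
      rw [← k4, State.stamped, State.stamped, h1, h2 13 (by norm_num)]
  exact Runs.mono (Runs.seq part₁ part₂) (by omega) fun _ h => h

/-- Termination and the preservation of the control state hold for every input. Only the last
conclusion depends on the simulated program halting in time. -/
theorem runs_fueled {P : Prog} {R : ℕ} (hP : P.RegsBelow R) {s : State} (hw : 1 ≤ w)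
    (hf : f < 2 ^ w) (hs : Keeps b s) (h14 : s.reg 14 = f)
    (hst : ∀ B j, s.mem (3 + 2 * B) j ≤ b.reg 13) {v : State} (hv : Simulates R v s) :
    Runs scratch w P.fueled s (P.fuelCost * (1 + f)) fun s' => Keeps b s' ∧
      (∀ B j, s'.mem (3 + 2 * B) j ≤ b.reg 13) ∧
      ∀ t v', Exec w P v t v' → t ≤ f → Simulates R v' s' := by
  intro s₀ hs₀
  have h13 : s₀.reg 13 = b.reg 13 := (hs₀.reg 13 rfl).trans (hs.reg 13 (by norm_num))
  have h14' : s₀.reg 14 = f := (hs₀.reg 14 rfl).trans h14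
  obtain ⟨t, s', e, hfr, ht⟩ := P.fueled_halts hw s₀ (by omega)
  have hk := hs.of_agree hs₀
  refine ⟨t, s', s', e, ht.trans (Nat.mul_le_mul_left _ (by omega)), Agree.refl _, ?_, ?_, ?_⟩
  · refine hk.trans ⟨fun r hr => hfr.reg r (by omega) (by omega) (by omega) (by omega), hfr.mem₀,
      hfr.mem₁⟩
  · intro B j
    rcases hfr.stamp B j with h | h
    · rw [h, hs₀.mem]
      exact hst B j
    · rw [h, h13]
  · intro t' v' hex ht'
    have hv₀ : Simulates R v s₀ := by
      refine ⟨fun r hr => ?_, fun A i => ?_⟩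
      · rw [hs₀.reg, hv.reg r hr]
        simp only [scratch, temps]
        rw [decide_eq_false (by omega : ¬ 64 + 2 * r < 40), decide_eq_false
          (by omega : ¬ (64 + 2 * r) % 2 = 1)]
        simp
      · rw [← hv.mem A i, State.stamped, State.stamped, hs₀.mem, hs₀.reg 13 rfl]
    obtain ⟨t'', s'', e', hsim, -⟩ := hex.fueled hw hP s₀ (by omega) (by omega) hv₀
    -- The run that halts within the fuel and the run that simulates the program are the same by
    -- determinism.
    obtain ⟨-, rfl⟩ := e.deterministic e'
    exact hsim

end

end WordRAM

namespace WordRAM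

open WordRAM.Expr

/-! ## Searching the simulated output -/

/-- The contents of a cell of the simulated array `1`. -/
def outputExpr (i : Expr) : Expr := mul (get 4 i) (bin .eq (get 5 i) (var 13))

/-- Multiplication by the result of the stamp test replaces a branch. A product is reduced modulo `2
^ w`, so the simulated cell must contain a word. -/
theorem eval_outputExpr {w : ℕ} (h1 : 1 < 2 ^ w) {s : State} {i : Expr} {j : ℕ}
    (hi : i.eval w s = j) (hj : s.stamped 1 j < 2 ^ w) :
    (outputExpr i).eval w s = s.stamped 1 j := by
  rw [State.stamped] at hj ⊢
  simp only [outputExpr, Expr.eval, hi, Op.eval_eq h1]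
  by_cases h : s.mem (3 + 2 * 1) j = s.reg 13
  · rw [if_pos h] at hj ⊢
    rw [show s.mem 5 j = s.reg 13 from h, decide_eq_true rfl, Bool.toNat_true,
      Op.eval_mul (by rwa [mul_one]), mul_one]
  · rw [if_neg h, decide_eq_false (show ¬ s.mem 5 j = s.reg 13 from h), Bool.toNat_false,
      Op.eval_mul (by rw [mul_zero]; omega), mul_zero]

/-- A triple of the simulated output that tells something about the formula. -/
structure Relevant (F : CNF) (h K : ℕ) (out : ℕ → ℕ) (e : ℕ) : Prop where
  lt : e < out 0
  src : out (3 * e + 1) < 2 ^ h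
  flow : out (3 * e + 3) < K * F.m
  le : 7 * (F.m + 1) ≤ out (3 * e + 2) / 2 ^ h
  lt_add : out (3 * e + 2) / 2 ^ h < 7 * (F.m + 1) + F.m

/-- Register `41` contains the largest third part of a sink, plus one, among the relevant triples
below `e`, and the registers `42` and `43` contain the partial assignments of such a triple. -/
structure Scanned (F : CNF) (h K : ℕ) (out : ℕ → ℕ) (e : ℕ) (s : State) : Prop where
  attained : s.reg 41 = 7 * (F.m + 1) ∨ ∃ e', Relevant F h K out e' ∧
    s.reg 41 = out (3 * e' + 2) / 2 ^ h + 1 ∧ s.reg 42 = out (3 * e' + 1) ∧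
    s.reg 43 = out (3 * e' + 2) % 2 ^ h
  le : ∀ e' < e, Relevant F h K out e' → out (3 * e' + 2) / 2 ^ h + 1 ≤ s.reg 41

/-- The simulated output consists of words, and it is not too long. -/
structure Sound (w f : ℕ) (out : ℕ → ℕ) : Prop where
  count : out 0 ≤ f
  words : ∀ e < out 0, out (3 * e + 1) < 2 ^ w ∧ out (3 * e + 2) < 2 ^ w ∧ out (3 * e + 3) < 2 ^ w

/-- Load the triple with number `e` in register `40`, and decide whether it is an improvement. -/
def scanInstrs : List Instr :=
  [.op 46 .add (outputExpr (add (mul (lit 3) (var 40)) (lit 1))) (lit 0),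
    .op 47 .add (outputExpr (add (mul (lit 3) (var 40)) (lit 2))) (lit 0),
    .op 48 .add (outputExpr (add (mul (lit 3) (var 40)) (lit 3))) (lit 0),
    .op 50 .div (var 47) (var 4),
    .op 49 .band (bin .band (bin .lt (var 40) (var 45)) (bin .lt (var 46) (var 4)))
      (bin .band (bin .lt (var 48) (mul (var 6) (var 2)))
        (bin .band (bin .eq (bin .lt (var 50) (var 41)) (lit 0))
          (bin .lt (var 50) (add (mul (lit 7) (var 3)) (var 2)))))]

/-- Search the simulated output for the best triple. -/
def scanProg : Prog :=
  .seq (block [.op 41 .mul (lit 7) (var 3), .lit 42 0, .lit 43 0,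
    .op 45 .add (outputExpr (lit 0)) (lit 0)])
  (forLoop 40 (var 8) (.seq (block scanInstrs)
    (cond (var 49) (block [.op 41 .add (var 50) (lit 1), .op 42 .add (var 46) (lit 0),
      .op 43 .mod (var 47) (var 4)]) (block []))))

section

variable {w : ℕ} {F : CNF} {h K N f : ℕ} {b : State}

theorem Keeps.of_only {s s' : State} (hs : Keeps b s) (hm : s'.mem = s.mem) {S : ℕ → Bool}
    (hr : ∀ r, S r = false → s'.reg r = s.reg r) (hS : ∀ r < 14, S r = false) : Keeps b s' :=
  ⟨fun r h => (hr r (hS r h)).trans (hs.reg r h), by rw [hm, hs.mem₀], by rw [hm, hs.mem₁]⟩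

/-- The test asks whether the triple is relevant and at least as good as the current record.
Register `41` stores the best quotient plus one, so reaching it is a strict improvement. -/
theorem runBlock_scanInstrs (hb : Setup F h K N f b) (hw : Fits w F h K N f) {s : State}
    (hs : Keeps b s) {e : ℕ} (he : e < f) (h40 : s.reg 40 = e) {out : ℕ → ℕ}
    (hout : ∀ i, s.stamped 1 i = out i) (hsound : Sound w f out) (h45 : s.reg 45 = out 0)
    (h41 : 7 * (F.m + 1) ≤ s.reg 41) :
    ((runBlock w scanInstrs s).reg 49 ≠ 0 ↔ Relevant F h K out e ∧
        s.reg 41 ≤ out (3 * e + 2) / 2 ^ h) ∧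
      (e < out 0 → (runBlock w scanInstrs s).reg 46 = out (3 * e + 1) ∧
        (runBlock w scanInstrs s).reg 47 = out (3 * e + 2) ∧
        (runBlock w scanInstrs s).reg 50 = out (3 * e + 2) / 2 ^ h) := by
  have hnw := hw.n
  have hf := hw.f
  have hNw := hw.N
  have hN := hw.nodes
  have hcap := hw.cap
  have hK1 : K * (F.m + 1) = K * F.m + K := by ring
  have h1 : 1 < 2 ^ w := by omega
  have hS := hb.of_keeps hs
  have h8 : 8 * (F.m + 1) ≤ 8 * (F.m + 1) * 2 ^ h := Nat.le_mul_of_pos_right _ (by positivity)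
  obtain ⟨s₁, hs₁⟩ : ∃ s₁, s₁ = runBlock w scanInstrs s := ⟨_, rfl⟩
  obtain ⟨A, hA⟩ : ∃ A, A = (outputExpr (add (mul (lit 3) (var 40)) (lit 1))).eval w s := ⟨_, rfl⟩
  obtain ⟨B, hB⟩ : ∃ B, B = (outputExpr (add (mul (lit 3) (var 40)) (lit 2))).eval w s := ⟨_, rfl⟩
  obtain ⟨Y, hY⟩ : ∃ Y, Y = (outputExpr (add (mul (lit 3) (var 40)) (lit 3))).eval w s := ⟨_, rfl⟩
  -- The three values are results of multiplications and thus words, even if the triple lies beyond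
  -- the end of the output.
  have hAw : A < 2 ^ w := by rw [hA]; exact Nat.mod_lt _ (by positivity)
  have hBw : B < 2 ^ w := by rw [hB]; exact Nat.mod_lt _ (by positivity)
  have hYw : Y < 2 ^ w := by rw [hY]; exact Nat.mod_lt _ (by positivity)
  have hfin : s₁ = (((((s.setReg 46 A).setReg 47 B).setReg 48 Y).setReg 50 (B / 2 ^ h)).setReg 49
      (decide (e < out 0) && decide (A < 2 ^ h) && (decide (Y < K * F.m) &&
        (decide (s.reg 41 ≤ B / 2 ^ h) &&
          decide (B / 2 ^ h < 7 * (F.m + 1) + F.m)))).toNat) := by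
    have e46 : Instr.run w s (.op 46 .add (outputExpr (add (mul (lit 3) (var 40)) (lit 1)))
        (lit 0)) = s.setReg 46 A := run_copy hA.symm hAw
    have e47 : Instr.run w (s.setReg 46 A) (.op 47 .add
        (outputExpr (add (mul (lit 3) (var 40)) (lit 2))) (lit 0)) =
        (s.setReg 46 A).setReg 47 B := run_copy (hB ▸ rfl) hBw
    have e48 : Instr.run w ((s.setReg 46 A).setReg 47 B) (.op 48 .add
        (outputExpr (add (mul (lit 3) (var 40)) (lit 3))) (lit 0)) =
        ((s.setReg 46 A).setReg 47 B).setReg 48 Y := run_copy (hY ▸ rfl) hYw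
    rw [hs₁, scanInstrs]
    simp only [runBlock, e46, e47, e48]
    simp only [Instr.run, Expr.eval, State.setReg_reg, Nat.reduceEqDiff, if_true, if_false,
      h40, h45, hS.Q, hS.K, hS.m, hS.W, Nat.zero_mod, Op.eval_div hBw, Op.eval_lt h1,
      Op.eval_eq h1, Nat.mod_eq_of_lt (show 7 < 2 ^ w by omega)]
    rw [Op.eval_mul (x := K) (by omega), Op.eval_mul (x := 7) (by omega),
      Op.eval_add (x := 7 * (F.m + 1)) (by omega), Op.eval_band h1, Op.eval_band h1,
      Op.eval_band h1, Op.eval_band h1]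
    congr 5
    by_cases hlt : B / 2 ^ h < s.reg 41
    · simp [hlt]
    · simp [hlt, not_lt.1 hlt]
  rw [← hs₁]
  have hvals : e < out 0 → A = out (3 * e + 1) ∧ B = out (3 * e + 2) ∧ Y = out (3 * e + 3) := by
    intro heo
    obtain ⟨w1, w2, w3⟩ := hsound.words e heo
    rw [← hout] at w1 w2 w3
    have pos : ∀ c, c ≤ 3 → (add (mul (lit 3) (var 40)) (lit c)).eval w s = 3 * e + c := by
      intro c hc
      simp only [Expr.eval, h40]
      rw [Nat.mod_eq_of_lt (show 3 < 2 ^ w by omega), Nat.mod_eq_of_lt (show c < 2 ^ w by omega),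
        Op.eval_mul (by omega), Op.eval_add (by omega)]
    rw [hA, hB, hY, eval_outputExpr h1 (pos 1 (by omega)) w1,
      eval_outputExpr h1 (pos 2 (by omega)) w2, eval_outputExpr h1 (pos 3 (by omega)) w3,
      hout, hout, hout]
    exact ⟨rfl, rfl, rfl⟩
  constructor
  · have hne : ∀ x : Bool, x.toNat ≠ 0 ↔ x = true := by rintro (_ | _) <;> simp
    rw [hfin, State.setReg_reg, if_pos rfl, hne]
    simp only [Bool.and_eq_true, decide_eq_true_eq]
    constructor
    · rintro ⟨⟨k1, k2⟩, k3, k4, k5⟩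
      obtain ⟨rfl, rfl, rfl⟩ := hvals k1
      exact ⟨⟨k1, k2, k3, h41.trans k4, k5⟩, k4⟩
    · rintro ⟨⟨k1, k2, k3, -, k5⟩, k4⟩
      obtain ⟨rfl, rfl, rfl⟩ := hvals k1
      exact ⟨⟨k1, k2⟩, k3, k4, k5⟩
  · intro heo
    obtain ⟨h1, h2, -⟩ := hvals heo
    rw [hfin, ← h1, ← h2]
    simp [State.setReg_reg]

/-- The loop always makes `f` iterations, which is enough because a program that halts within the
fuel lists at most `f` triples. Everything about the record is conditional on `Sound`, as a failed
run may leave anything behind. -/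
theorem runs_scanProg (hb : Setup F h K N f b) (hw : Fits w F h K N f) {s : State}
    (hs : Keeps b s) {out : ℕ → ℕ} (hout : ∀ i, s.stamped 1 i = out i) :
    Runs scratch w scanProg s (f * 200 + 50) fun s' => Keeps b s' ∧ s'.mem = s.mem ∧
      (Sound w f out → Scanned F h K out f s') := by
  have hnw := hw.n
  have hf := hw.f
  have hNw := hw.N
  have hN := hw.nodes
  have h8 : 8 * (F.m + 1) ≤ 8 * (F.m + 1) * 2 ^ h := Nat.le_mul_of_pos_right _ (by positivity)
  have h1 : 1 < 2 ^ w := by omega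
  let I : ℕ → State → Prop := fun e s' => Keeps b s' ∧ s'.mem = s.mem ∧ s'.reg 40 = e ∧
    (Sound w f out → s'.reg 45 = out 0 ∧ Scanned F h K out e s')
  have stamped_eq : ∀ s', Keeps b s' → s'.mem = s.mem → ∀ i, s'.stamped 1 i = out i := by
    intro s' hs' hm i
    rw [← hout, State.stamped, State.stamped, hm, hs'.reg _ (by norm_num), hs.reg _ (by norm_num)]
  have part₁ : Runs scratch w (block [.op 41 .mul (lit 7) (var 3), .lit 42 0, .lit 43 0,
      .op 45 .add (outputExpr (lit 0)) (lit 0)]) s 30 fun s' => Keeps b s' ∧ s'.mem = s.mem ∧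
      (Sound w f out → s'.reg 45 = out 0 ∧ s'.reg 41 = 7 * (F.m + 1)) := by
    obtain ⟨h1, h2⟩ := runBlock_only (S := fun r => decide (40 ≤ r)) (w := w)
      (l := [.op 41 .mul (lit 7) (var 3), .lit 42 0, .lit 43 0,
        .op 45 .add (outputExpr (lit 0)) (lit 0)]) rfl s
    refine Runs.block_le hasTemps_scratch rfl (by decide) ⟨hs.of_only h1 h2 (fun r hr => ?_), h1,
      fun hsound => ?_⟩
    · exact decide_eq_false (by omega)
    · have ho : s.stamped 1 0 < 2 ^ w := by
        have := hsound.count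
        rw [hout]
        omega
      have e0 : (lit 0).eval w (((s.setReg 41 (7 * (F.m + 1))).setReg 42 0).setReg 43 0) = 0 :=
        Nat.zero_mod _
      have e1 := eval_outputExpr (by omega) e0
        (by rwa [State.stamped_setReg _ (by norm_num), State.stamped_setReg _ (by norm_num),
          State.stamped_setReg _ (by norm_num)])
      rw [State.stamped_setReg _ (by norm_num), State.stamped_setReg _ (by norm_num),
          State.stamped_setReg _ (by norm_num)] at e1
      simp only [runBlock]
      have e2 : Instr.run w s (.op 41 .mul (lit 7) (var 3)) = s.setReg 41 (7 * (F.m + 1)) := by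
        simp only [Instr.run, Expr.eval, (hb.of_keeps hs).W]
        rw [Nat.mod_eq_of_lt (by omega), Op.eval_mul (by omega)]
      have e3 : ∀ (s : State) (x : ℕ), Instr.run w s (.lit x 0) = s.setReg x 0 := fun s x => by
        simp [Instr.run]
      rw [e2, e3, e3, run_copy e1 ho, hout]
      simp [State.setReg_reg]
  have part₂ : ∀ s₁, (Keeps b s₁ ∧ s₁.mem = s.mem ∧
      (Sound w f out → s₁.reg 45 = out 0 ∧ s₁.reg 41 = 7 * (F.m + 1))) →
      Runs scratch w (forLoop 40 (var 8) (.seq (block scanInstrs)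
        (cond (var 49) (block [.op 41 .add (var 50) (lit 1), .op 42 .add (var 46) (lit 0),
          .op 43 .mod (var 47) (var 4)]) (block [])))) s₁ (f * 200 + 5) (I f) := by
    rintro s₁ ⟨k1, k2, k3⟩
    refine Runs.forLoop_le (T := 190) hasTemps_scratch rfl rfl (by omega) I ?_ ?_ ?_
      (by simp only [Expr.cost]; omega)
    · refine ⟨k1.setReg _ (by norm_num), k2, by simp [State.setReg_reg], fun hsound => ?_⟩
      obtain ⟨k4, k5⟩ := k3 hsound
      exact ⟨by simp [State.setReg_reg, k4], .inl (by simp [State.setReg_reg, k5]),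
        fun e' he' => absurd he' (Nat.not_lt_zero _)⟩
    · rintro e s₂ - ⟨hs, -, h40, -⟩
      exact ⟨h40, (hb.of_keeps hs).f⟩
    · rintro e s₂ he ⟨hs, hm, h40, hgood⟩
      refine Runs.seq (T₁ := 120) (T₂ := 70) (R₁ := fun s' => s' = runBlock w scanInstrs s₂)
        (Runs.block_le hasTemps_scratch rfl (by decide) rfl) ?_
      obtain ⟨m1, m2⟩ := runBlock_only (S := fun r => decide (46 ≤ r)) (w := w)
        (l := scanInstrs) rfl s₂
      have mk : Keeps b (runBlock w scanInstrs s₂) :=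
        hs.of_only m1 m2 fun r hr => decide_eq_false (by omega)
      have h41 : Sound w f out → 7 * (F.m + 1) ≤ s₂.reg 41 := fun hsound => by
        rcases (hgood hsound).2.attained with h | ⟨e', h, h', -⟩
        · omega
        · have := h.le
          omega
      have hscan := fun hsound => runBlock_scanInstrs hb hw hs he h40 (stamped_eq _ hs hm) hsound
        (hgood hsound).1 (h41 hsound)
      rintro _ rfl
      generalize runBlock w scanInstrs s₂ = s₃ at *
      have hv : (var 49).eval w s₃ = s₃.reg 49 := rfl
      refine Runs.mono (T := 1 + 1 + 60) (Runs.cond (e := var 49) hasTemps_scratch rfl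
        (fun h49 => ?_) fun h49 => ?_) (by omega) fun _ h => h
      · rw [hv] at h49
        obtain ⟨n1, n2⟩ := runBlock_only (S := fun r => decide (41 ≤ r) && decide (r < 45)) (w := w)
          (l := [.op 41 .add (var 50) (lit 1), .op 42 .add (var 46) (lit 0),
            .op 43 .mod (var 47) (var 4)]) rfl s₃
        refine Runs.block_le hasTemps_scratch rfl (by decide) ?_
        refine ⟨?_, (mk.of_only n1 n2 fun r hr => ?_).setReg _ (by norm_num), ?_, ?_,
          fun hsound => ?_⟩
        · rw [n2 _ rfl, m2 _ rfl, h40]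
        · rw [decide_eq_false (by omega)]
          rfl
        · rw [State.setReg_mem, n1, m1, hm]
        · simp [State.setReg_reg]
        · obtain ⟨g1, g2⟩ := hscan hsound
          obtain ⟨hrel, himp⟩ := g1.1 h49
          obtain ⟨v1, v2, v3⟩ := g2 hrel.lt
          obtain ⟨u1, u2, -⟩ := hsound.words e hrel.lt
          have hle := hrel.lt_add
          refine ⟨by rw [State.setReg_reg, if_neg (by norm_num), n2 _ rfl, m2 _ rfl,
            (hgood hsound).1], ?_⟩
          have hQ := (hb.of_keeps mk).Q
          have e1 : Instr.run w s₃ (.op 41 .add (var 50) (lit 1)) =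
              s₃.setReg 41 (out (3 * e + 2) / 2 ^ h + 1) := by
            simp only [Instr.run, Expr.eval, v3]
            rw [Nat.mod_eq_of_lt h1, Op.eval_add (by omega)]
          have e2 := run_copy (w := w) (x := 42) (e := var 46) (v := out (3 * e + 1))
            (s := s₃.setReg 41 (out (3 * e + 2) / 2 ^ h + 1)) (by
              simp [Expr.eval, State.setReg_reg, v1]) u1
          have e3 : Instr.run w ((s₃.setReg 41 (out (3 * e + 2) / 2 ^ h + 1)).setReg 42
              (out (3 * e + 1))) (.op 43 .mod (var 47) (var 4)) =
              ((s₃.setReg 41 (out (3 * e + 2) / 2 ^ h + 1)).setReg 42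
              (out (3 * e + 1))).setReg 43 (out (3 * e + 2) % 2 ^ h) := by
            simp only [Instr.run, Expr.eval, State.setReg_reg, Nat.reduceEqDiff, if_false, v2, hQ]
            rw [Op.eval_mod u2]
          simp only [runBlock]
          rw [e1, e2, e3]
          refine ⟨.inr ⟨e, hrel, by simp [State.setReg_reg], by simp [State.setReg_reg],
            by simp [State.setReg_reg]⟩, fun e' he' hrel' => ?_⟩
          rw [show ((((s₃.setReg 41 (out (3 * e + 2) / 2 ^ h + 1)).setReg 42
            (out (3 * e + 1))).setReg 43 (out (3 * e + 2) % 2 ^ h)).setReg 40 (e + 1)).reg 41 =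
            out (3 * e + 2) / 2 ^ h + 1 by simp [State.setReg_reg]]
          rcases Nat.lt_succ_iff_lt_or_eq.1 he' with h | rfl
          · exact ((hgood hsound).2.le e' h hrel').trans (by omega)
          · exact le_rfl
      · rw [hv] at h49
        refine Runs.block_le hasTemps_scratch rfl (by decide) ?_
        refine ⟨(m2 _ rfl).trans h40, mk.setReg _ (by norm_num), by rw [State.setReg_mem, runBlock, m1, hm],
          by simp [State.setReg_reg], fun hsound => ?_⟩
        obtain ⟨k4, k5⟩ := hgood hsound
        obtain ⟨g1, -⟩ := hscan hsound
        have e41 : ((runBlock w [] s₃).setReg 40 (e + 1)).reg 41 = s₂.reg 41 := by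
          rw [State.setReg_reg, if_neg (by norm_num)]
          exact m2 _ rfl
        have e42 : ((runBlock w [] s₃).setReg 40 (e + 1)).reg 42 = s₂.reg 42 := by
          rw [State.setReg_reg, if_neg (by norm_num)]
          exact m2 _ rfl
        have e43 : ((runBlock w [] s₃).setReg 40 (e + 1)).reg 43 = s₂.reg 43 := by
          rw [State.setReg_reg, if_neg (by norm_num)]
          exact m2 _ rfl
        refine ⟨by rw [State.setReg_reg, if_neg (by norm_num)]; exact (m2 _ rfl).trans k4, ?_, ?_⟩
        · rw [e41, e42, e43]
          exact k5.attained
        · intro e' he' hrel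
          rw [e41]
          rcases Nat.lt_succ_iff_lt_or_eq.1 he' with h | rfl
          · exact k5.le e' h hrel
          · by_contra hlt
            exact g1.2 ⟨hrel, by omega⟩ h49
  refine Runs.mono (Runs.seq part₁ part₂) (by omega) ?_
  rintro s' ⟨k1, k2, -, k4⟩
  exact ⟨k1, k2, fun hsound => (k4 hsound).2⟩

end

end WordRAM

namespace WordRAM

open WordRAM.Expr

/-! ## Verification, and one threshold -/

/-- Count the clauses that the assignment in register `53` satisfies. -/
def countProg : Prog :=
  .seq (block [.lit 52 0]) (forLoop 20 (var 2)
    (.seq (satProg (var 53) (lit 0) (var 1) (var 20)) (block [.op 52 .add (var 52) (var 28)])))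

/-- Register `54` becomes the best value that is known after the search through all assignments
that extend the partial assignments in the registers `42` and `43`. -/
def verifyProg : Prog :=
  .seq (block [.op 54 .add (var 10) (lit 0)])
  (forLoop 51 (var 6)
    (.seq (block [.op 53 .add (add (var 42) (mul (var 43) (var 4)))
      (bin .shl (var 51) (mul (lit 2) (var 5)))])
    (.seq countProg
      (cond (bin .lt (var 54) (var 52)) (block [.op 54 .add (var 52) (lit 0)]) (block [])))))

/-- Try one threshold. -/
def candidateProg (P : Prog) (R : ℕ) : Prog :=
  .seq buildProg (.seq (headerProg R) (.seq P.fueled (.seq scanProg (.seq verifyProg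
    (block [.op 10 .add (var 54) (lit 0)])))))

section

variable {w : ℕ} {F : CNF} {h K N f : ℕ} {b : State}

theorem runs_countProg (hb : Setup F h K N f b) (hw : Fits w F h K N f) {s : State}
    (hs : Keeps b s) {g : ℕ} (h53 : s.reg 53 = g) (hg : g < 2 ^ w) {R : State → Prop}
    (hR : ∀ v, R (((s.setReg 28 v).setReg 52 (F.numSat (F.assignment g))).setReg 20 F.m)) :
    Runs scratch w countProg s (F.m * (100 * F.size + 20) + 10) R := by
  have hnw := hw.n
  have hm : F.m + 2 < 2 ^ w := by
    have := hw.input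
    have := F.le_length_input
    omega
  let I : ℕ → State → Prop := fun j s' => ∃ v, s' = ((s.setReg 28 v).setReg 52
    ((F.clauses.take j).countP (CNF.satisfies (F.assignment g)))).setReg 20 j
  have keeps : ∀ j s', I j s' → Keeps b s' := by
    rintro j s' ⟨v, rfl⟩
    exact ((hs.setReg _ (by norm_num)).setReg _ (by norm_num)).setReg _ (by norm_num)
  have part₁ : Runs scratch w (block [.lit 52 0]) s 2 fun s' => s' = s.setReg 52 0 := by
    refine Runs.block_le hasTemps_scratch rfl (by decide) ?_
    simp only [runBlock, Instr.run, Nat.zero_mod]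
  have part₂ : Runs scratch w (forLoop 20 (var 2) (.seq
      (satProg (var 53) (lit 0) (var 1) (var 20)) (block [.op 52 .add (var 52) (var 28)])))
      (s.setReg 52 0) (F.m * (100 * F.size + 20) + 5) (I F.m) := by
    refine Runs.forLoop_le (T := 100 * F.size + 13) hasTemps_scratch rfl rfl (by omega) I ?_ ?_ ?_
      (by simp only [Expr.cost]; rw [show 100 * F.size + 13 + 1 + 6 = 100 * F.size + 20 by ring])
    · refine ⟨s.reg 28, ?_⟩
      simp [State.setReg]
    · rintro j s' - hI
      refine ⟨?_, (hb.of_keeps (keeps j s' hI)).m⟩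
      obtain ⟨v, rfl⟩ := hI
      simp [State.setReg_reg]
    · rintro j s' hj' hI
      have hj : j < F.clauses.length := hj'
      have hk := keeps j s' hI
      have hS := hb.of_keeps hk
      obtain ⟨v, rfl⟩ := hI
      have h53' : (var 53).eval w (((s.setReg 28 v).setReg 52 ((F.clauses.take j).countP
        (CNF.satisfies (F.assignment g)))).setReg 20 j) = g := by
        simp [Expr.eval, State.setReg_reg, h53]
      have h20' : (var 20).eval w (((s.setReg 28 v).setReg 52 ((F.clauses.take j).countP
        (CNF.satisfies (F.assignment g)))).setReg 20 j) = j := by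
        simp [Expr.eval, State.setReg_reg]
      have h1' : (var 1).eval w (((s.setReg 28 v).setReg 52 ((F.clauses.take j).countP
        (CNF.satisfies (F.assignment g)))).setReg 20 j) = F.n := hS.n
      have hlit : (lit 0).eval w (((s.setReg 28 v).setReg 52 ((F.clauses.take j).countP
        (CNF.satisfies (F.assignment g)))).setReg 20 j) = 0 := Nat.zero_mod _
      refine Runs.mono (Runs.seq (T₂ := 5) (runs_satProg (a := var 53) (lo := lit 0) (hi := var 1)
        (c := var 20) (R := fun s' => s' = _) hS.mem₀ hw.input hw.n rfl rfl rfl rfl (by omega)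
        (by omega) (by omega) (by rw [h20']; exact hj) rfl) ?_) (by
          simp only [Expr.cost, CNF.size]; omega) fun _ h => h
      rintro _ rfl
      refine Runs.block_le hasTemps_scratch rfl (by decide) ?_
      simp only [h53', h20', h1', hlit]
      have hc : (F.clauses.take (j + 1)).countP (CNF.satisfies (F.assignment g)) =
          (F.clauses.take j).countP (CNF.satisfies (F.assignment g)) +
            (partSat g 0 F.n F.clauses[j]).toNat := by
        rw [← List.take_concat_get' _ _ hj, List.countP_append, List.countP_singleton,
          CNF.satisfies_assignment]
        cases partSat g 0 F.n F.clauses[j] <;> rfl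
      have hle : (F.clauses.take j).countP (CNF.satisfies (F.assignment g)) ≤ j :=
        List.countP_le_length.trans (List.length_take_le _ _)
      have hbool := Bool.toNat_le (partSat g 0 F.n F.clauses[j])
      simp only [runBlock, Instr.run, Expr.eval, State.setReg_reg, Nat.reduceEqDiff, if_true,
        if_false]
      rw [Op.eval_add (by omega), ← hc]
      refine ⟨trivial, (partSat g 0 F.n F.clauses[j]).toNat, ?_⟩
      simp only [State.setReg, State.mk.injEq, and_true]
      funext r
      simp only [Function.update_apply]
      split_ifs <;> rfl
  refine Runs.mono (Runs.seq part₁ (T₂ := F.m * (100 * F.size + 20) + 5) fun s' hs' => hs' ▸ part₂)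
    (by omega) ?_
  rintro s' ⟨v, rfl⟩
  have := hR v
  rwa [CNF.numSat, ← List.take_length (l := F.clauses)] at this

/-- Each value with which register `54` is compared is the number of clauses that some assignment
satisfies. It therefore stays below `B` even if the registers `42` and `43` contain garbage, and it
is complete for their extensions if they contain partial assignments. -/
theorem runs_verifyProg (hb : Setup F h K N f b) (hw : Fits w F h K N f) {B : ℕ}
    (hB : ∀ a, F.numSat a ≤ B) (h10 : b.reg 10 ≤ B) (hBm : B ≤ F.m) {s : State}
    (hs : Keeps b s) :
    Runs scratch w verifyProg s (K * (200 * F.size ^ 2) + 20) fun s' => Keeps b s' ∧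
      s'.mem = s.mem ∧ s'.reg 54 ≤ B ∧ b.reg 10 ≤ s'.reg 54 ∧
      (s.reg 42 < 2 ^ h → s.reg 43 < 2 ^ h → ∀ β < K,
        F.numSat (F.assignment (CNF.compose h (s.reg 42) β (s.reg 43))) ≤ s'.reg 54) := by
  have hnw := hw.n
  have hsh := hw.shift
  have hhalf := hw.half
  have hQle : 2 ^ h ≤ 2 ^ (3 * h) := Nat.pow_le_pow_right (by norm_num) (by omega)
  have hKQ := hw.le_Q
  have hm : F.m + 2 < 2 ^ w := by
    have := hw.input
    have := F.le_length_input
    omega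
  have h1 : 1 < 2 ^ w := by omega
  let I : ℕ → State → Prop := fun β s' => Keeps b s' ∧ s'.mem = s.mem ∧ s'.reg 51 = β ∧
    s'.reg 42 = s.reg 42 ∧ s'.reg 43 = s.reg 43 ∧ s'.reg 54 ≤ B ∧ b.reg 10 ≤ s'.reg 54 ∧
    (s.reg 42 < 2 ^ h → s.reg 43 < 2 ^ h → ∀ β' < β,
      F.numSat (F.assignment (CNF.compose h (s.reg 42) β' (s.reg 43))) ≤ s'.reg 54)
  have part₁ : Runs scratch w (block [.op 54 .add (var 10) (lit 0)]) s 5 fun s' =>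
      s' = s.setReg 54 (b.reg 10) := by
    refine Runs.block_le hasTemps_scratch rfl (by decide) ?_
    have h10' : (var 10).eval w s = b.reg 10 := hs.reg 10 (by norm_num)
    simp only [runBlock]
    rw [run_copy h10' (by omega)]
  have part₂ : Runs scratch w (forLoop 51 (var 6)
      (.seq (block [.op 53 .add (add (var 42) (mul (var 43) (var 4)))
        (bin .shl (var 51) (mul (lit 2) (var 5)))])
      (.seq countProg
        (cond (bin .lt (var 54) (var 52)) (block [.op 54 .add (var 52) (lit 0)]) (block [])))))
      (s.setReg 54 (b.reg 10)) (K * (200 * F.size ^ 2) + 5) (I K) := by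
    refine Runs.forLoop_le (T := 20 + (F.m * (100 * F.size + 20) + 10 + 20)) hasTemps_scratch rfl
      rfl (by omega) I ?_ ?_ ?_ ?_
    · refine ⟨(hs.setReg _ (by norm_num)).setReg _ (by norm_num), rfl, ?_⟩
      simp [State.setReg_reg, h10]
    · rintro β s' - ⟨hk, -, h51, -⟩
      exact ⟨h51, (hb.of_keeps hk).K⟩
    · rintro β s' hβ ⟨hk, hmem, h51, h42, h43, h54, h54', hbest⟩
      obtain ⟨g, hg⟩ : ∃ g, g = Op.eval w .add
        ((add (var 42) (mul (var 43) (var 4))).eval w s')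
        ((bin .shl (var 51) (mul (lit 2) (var 5))).eval w s') := ⟨_, rfl⟩
      -- Whatever the hint is, the sum is a word, and the bits of any word describe some assignment.
      have hgw : g < 2 ^ w := by
        rw [hg]
        exact Nat.mod_lt _ (by positivity)
      have hgood : s.reg 42 < 2 ^ h → s.reg 43 < 2 ^ h →
          g = CNF.compose h (s.reg 42) β (s.reg 43) := by
        intro hα hγ
        have hlt := CNF.compose_lt hα (hβ.trans_le hKQ) hγ
        have h2 := hlt
        rw [CNF.compose] at h2
        rw [hg]
        simp only [Expr.eval, h42, h43, h51, (hb.of_keeps hk).Q, (hb.of_keeps hk).half]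
        rw [Nat.mod_eq_of_lt (show 2 < 2 ^ w by omega), Op.eval_mul (x := 2) (by omega),
          Op.eval_mul (by omega), Op.eval_shl (by omega), Op.eval_add (x := s.reg 42) (by omega),
          Op.eval_add (by omega)]
        rfl
      refine Runs.seq (R₁ := fun s₁ => s₁ = s'.setReg 53 g) (Runs.block_le hasTemps_scratch rfl
        (by decide) (by simp only [runBlock, Instr.run, ← hg])) ?_
      rintro _ rfl
      have hbody : ∀ v, Runs scratch w (cond (bin .lt (var 54) (var 52))
          (block [.op 54 .add (var 52) (lit 0)]) (block []))
          ((((s'.setReg 53 g).setReg 28 v).setReg 52 (F.numSat (F.assignment g))).setReg 20 F.m)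
          20 fun s' => s'.reg 51 = β ∧ I (β + 1) (s'.setReg 51 (β + 1)) := by
        intro v
        have hcase : F.numSat (F.assignment g) ≤ B := hB _
        have hkk : Keeps b ((((s'.setReg 53 g).setReg 28 v).setReg 52
            (F.numSat (F.assignment g))).setReg 20 F.m) :=
          (((hk.setReg _ (by norm_num)).setReg _ (by norm_num)).setReg _ (by norm_num)).setReg _
            (by norm_num)
        have hev : (bin .lt (var 54) (var 52)).eval w ((((s'.setReg 53 g).setReg 28 v).setReg 52
            (F.numSat (F.assignment g))).setReg 20 F.m) =
            (decide (s'.reg 54 < F.numSat (F.assignment g))).toNat := by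
          simp [Expr.eval, State.setReg_reg, Op.eval_lt h1]
        refine Runs.mono (Runs.cond (T := 10) hasTemps_scratch rfl (fun hne => ?_) fun hze => ?_)
          (by decide) fun _ h => h
        · rw [hev] at hne
          have hlt : s'.reg 54 < F.numSat (F.assignment g) := by
            by_contra hlt
            simp [hlt] at hne
          refine Runs.block_le hasTemps_scratch rfl (by decide) ?_
          simp only [runBlock]
          rw [run_copy (v := F.numSat (F.assignment g)) (by simp [Expr.eval, State.setReg_reg])
            (by omega)]
          refine ⟨by simp [State.setReg_reg, h51], (hkk.setReg _ (by norm_num)).setReg _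
            (by norm_num), hmem, ?_⟩
          simp only [State.setReg_reg, Nat.reduceEqDiff, if_true, if_false]
          refine ⟨trivial, h42, h43, hcase, by omega, fun hα hγ β' hβ' => ?_⟩
          rcases Nat.lt_succ_iff_lt_or_eq.1 hβ' with h | rfl
          · exact (hbest hα hγ β' h).trans hlt.le
          · rw [hgood hα hγ]
        · rw [hev] at hze
          have hlt : ¬ s'.reg 54 < F.numSat (F.assignment g) := by
            intro hlt
            simp [hlt] at hze
          refine Runs.block_le hasTemps_scratch rfl (by decide) ?_
          refine ⟨by simp [runBlock, State.setReg_reg, h51], hkk.setReg _ (by norm_num), hmem, ?_⟩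
          simp only [runBlock, State.setReg_reg, Nat.reduceEqDiff, if_true, if_false]
          refine ⟨trivial, h42, h43, h54, h54', fun hα hγ β' hβ' => ?_⟩
          rcases Nat.lt_succ_iff_lt_or_eq.1 hβ' with h | rfl
          · exact hbest hα hγ β' h
          · rw [← hgood hα hγ]
            exact not_lt.1 hlt
      refine Runs.seq (R₁ := fun s₁ => ∃ v, s₁ = (((s'.setReg 53 g).setReg 28 v).setReg 52
        (F.numSat (F.assignment g))).setReg 20 F.m) (runs_countProg hb hw (hk.setReg _
        (by norm_num)) (by simp [State.setReg_reg]) hgw fun v => ⟨v, rfl⟩) ?_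
      rintro _ ⟨v, rfl⟩
      exact hbody v
    · have h1 : 1 ≤ F.size := by rw [CNF.size]; omega
      have h2 : F.m * (100 * F.size + 20) ≤ (F.size - 1) * (100 * F.size + 20) :=
        Nat.mul_le_mul_right _ (by rw [CNF.size]; omega)
      have h3 : 20 + (F.m * (100 * F.size + 20) + 10 + 20) + (var 6).cost + 6 ≤
          200 * F.size ^ 2 := by
        obtain ⟨z, hz⟩ := Nat.exists_eq_add_of_le h1
        rw [hz] at h2 ⊢
        simp only [Expr.cost, Nat.add_sub_cancel_left] at h2 ⊢
        nlinarith
      have := Nat.mul_le_mul_left K h3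
      simp only [Expr.cost] at this ⊢
      omega
  refine Runs.mono (Runs.seq part₁ (T₂ := K * (200 * F.size ^ 2) + 5) fun s' hs' => hs' ▸ part₂)
    (by omega) ?_
  rintro s' ⟨k1, k2, -, -, -, k3, k4, k5⟩
  exact ⟨k1, k2, k3, k4, k5⟩

end

end WordRAM

namespace WordRAM

open WordRAM.Expr

section

variable {w : ℕ} {F : CNF} {h K N f : ℕ} {b : State}

/-- The threshold is large enough, and the simulated program solves the instance with this
threshold sufficiently fast. -/
def Succeeds (w : ℕ) (F : CNF) (h K N f : ℕ) (P : Prog) (k : ℕ) : Prop :=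
  K * F.m ≤ k ∧ ∃ (hE : IsEdgeList N (F.edges h K)) (t : ℕ) (v : State),
    Exec w P (initial w (KPMFInstance.ofEdges hE k).input) t v ∧
      (KPMFInstance.ofEdges hE k).Correct (v.mem 1) ∧ t ≤ f

/-- What the output of a correct run tells about the formula. -/
theorem numSat_le_of_scanned (hw : Fits w F h K N f) (hK : K = 2 ^ (F.n - 2 * h)) {k : ℕ}
    (hk : K * F.m ≤ k) {hE : IsEdgeList N (F.edges h K)} {out : ℕ → ℕ}
    (hout : (KPMFInstance.ofEdges hE k).Correct out) {s : State} (hs : Scanned F h K out f s)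
    (hf : out 0 ≤ f) {best : ℕ} (hbest : s.reg 42 < 2 ^ h → s.reg 43 < 2 ^ h → ∀ β < K,
      F.numSat (F.assignment (CNF.compose h (s.reg 42) β (s.reg 43))) ≤ best)
    (a : Fin F.n → Bool) : F.numSat a ≤ best := by
  rcases Nat.eq_zero_or_pos (F.numSat a) with h0 | hpos
  · omega
  have hQ : 0 < 2 ^ h := by positivity
  obtain ⟨α, hα, β, hβ, γ, hγ, rfl⟩ := F.exists_compose h a
  have hsum := F.numSat_compose (β := β) hα hγ
  generalize hσ : F.numSat (F.assignment (CNF.compose h α β γ)) = x at *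
  -- The sink parameter is one less than the number of satisfied clauses, so that an assignment
  -- satisfying `σ + 1` clauses makes the flow fall short of `K * M`.
  obtain ⟨σ, rfl⟩ := Nat.exists_eq_add_of_le' hpos
  have hσm : σ < F.m := by omega
  obtain ⟨y, hy, e, he, e₁, e₂, e₃⟩ := (inOutput_edgeList hw.le_Q hw.nodes hk hE hout hα hγ hσm).2
    ⟨β, hK ▸ hβ, by omega⟩
  -- The quotient of a sink number by `2 ^ h` is `σ` up to a constant and the remainder is `γ`, so
  -- comparing quotients compares the values of `σ`.
  have hdiv : ∀ σ γ, γ < 2 ^ h → node (2 ^ h) (F.m + 1) 7 σ γ / 2 ^ h = 7 * (F.m + 1) + σ := by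
    intro σ γ hγ
    rw [node, add_comm, Nat.add_mul_div_right _ _ hQ, Nat.div_eq_of_lt hγ, zero_add]
  have hrel : Relevant F h K out e := by
    refine ⟨he, ?_, e₃ ▸ hy, ?_, ?_⟩
    · rw [e₁, node]
      omega
    · rw [e₂, hdiv _ _ hγ]
      omega
    · rw [e₂, hdiv _ _ hγ]
      omega
  have h1 := hs.le e (he.trans_le hf) hrel
  rw [e₂, hdiv _ _ hγ] at h1
  rcases hs.attained with h2 | ⟨e', hrel', h2, h3, h4⟩
  · omega
  obtain ⟨σ', hσ'⟩ := Nat.exists_eq_add_of_le hrel'.le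
  have hσm' : σ' < F.m := by
    have := hrel'.lt_add
    omega
  have hα' : s.reg 42 < 2 ^ h := h3 ▸ hrel'.src
  have hγ' : s.reg 43 < 2 ^ h := h4 ▸ Nat.mod_lt _ hQ
  have hnode : out (3 * e' + 2) = node (2 ^ h) (F.m + 1) 7 σ' (s.reg 43) := by
    rw [node, h4, ← hσ']
    exact (Nat.div_add_mod' _ _).symm
  -- The recorded triple has `σ' ≥ σ`, and its flow below `K * M` yields a `β'` whose assignment
  -- satisfies more than `σ'` clauses. The verification has tested this assignment.
  obtain ⟨β', hβ', h5⟩ := (inOutput_edgeList hw.le_Q hw.nodes hk hE hout hα' hγ' hσm').1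
    ⟨_, hrel'.flow, e', hrel'.lt, by rw [← h3, node]; omega, hnode, rfl⟩
  have h6 := F.numSat_compose (β := β') hα' hγ'
  have h7 := hbest hα' hγ' β' hβ'
  omega

/-- The time bound and the inequality with `B` hold for every threshold. Only the last conclusion,
that the maximum is reached, needs the threshold to be a successful one. -/
theorem runs_candidateProg {P : Prog} {R : ℕ} (hP : P.RegsBelow R) (hb : Setup F h K N f b)
    (hw : Fits w F h K N f) (hK : K = 2 ^ (F.n - 2 * h)) (hL : Holds [] (b.setReg 17 0))
    (hk : b.reg 12 < 2 ^ w) {B : ℕ} (hB : ∀ a, F.numSat a ≤ B) (h10 : b.reg 10 ≤ B)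
    (hBm : B ≤ F.m) :
    Runs scratch w (candidateProg P R) b (2 ^ h * (4000 * F.size ^ 3) + P.fuelCost * (1 + f) +
      f * 200 + K * (200 * F.size ^ 2) + (R + 200)) fun s' =>
      (∀ r < 14, r ≠ 10 → s'.reg r = b.reg r) ∧ s'.mem 0 = b.mem 0 ∧ s'.mem 1 = b.mem 1 ∧
      (∀ A j, s'.mem (3 + 2 * A) j ≤ b.reg 13) ∧ b.reg 10 ≤ s'.reg 10 ∧ s'.reg 10 ≤ B ∧
      (Succeeds w F h K N f P (b.reg 12) → ∀ a, F.numSat a ≤ s'.reg 10) := by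
  have hnw := hw.n
  have hNw := hw.N
  have hf := hw.f
  have hE : IsEdgeList N (F.edges h K) := CNF.isEdgeList_edges F hw.nodes
  have hm : F.m + 2 < 2 ^ w := by
    have := hw.input
    have := F.le_length_input
    omega
  have part₅ : ∀ s₁, (Keeps b s₁ ∧ (∀ B j, s₁.mem (3 + 2 * B) j ≤ b.reg 13) ∧
      ((∃ t v, Exec w P (initial w (KPMFInstance.ofEdges hE (b.reg 12)).input) t v ∧
        (KPMFInstance.ofEdges hE (b.reg 12)).Correct (v.mem 1) ∧ t ≤ f) →
        Scanned F h K (s₁.stamped 1) f s₁ ∧ s₁.stamped 1 0 ≤ f ∧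
        (KPMFInstance.ofEdges hE (b.reg 12)).Correct (s₁.stamped 1))) →
      Runs scratch w (.seq verifyProg (block [.op 10 .add (var 54) (lit 0)])) s₁
        (K * (200 * F.size ^ 2) + 20 + 5) fun s' =>
      (∀ r < 14, r ≠ 10 → s'.reg r = b.reg r) ∧ s'.mem 0 = b.mem 0 ∧ s'.mem 1 = b.mem 1 ∧
      (∀ A j, s'.mem (3 + 2 * A) j ≤ b.reg 13) ∧ b.reg 10 ≤ s'.reg 10 ∧ s'.reg 10 ≤ B ∧
      (Succeeds w F h K N f P (b.reg 12) → ∀ a, F.numSat a ≤ s'.reg 10) := by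
    rintro s₁ ⟨k1, k2, k3⟩
    refine Runs.seq (runs_verifyProg hb hw hB h10 hBm k1) ?_
    rintro s₂ ⟨l1, l2, l3, l4, l5⟩
    refine Runs.block_le hasTemps_scratch rfl (by decide) ?_
    simp only [runBlock]
    rw [run_copy (v := s₂.reg 54) rfl (by omega)]
    refine ⟨fun r hr hr' => ?_, l1.mem₀, l1.mem₁, fun A j => ?_, ?_, ?_, ?_⟩
    · rw [State.setReg_reg, if_neg hr', l1.reg r hr]
    · rw [State.setReg_mem, l2]
      exact k2 A j
    · rwa [State.setReg_reg, if_pos rfl]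
    · rwa [State.setReg_reg, if_pos rfl]
    · rintro ⟨hKm, hE', t, v, hex⟩
      rw [State.setReg_reg, if_pos rfl]
      obtain ⟨q1, q2, q3⟩ := k3 ⟨t, v, hex⟩
      exact numSat_le_of_scanned hw hK hKm q3 q1 q2 l5
  have part₄ : ∀ s₁, (Keeps b s₁ ∧ (∀ B j, s₁.mem (3 + 2 * B) j ≤ b.reg 13) ∧
      ∀ t v', Exec w P (initial w (KPMFInstance.ofEdges hE (b.reg 12)).input) t v' → t ≤ f →
        Simulates R v' s₁) → Runs scratch w scanProg s₁ (f * 200 + 50) fun s₁ =>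
      Keeps b s₁ ∧ (∀ B j, s₁.mem (3 + 2 * B) j ≤ b.reg 13) ∧
      ((∃ t v, Exec w P (initial w (KPMFInstance.ofEdges hE (b.reg 12)).input) t v ∧
        (KPMFInstance.ofEdges hE (b.reg 12)).Correct (v.mem 1) ∧ t ≤ f) →
        Scanned F h K (s₁.stamped 1) f s₁ ∧ s₁.stamped 1 0 ≤ f ∧
        (KPMFInstance.ofEdges hE (b.reg 12)).Correct (s₁.stamped 1)) := by
    rintro s₁ ⟨k1, k2, k3⟩
    refine Runs.mono (runs_scanProg hb hw k1 (out := s₁.stamped 1) fun _ => rfl) le_rfl ?_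
    rintro s₂ ⟨l1, l2, l3⟩
    have hst : s₂.stamped 1 = s₁.stamped 1 := by
      funext i
      rw [State.stamped, State.stamped, l2, l1.reg 13 (by norm_num), k1.reg 13 (by norm_num)]
    rw [hst, l2]
    refine ⟨l1, k2, ?_⟩
    rintro ⟨t, v, hex, hcor, ht⟩
    have hv : s₁.stamped 1 = v.mem 1 := funext fun i => (k3 t v hex ht).mem 1 i
    have hcount := hcor.count_le hex
    rw [hv] at l3 ⊢
    -- The entries of a correct output are words: the nodes are below `N`, and a listed flow is at
    -- most the threshold in register `12`.
    refine ⟨l3 ⟨hcount.trans ht, fun e he => ?_⟩, hcount.trans ht, hcor⟩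
    obtain ⟨u, u', h1, h2, -, -, h3⟩ := (hcor _ _ _).1 ⟨e, he, rfl, rfl, rfl⟩
    have h4 : (u : ℕ) < N := u.2
    have h5 : (u' : ℕ) < N := u'.2
    have h6 : v.mem 1 (3 * e + 3) ≤ b.reg 12 := h3
    omega
  refine Runs.mono (Runs.seq (runs_buildProg hb hw hL) fun s₁ h₁ =>
    Runs.seq (runs_headerProg R hb hw hk hE h₁.1 h₁.2) fun s₂ h₂ =>
    Runs.seq (runs_fueled hP (Nat.one_le_iff_ne_zero.2 ?_) (by omega) h₂.1 h₂.2.1 h₂.2.2.1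
      h₂.2.2.2) fun s₃ h₃ => Runs.seq (part₄ s₃ h₃) fun s₄ h₄ => part₅ s₄ h₄) ?_ fun _ h => h
  · rintro rfl
    omega
  · omega

end

end WordRAM

namespace CNF

/-- The words of the input are small. -/
theorem getD_input_le (F : CNF) (i : ℕ) : F.input.getD i 0 ≤ max F.m (2 * F.n + 1) := by
  by_cases hi : i < F.input.length
  · rw [List.getD_eq_getElem _ _ hi]
    have hm := List.getElem_mem hi
    generalize F.input[i] = x at hm
    rw [input_eq, List.mem_cons, List.mem_cons, List.mem_flatMap] at hm
    rcases hm with rfl | rfl | ⟨C, hC, hx⟩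
    · omega
    · omega
    · rw [clauseWords, List.mem_cons, List.mem_map] at hx
      rcases hx with rfl | ⟨l, -, rfl⟩
      · have := List.length_le_of_nodup_literals (F.nodup C hC)
        omega
      · have h1 := l.1.2
        have h2 := Bool.toNat_le l.2
        omega
  · rw [List.getD_eq_default _ _ (by omega)]
    exact Nat.zero_le _

theorem exists_max_numSat (F : CNF) : ∃ a, ∀ a', F.numSat a' ≤ F.numSat a :=
  Finite.exists_max F.numSat

end CNF

namespace WordRAM

open WordRAM.Expr

/-! ## The whole program -/

/-- Try all powers of two below `2 ^ L`, where `L` is in register `9`. -/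
def candidatesProg (P : Prog) (R : ℕ) : Prog :=
  forLoop 11 (var 9) (.seq (block [.op 13 .add (var 11) (lit 1), .op 12 .shl (lit 1) (var 11)])
    (candidateProg P R))

/-- Multiply register `x` by `e` for `d` times. -/
def powProg (x : ℕ) (e : Expr) (d : ℕ) : Prog :=
  forLoop 18 (lit d) (block [.op x .mul (var x) e])

/-- Compute the parameters of the construction. -/
def parameterProg (p q D E C : ℕ) : Prog :=
  .seq (block [.get 1 0 (lit 0), .get 2 0 (lit 1), .op 3 .add (var 2) (lit 1),
    .op 5 .add (bin .div (mul (var 1) (lit p)) (lit q)) (lit 1), .op 4 .shl (lit 1) (var 5),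
    .op 6 .shl (lit 1) (mul (bin .lt (mul (lit 2) (var 5)) (var 1))
      (bin .sub (var 1) (mul (lit 2) (var 5)))),
    .op 7 .add (var 4) (lit 0),
    .op 8 .mul (lit C) (bin .shl (lit 1) (bin .sub (var 1) (bin .div (var 1) (lit E)))),
    .op 9 .add (add (var 5) (mul (lit (8 * D)) (var 3))) (lit 1), .lit 10 0])
  (.seq (powProg 7 (mul (lit 8) (var 3)) D) (powProg 8 (var 3) (3 * D)))

/-- Compute the maximum number of clauses that can be satisfied, in register `10`. -/
def maxSatProg (P : Prog) (R p q D E C : ℕ) : Prog :=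
  .seq (parameterProg p q D E C) (candidatesProg P R)

section

variable {w : ℕ} {F : CNF} {h K N f : ℕ}

/-- Register `10` can only grow and never exceeds the bound `B`, so unsuccessful thresholds before
or after the successful one do no harm. -/
theorem runs_candidatesProg {P : Prog} {R : ℕ} (hP : P.RegsBelow R) (hw : Fits w F h K N f)
    (hK : K = 2 ^ (F.n - 2 * h)) {L : ℕ} (hL : L < 2 ^ w)
    (hgood : ∃ i < L, Succeeds w F h K N f P (2 ^ i % 2 ^ w)) {B : ℕ} (hB : ∀ a, F.numSat a ≤ B)
    (hBm : B ≤ F.m) {s : State} (hs : Setup F h K N f s) (h9 : s.reg 9 = L) (h10 : s.reg 10 = 0)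
    (hst : ∀ A j, s.mem (3 + 2 * A) j = 0) :
    Runs scratch w (candidatesProg P R) s (L * (2 ^ h * (4000 * F.size ^ 3) +
      P.fuelCost * (1 + f) + f * 200 + K * (200 * F.size ^ 2) + (R + 230)) + 5) fun s' =>
      s'.reg 2 = F.m ∧ s'.reg 10 ≤ B ∧ ∀ a, F.numSat a ≤ s'.reg 10 := by
  have hnw := hw.n
  have hm : F.m + 2 < 2 ^ w := by
    have := hw.input
    have := F.le_length_input
    omega
  let I : ℕ → State → Prop := fun i s' => Setup F h K N f s' ∧ s'.reg 9 = L ∧ s'.reg 11 = i ∧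
    (∀ A j, s'.mem (3 + 2 * A) j ≤ i) ∧ s'.reg 10 ≤ B ∧
    ((∃ i' < i, Succeeds w F h K N f P (2 ^ i' % 2 ^ w)) → ∀ a, F.numSat a ≤ s'.reg 10)
  have setup : ∀ {s s' : State}, Setup F h K N f s → (∀ r < 9, s'.reg r = s.reg r) →
      s'.mem 0 = s.mem 0 → s'.mem 1 = s.mem 1 → Setup F h K N f s' := by
    intro s s' hs hr h0 h1
    refine ⟨?_, ?_, ?_, ?_, ?_, ?_, ?_, ?_, fun i => ?_, fun i => ?_⟩
    · rw [hr _ (by norm_num), hs.n]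
    · rw [hr _ (by norm_num), hs.m]
    · rw [hr _ (by norm_num), hs.W]
    · rw [hr _ (by norm_num), hs.Q]
    · rw [hr _ (by norm_num), hs.half]
    · rw [hr _ (by norm_num), hs.K]
    · rw [hr _ (by norm_num), hs.N]
    · rw [hr _ (by norm_num), hs.f]
    · rw [h0, hs.mem₀]
    · rw [h1, hs.mem₁]
  refine Runs.mono (Runs.forLoop_le (T := 20 + (2 ^ h * (4000 * F.size ^ 3) +
      P.fuelCost * (1 + f) + f * 200 + K * (200 * F.size ^ 2) + (R + 200))) (T' := L * (2 ^ h *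
      (4000 * F.size ^ 3) + P.fuelCost * (1 + f) + f * 200 + K * (200 * F.size ^ 2) +
      (R + 230)) + 5) hasTemps_scratch rfl rfl hL I ?_ ?_ ?_ ?_) le_rfl ?_
  · refine ⟨setup hs (fun r hr => ?_) rfl rfl, ?_, ?_, fun A j => (hst A j).le, ?_, ?_⟩
    · rw [State.setReg_reg, if_neg (by omega)]
    · simp [State.setReg_reg, h9]
    · simp [State.setReg_reg]
    · simp [State.setReg_reg, h10]
    · rintro ⟨i', hi', -⟩
      exact absurd hi' (Nat.not_lt_zero _)
  · rintro i s' - ⟨-, h9, h11, -⟩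
    exact ⟨h11, h9⟩
  · rintro i s₁ hi ⟨k1, k2, k3, k4, k5, k6⟩
    have hrun : runBlock w [.op 13 .add (var 11) (lit 1), .op 12 .shl (lit 1) (var 11)] s₁ =
        (s₁.setReg 13 (i + 1)).setReg 12 (2 ^ i % 2 ^ w) := by
      simp only [runBlock, Instr.run, Expr.eval, k3, State.setReg_reg, Nat.reduceEqDiff, if_false]
      -- The shift may overflow for large `i`; the threshold is then just another one that need not
      -- succeed.
      rw [Nat.mod_eq_of_lt (show 1 < 2 ^ w by omega), Op.eval_add (by omega), Op.eval, one_mul]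
    refine Runs.seq (Runs.block_le (T := 20) (R := fun s' => s' = _) hasTemps_scratch rfl
      (by decide) hrun) ?_
    rintro _ rfl
    have hset : Setup F h K N f ((s₁.setReg 13 (i + 1)).setReg 12 (2 ^ i % 2 ^ w)) := by
      refine setup k1 (fun r hr => ?_) rfl rfl
      rw [State.setReg_reg, if_neg (by omega), State.setReg_reg, if_neg (by omega)]
    -- All stamps left by earlier rounds are at most `i`, so with the new stamp `i + 1` every
    -- simulated cell reads as zero.
    have hholds : Holds [] (((s₁.setReg 13 (i + 1)).setReg 12 (2 ^ i % 2 ^ w)).setReg 17 0) := by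
      refine ⟨by simp [State.setReg_reg], fun A j => ?_, fun A j => ?_⟩
      · have := k4 A j
        rw [State.stamped, if_neg]
        · simp [edgeWords]
        · simp only [State.setReg_mem, State.setReg_reg, Nat.reduceEqDiff, if_true, if_false]
          omega
      · simp only [State.setReg_mem, State.setReg_reg, Nat.reduceEqDiff, if_true, if_false]
        exact (k4 A j).trans (Nat.le_succ i)
    refine Runs.mono (runs_candidateProg hP hset hw hK hholds ?_ hB ?_ hBm) le_rfl ?_
    · rw [State.setReg_reg, if_pos rfl]
      exact Nat.mod_lt _ (by positivity)
    · simpa [State.setReg_reg] using k5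
    · rintro s' ⟨l1, l2, l3, l4, l5, l6, l7⟩
      simp only [State.setReg_reg, State.setReg_mem, Nat.reduceEqDiff, if_true, if_false] at l1 l2 l3 l4 l5 l7
      refine ⟨?_, setup hset (fun r hr => ?_) ?_ ?_, ?_, ?_, l4, ?_, ?_⟩
      · rw [l1 _ (by norm_num) (by norm_num), if_neg (by norm_num), if_neg (by norm_num), k3]
      · rw [State.setReg_reg, if_neg (by omega), l1 _ (by omega) (by omega)]
        simp only [State.setReg_reg]
      · exact l2
      · exact l3
      · rw [State.setReg_reg, if_neg (by norm_num), l1 _ (by norm_num) (by norm_num),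
          if_neg (by norm_num), if_neg (by norm_num), k2]
      · simp [State.setReg_reg]
      · simpa [State.setReg_reg] using l6
      · rintro ⟨i', hi', hsucc⟩ a
        rw [State.setReg_reg, if_neg (by norm_num)]
        rcases Nat.lt_succ_iff_lt_or_eq.1 hi' with h | rfl
        · exact (k6 ⟨i', h, hsucc⟩ a).trans l5
        · exact l7 hsucc a
  · simp only [Expr.cost]
    rw [show ∀ x, 20 + (x + (R + 200)) + 1 + 6 = x + (R + 227) by intro x; ring]
    exact Nat.add_le_add_right (Nat.mul_le_mul_left L (by omega)) 5
  · rintro s' ⟨k1, -, -, -, k5, k6⟩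
    exact ⟨k1.m, k5, k6 hgood⟩

/-- Since `c` is positive, the intermediate products are bounded by the final one, and it is enough
to exclude overflow there. -/
theorem runs_powProg {x : ℕ} {e : Expr} {d v c : ℕ} {s : State} (hx : scratch x = false)
    (hx18 : x ≠ 18) (he : e.avoids scratch = true) (hd : d < 2 ^ w) (hxv : s.reg x = v)
    (heval : ∀ s' : State, (∀ r, r ≠ x → r ≠ 18 → s'.reg r = s.reg r) → e.eval w s' = c)
    (hpow : v * c ^ d < 2 ^ w) (hc : 0 < c) :
    Runs scratch w (powProg x e d) s (d * (e.cost + 20) + 10) fun s' =>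
      s'.mem = s.mem ∧ s'.reg x = v * c ^ d ∧ ∀ r, r ≠ x → r ≠ 18 → s'.reg r = s.reg r := by
  refine Runs.mono (Runs.forLoop_le (x := 18) (e := lit d) (n := d) (T := e.cost + 10)
    (T' := d * (e.cost + 20) + 10) hasTemps_scratch rfl rfl hd (fun i s' => s'.mem = s.mem ∧
      s'.reg x = v * c ^ i ∧ s'.reg 18 = i ∧ ∀ r, r ≠ x → r ≠ 18 → s'.reg r = s.reg r)
      ?_ ?_ ?_ ?_) le_rfl ?_
  · refine ⟨rfl, ?_, by simp [State.setReg_reg], fun r _ hr => ?_⟩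
    · rw [State.setReg_reg, if_neg hx18, hxv, pow_zero, mul_one]
    · rw [State.setReg_reg, if_neg hr]
  · rintro i s' - ⟨-, -, h18, -⟩
    exact ⟨h18, Nat.mod_eq_of_lt hd⟩
  · rintro i s' hi ⟨k1, k2, k3, k4⟩
    refine Runs.block_le hasTemps_scratch (by simp [Instr.avoids, Expr.avoids, hx, he])
      (by simp only [blockCost, Instr.cost, Expr.cost]; omega) ?_
    have hle : v * c ^ (i + 1) ≤ v * c ^ d :=
      Nat.mul_le_mul_left _ (Nat.pow_le_pow_right hc hi)
    have hrun : runBlock w [.op x .mul (var x) e] s' = s'.setReg x (v * c ^ (i + 1)) := by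
      simp only [runBlock, Instr.run, Expr.eval, k2, heval s' k4]
      rw [Op.eval_mul (by rw [mul_assoc, ← pow_succ]; omega), mul_assoc, ← pow_succ]
    rw [hrun]
    refine ⟨by rw [State.setReg_reg, if_neg (Ne.symm hx18), k3], k1, ?_, ?_, ?_⟩
    · rw [State.setReg_reg, if_neg hx18, State.setReg_reg, if_pos rfl]
    · rw [State.setReg_reg, if_pos rfl]
    · intro r hr hr'
      rw [State.setReg_reg, if_neg hr', State.setReg_reg, if_neg hr, k4 r hr hr']
  · simp only [Expr.cost]
    have : d * (e.cost + 10 + 1 + 6) ≤ d * (e.cost + 20) := Nat.mul_le_mul_left _ (by omega)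
    omega
  · rintro s' ⟨k1, k2, -, k4⟩
    exact ⟨k1, k2, k4⟩

theorem runs_parameterProg {p q D E C : ℕ} (hq : 0 < q) (hE : 0 < E)
    (hh : h = F.n * p / q + 1)
    (hK : K = 2 ^ (F.n - 2 * h)) (hN : N = 2 ^ h * (8 * (F.m + 1)) ^ D)
    (hf : f = C * 2 ^ (F.n - F.n / E) * (F.m + 1) ^ (3 * D)) (hw : Fits w F h K N f)
    (hp : F.n * p + p + q + E + C + 24 * D < 2 ^ w) (hL : h + 8 * D * (F.m + 1) + 1 < 2 ^ w) :
    Runs scratch w (parameterProg p q D E C) (initial w F.input) (200 * D + 150) fun s' =>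
      Setup F h K N f s' ∧ s'.reg 9 = h + 8 * D * (F.m + 1) + 1 ∧ s'.reg 10 = 0 ∧
      ∀ A j, s'.mem (3 + 2 * A) j = 0 := by
  have hnw := hw.n
  have hNw := hw.N
  have hsh := hw.shift
  have hhalf := hw.half
  have hass := hw.assign
  have hm : F.m + 2 < 2 ^ w := by
    have := hw.input
    have := F.le_length_input
    omega
  have h1 : 1 < 2 ^ w := by omega
  have hQle : 2 ^ h ≤ 2 ^ (3 * h) := Nat.pow_le_pow_right (by norm_num) (by omega)
  have hWpos : 0 < (F.m + 1) ^ (3 * D) := by positivity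
  have hf0 : C * 2 ^ (F.n - F.n / E) ≤ f := hf ▸ Nat.le_mul_of_pos_right _ hWpos
  have hfw : f < 2 ^ w := by have := hw.f; omega
  have hmem : ∀ i, (initial w F.input).mem 0 i = F.input.getD i 0 := by
    intro i
    have := F.getD_input_le i
    rw [initial]
    simp only [if_true]
    exact Nat.mod_eq_of_lt (by omega)
  have hn0 : F.input.getD 0 0 = F.n := rfl
  have hm0 : F.input.getD 1 0 = F.m := rfl
  have runInit : Runs scratch w (block [.get 1 0 (lit 0), .get 2 0 (lit 1),
      .op 3 .add (var 2) (lit 1), .op 5 .add (bin .div (mul (var 1) (lit p)) (lit q)) (lit 1),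
      .op 4 .shl (lit 1) (var 5), .op 6 .shl (lit 1) (mul (bin .lt (mul (lit 2) (var 5)) (var 1))
        (bin .sub (var 1) (mul (lit 2) (var 5)))), .op 7 .add (var 4) (lit 0),
      .op 8 .mul (lit C) (bin .shl (lit 1) (bin .sub (var 1) (bin .div (var 1) (lit E)))),
      .op 9 .add (add (var 5) (mul (lit (8 * D)) (var 3))) (lit 1), .lit 10 0])
      (initial w F.input) 90 fun s' => s'.mem = (initial w F.input).mem ∧ s'.reg 1 = F.n ∧
        s'.reg 2 = F.m ∧ s'.reg 3 = F.m + 1 ∧ s'.reg 4 = 2 ^ h ∧ s'.reg 5 = h ∧ s'.reg 6 = K ∧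
        s'.reg 7 = 2 ^ h ∧ s'.reg 8 = C * 2 ^ (F.n - F.n / E) ∧
        s'.reg 9 = h + 8 * D * (F.m + 1) + 1 ∧ s'.reg 10 = 0 := by
    refine Runs.block_le hasTemps_scratch rfl (by simp [blockCost, Instr.cost, Expr.cost]) ?_
    have e5 : Op.eval w .add (Op.eval w .div (Op.eval w .mul F.n p) q) 1 = h := by
      rw [Op.eval_mul (by omega), Op.eval_div (by omega), Op.eval_add (by omega), hh]
    have e6 : Op.eval w .shl 1 (Op.eval w .mul (Op.eval w .lt (2 * h) F.n)
        (Op.eval w .sub F.n (2 * h))) = K := by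
      -- The subtraction of the machine wraps around; multiplication by the comparison bit turns it
      -- into truncated subtraction.
      have hx : Op.eval w .mul (Op.eval w .lt (2 * h) F.n) (Op.eval w .sub F.n (2 * h)) =
          F.n - 2 * h := by
        rw [Op.eval_lt h1]
        by_cases hlt : 2 * h < F.n
        · rw [decide_eq_true hlt, Op.eval_sub (by omega) (by omega), Bool.toNat_true,
            Op.eval_mul (by omega), one_mul]
        · rw [decide_eq_false hlt, Bool.toNat_false, Op.eval_mul (by rw [zero_mul]; omega), zero_mul]
          omega
      have hle : K ≤ 2 ^ h := hw.le_Q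
      rw [hx, Op.eval_shl (by rw [one_mul, ← hK]; omega), one_mul, hK]
    have e8 : Op.eval w .mul C (Op.eval w .shl 1 (Op.eval w .sub F.n (Op.eval w .div F.n E))) =
        C * 2 ^ (F.n - F.n / E) := by
      have hle : 2 ^ (F.n - F.n / E) ≤ 2 ^ F.n :=
        Nat.pow_le_pow_right (by norm_num) (Nat.sub_le _ _)
      rw [Op.eval_div (by omega), Op.eval_sub (Nat.div_le_self _ _) (by omega),
        Op.eval_shl (by omega), one_mul, Op.eval_mul (by omega)]
    have e9 : Op.eval w .add (Op.eval w .add h (Op.eval w .mul (8 * D) (F.m + 1))) 1 =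
        h + 8 * D * (F.m + 1) + 1 := by
      rw [Op.eval_mul (by omega), Op.eval_add (x := h) (by omega), Op.eval_add (by omega)]
    have e2 : Op.eval w .mul 2 h = 2 * h := Op.eval_mul (by omega)
    have e3 : Op.eval w .add F.m 1 = F.m + 1 := Op.eval_add (by omega)
    have e4 : Op.eval w .shl 1 h = 2 ^ h := by rw [Op.eval_shl (by omega), one_mul]
    have e7 : Op.eval w .add (2 ^ h) 0 = 2 ^ h := by rw [Op.eval_add (by omega), add_zero]
    simp only [runBlock, Instr.run, Expr.eval, State.setReg_reg, State.setReg_mem,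
      Nat.reduceEqDiff, if_true, if_false, Nat.zero_mod, Nat.mod_eq_of_lt h1, hmem, hn0, hm0,
      Nat.mod_eq_of_lt (show 2 < 2 ^ w by omega), Nat.mod_eq_of_lt (show p < 2 ^ w by omega),
      Nat.mod_eq_of_lt (show q < 2 ^ w by omega), Nat.mod_eq_of_lt (show E < 2 ^ w by omega),
      Nat.mod_eq_of_lt (show C < 2 ^ w by omega), Nat.mod_eq_of_lt (show 8 * D < 2 ^ w by omega),
      e2, e3, e4, e5, e6, e7, e8, e9, and_self]
  have runNodes : ∀ s₁ : State, (s₁.mem = (initial w F.input).mem ∧ s₁.reg 1 = F.n ∧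
        s₁.reg 2 = F.m ∧ s₁.reg 3 = F.m + 1 ∧ s₁.reg 4 = 2 ^ h ∧ s₁.reg 5 = h ∧ s₁.reg 6 = K ∧
        s₁.reg 7 = 2 ^ h ∧ s₁.reg 8 = C * 2 ^ (F.n - F.n / E) ∧
        s₁.reg 9 = h + 8 * D * (F.m + 1) + 1 ∧ s₁.reg 10 = 0) →
      Runs scratch w (powProg 7 (mul (lit 8) (var 3)) D) s₁ (D * 23 + 10) fun s₁ =>
        s₁.mem = (initial w F.input).mem ∧ s₁.reg 1 = F.n ∧
        s₁.reg 2 = F.m ∧ s₁.reg 3 = F.m + 1 ∧ s₁.reg 4 = 2 ^ h ∧ s₁.reg 5 = h ∧ s₁.reg 6 = K ∧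
        s₁.reg 7 = N ∧ s₁.reg 8 = C * 2 ^ (F.n - F.n / E) ∧
        s₁.reg 9 = h + 8 * D * (F.m + 1) + 1 ∧ s₁.reg 10 = 0 := by
    rintro s₁ ⟨k0, k1, k2, k3, k4, k5, k6, k7, k8, k9, k10⟩
    have h8 : 8 * (F.m + 1) ≤ 8 * (F.m + 1) * 2 ^ h := Nat.le_mul_of_pos_right _ (by positivity)
    have hnodes := hw.nodes
    refine Runs.mono (runs_powProg (c := 8 * (F.m + 1)) (v := 2 ^ h) rfl (by norm_num) rfl
      (by omega) k7 (fun s' hs' => ?_) (by omega) (by omega)) (by simp only [Expr.cost]; omega) ?_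
    · simp only [Expr.eval]
      rw [hs' 3 (by norm_num) (by norm_num), k3, Nat.mod_eq_of_lt (by omega),
        Op.eval_mul (by omega)]
    · rintro s' ⟨l1, l2, l3⟩
      refine ⟨l1.trans k0, ?_, ?_, ?_, ?_, ?_, ?_, l2.trans hN.symm, ?_, ?_, ?_⟩ <;>
        rw [l3 _ (by norm_num) (by norm_num)] <;> assumption
  have runFuel : ∀ s₁ : State, (s₁.mem = (initial w F.input).mem ∧ s₁.reg 1 = F.n ∧
        s₁.reg 2 = F.m ∧ s₁.reg 3 = F.m + 1 ∧ s₁.reg 4 = 2 ^ h ∧ s₁.reg 5 = h ∧ s₁.reg 6 = K ∧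
        s₁.reg 7 = N ∧ s₁.reg 8 = C * 2 ^ (F.n - F.n / E) ∧
        s₁.reg 9 = h + 8 * D * (F.m + 1) + 1 ∧ s₁.reg 10 = 0) →
      Runs scratch w (powProg 8 (var 3) (3 * D)) s₁ (3 * D * 21 + 10) fun s' =>
      Setup F h K N f s' ∧ s'.reg 9 = h + 8 * D * (F.m + 1) + 1 ∧ s'.reg 10 = 0 ∧
      ∀ A j, s'.mem (3 + 2 * A) j = 0 := by
    rintro s₁ ⟨k0, k1, k2, k3, k4, k5, k6, k7, k8, k9, k10⟩
    refine Runs.mono (runs_powProg (c := F.m + 1) (v := C * 2 ^ (F.n - F.n / E)) rfl (by norm_num)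
      rfl (by omega) k8 (fun s' hs' => ?_) (by omega) (by omega)) (by simp only [Expr.cost]; omega) ?_
    · simp only [Expr.eval]
      rw [hs' 3 (by norm_num) (by norm_num), k3]
    · rintro s' ⟨l1, l2, l3⟩
      have l0 := l1.trans k0
      refine ⟨⟨?_, ?_, ?_, ?_, ?_, ?_, ?_, l2.trans hf.symm, ?_, ?_⟩, ?_, ?_, ?_⟩
      · rw [l3 _ (by norm_num) (by norm_num), k1]
      · rw [l3 _ (by norm_num) (by norm_num), k2]
      · rw [l3 _ (by norm_num) (by norm_num), k3]
      · rw [l3 _ (by norm_num) (by norm_num), k4]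
      · rw [l3 _ (by norm_num) (by norm_num), k5]
      · rw [l3 _ (by norm_num) (by norm_num), k6]
      · rw [l3 _ (by norm_num) (by norm_num), k7]
      · rw [l0]
        exact hmem
      · rw [l0]
        exact fun i => rfl
      · rw [l3 _ (by norm_num) (by norm_num), k9]
      · rw [l3 _ (by norm_num) (by norm_num), k10]
      · intro A j
        rw [l0, initial]
        exact if_neg (by omega)
  refine Runs.mono (Runs.seq runInit fun s₁ h₁ => Runs.seq (runNodes s₁ h₁) runFuel) (by omega)
    fun _ h => h

end

end WordRAM

/-! ## The parameters of the construction -/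

namespace CNF

/-- The number of variables in the first and in the second part. -/
def half (F : CNF) (p q : ℕ) : ℕ := F.n * p / q + 1

/-- The number of nodes. -/
def nodes (F : CNF) (h D : ℕ) : ℕ := 2 ^ h * (8 * (F.m + 1)) ^ D

/-- The time limit for the simulated program. -/
def fuel (F : CNF) (D E C : ℕ) : ℕ := C * 2 ^ (F.n - F.n / E) * (F.m + 1) ^ (3 * D)

theorem half_le (F : CNF) {p q : ℕ} (hpq : p ≤ q) (hq : 0 < q) : F.half p q ≤ F.n + 1 := by
  refine Nat.succ_le_succ ?_
  rw [Nat.div_le_iff_le_mul_add_pred hq, mul_comm q]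
  exact (Nat.mul_le_mul_left _ hpq).trans (Nat.le_add_right _ _)

/-- The block of `β` has `n - 2h ≤ h` variables, which gives `K ≤ 2 ^ h`: the indices `p < 2 ^ h`
then suffice for all three kinds of partial assignments. -/
theorem le_three_half (F : CNF) {p q : ℕ} (hpq : q ≤ 3 * p) (hq : 0 < q) :
    F.n ≤ 3 * F.half p q := by
  have h1 : F.n * p < F.half p q * q := by
    rw [half, Nat.succ_mul, mul_comm _ q]
    have := Nat.div_add_mod (F.n * p) q
    have := Nat.mod_lt (F.n * p) hq
    omega
  have h2 : F.n * q ≤ 3 * (F.n * p) := by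
    calc F.n * q ≤ F.n * (3 * p) := Nat.mul_le_mul_left _ hpq
      _ = 3 * (F.n * p) := by ring
  have h3 : F.n * q < 3 * F.half p q * q := by
    rw [mul_assoc]
    omega
  exact (Nat.lt_of_mul_lt_mul_right h3).le

section

variable (F : CNF)

theorem pow_le_pow_bits : 2 ^ (F.n + 1) ≤ 2 ^ F.bits :=
  Nat.pow_le_pow_right (by norm_num) (by rw [bits]; omega)

theorem m_add_two_le : F.m + 2 ≤ 2 ^ F.bits := by
  have h1 := Nat.lt_pow_succ_log_self (b := 2) (by norm_num) (F.m + 1)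
  have h2 : 2 ^ (Nat.log 2 (F.m + 1)).succ ≤ 2 ^ F.bits :=
    Nat.pow_le_pow_right (by norm_num) (by rw [bits]; omega)
  omega

theorem nodes_le {h D : ℕ} (hh : h ≤ F.n + 1) : F.nodes h D ≤ (2 ^ F.bits) ^ (4 * D + 1) := by
  have hX := F.pow_le_pow_bits
  have hm := F.m_add_two_le
  have h2 : 2 ^ h ≤ 2 ^ F.bits := (Nat.pow_le_pow_right (by norm_num) hh).trans hX
  have hX2 : 2 ≤ 2 ^ F.bits := by omega
  have h8 : 8 * (F.m + 1) ≤ (2 ^ F.bits) ^ 4 := by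
    calc 8 * (F.m + 1) ≤ (2 ^ F.bits) ^ 3 * 2 ^ F.bits :=
          Nat.mul_le_mul (Nat.pow_le_pow_left hX2 3) (by omega)
      _ = (2 ^ F.bits) ^ 4 := by ring
  calc F.nodes h D ≤ 2 ^ F.bits * ((2 ^ F.bits) ^ 4) ^ D :=
        Nat.mul_le_mul h2 (Nat.pow_le_pow_left h8 D)
    _ = (2 ^ F.bits) ^ (4 * D + 1) := by rw [← pow_mul]; ring

end

end CNF

namespace WordRAM

section

variable {F : CNF} {p q D E C w : ℕ}

/-- All size conditions are reduced to this: a number bounded by a fixed power of `2 ^ F.bits` is a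
word once the constant in the word length exceeds the exponent. -/
theorem lt_two_pow_of_le {κ a x : ℕ} (hw : κ * F.bits ≤ w) (ha : a < κ)
    (hx : x ≤ (2 ^ F.bits) ^ a) : x < 2 ^ w := by
  refine hx.trans_lt ?_
  rw [← pow_mul]
  refine Nat.pow_lt_pow_right (by norm_num) (lt_of_lt_of_le ?_ hw)
  rw [mul_comm]
  exact Nat.mul_lt_mul_of_pos_right ha (by rw [CNF.bits]; omega)

/-- Constants are treated like the other quantities, as powers of `2 ^ F.bits`, which is at least 2.
-/
theorem const_le_pow (F : CNF) (c : ℕ) : c ≤ (2 ^ F.bits) ^ c :=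
  (Nat.lt_two_pow_self).le.trans (Nat.pow_le_pow_left (by
    have := F.m_add_two_le; omega) c)

theorem fits (hq : 0 < q) (hpq : p ≤ q) (hqp : q ≤ 3 * p) (hD : 1 ≤ D)
    (hw : (p + q + E + C + 24 * D + 10) * F.bits ≤ w) :
    Fits w F (F.half p q) (2 ^ (F.n - 2 * F.half p q)) (F.nodes (F.half p q) D)
      (F.fuel D E C) := by
  have hh := F.half_le hpq hq
  have hn3 := F.le_three_half hqp hq
  have hX := F.pow_le_pow_bits
  have hm := F.m_add_two_le
  have hlt := fun a x => lt_two_pow_of_le (F := F) (x := x) (a := a) hw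
  have hC := const_le_pow F C
  have hN := F.nodes_le (D := D) hh
  have hQ : 2 ^ F.half p q ≤ 2 ^ F.bits := (Nat.pow_le_pow_right (by norm_num) hh).trans hX
  have hlen := F.length_input_le
  have hn1 : F.n + 1 < 2 ^ F.bits := Nat.lt_two_pow_self.trans_le hX
  have hhX : F.half p q < 2 ^ F.bits := Nat.lt_two_pow_self.trans_le hQ
  have hnX : 2 ^ F.n ≤ 2 ^ F.bits := (Nat.pow_le_pow_right (by norm_num) (by omega)).trans hX
  have hKQ : 2 ^ (F.n - 2 * F.half p q) ≤ 2 ^ F.half p q :=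
    Nat.pow_le_pow_right (by norm_num) (by omega)
  have h3h : 2 ^ (3 * F.half p q) ≤ (2 ^ F.bits) ^ 3 := by
    rw [mul_comm, pow_mul]
    exact Nat.pow_le_pow_left hQ 3
  have hfu : F.fuel D E C ≤ (2 ^ F.bits) ^ (C + 3 * D + 1) := by
    calc F.fuel D E C ≤ (2 ^ F.bits) ^ C * 2 ^ F.bits * (2 ^ F.bits) ^ (3 * D) :=
          Nat.mul_le_mul (Nat.mul_le_mul hC ((Nat.pow_le_pow_right (by norm_num)
            (Nat.sub_le _ _)).trans hnX)) (Nat.pow_le_pow_left (by omega) _)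
      _ = (2 ^ F.bits) ^ (C + 3 * D + 1) := by ring
  have hfu0 : 1 ≤ (2 ^ F.bits) ^ (C + 3 * D + 1) := Nat.one_le_pow _ _ (by omega)
  -- What follows is polynomial arithmetic in `X ≥ 2`, where each additional factor `X` absorbs a
  -- factor 2.
  generalize 2 ^ F.bits = X at *
  have hX2 : 2 ≤ X := by omega
  have hX3 : X * X * X = X ^ 3 := by ring
  have hXX : 2 * X ≤ X * X := Nat.mul_le_mul_right X hX2
  have hXXX : 2 * (X * X) ≤ X * X * X := by
    calc 2 * (X * X) ≤ X * (X * X) := Nat.mul_le_mul_right _ hX2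
      _ = X * X * X := by ring
  have hX4 : 2 * (X * X * X) ≤ X ^ 4 := by
    calc 2 * (X * X * X) ≤ X * (X * X * X) := Nat.mul_le_mul_right _ hX2
      _ = X ^ 4 := by ring
  constructor
  · refine hlt 4 _ (by omega) ?_
    have h1 : F.m * (2 * F.n + 1) ≤ X * (X * X) := Nat.mul_le_mul (by omega) (by omega)
    have h2 : X * (X * X) = X * X * X := by ring
    omega
  · exact hlt 2 _ (by omega) (by rw [pow_two]; omega)
  · exact hlt 3 _ (by omega) h3h
  · exact hlt 1 _ (by omega) (by rwa [pow_one])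
  · exact hlt 2 _ (by omega) (by rw [pow_two]; omega)
  · rw [CNF.nodes, mul_comm]
    exact Nat.mul_le_mul_left _ (Nat.le_self_pow (by omega) _)
  · exact hlt _ _ (by omega) hN
  · exact hKQ
  · refine hlt 3 _ (by omega) ?_
    have h1 : 2 ^ (F.n - 2 * F.half p q) * (F.m + 1) ≤ X * X :=
      Nat.mul_le_mul (hKQ.trans hQ) (by omega)
    rw [← hX3]
    omega
  · refine hlt 8 _ (by omega) ?_
    have h1 : 7 + F.m ≤ X * X * X := by omega
    have h2 : 2 ^ F.half p q * (F.m * (7 + F.m)) ≤ X * (X * (X * X * X)) :=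
      Nat.mul_le_mul hQ (Nat.mul_le_mul (by omega) h1)
    have h3 : X * (X * (X * X * X)) = X ^ 5 := by ring
    have h5 : 2 ^ 5 ≤ X ^ 5 := Nat.pow_le_pow_left hX2 5
    have h6 : 2 ^ 3 * X ^ 5 ≤ X ^ 8 := by
      calc 2 ^ 3 * X ^ 5 ≤ X ^ 3 * X ^ 5 := Nat.mul_le_mul_right _ (Nat.pow_le_pow_left hX2 3)
        _ = X ^ 8 := by ring
    omega
  · refine hlt (C + 3 * D + 1 + 4) _ (by omega) ?_
    have h6 : 2 ^ 4 * X ^ (C + 3 * D + 1) ≤ X ^ (C + 3 * D + 1 + 4) := by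
      rw [pow_add X _ 4, mul_comm]
      exact Nat.mul_le_mul_left _ (Nat.pow_le_pow_left hX2 4)
    omega

theorem constants_lt (hq : 0 < q) (hpq : p ≤ q)
    (hw : (p + q + E + C + 24 * D + 10) * F.bits ≤ w) :
    F.n * p + p + q + E + C + 24 * D < 2 ^ w ∧
      F.half p q + 8 * D * (F.m + 1) + 1 < 2 ^ w := by
  have hh := F.half_le hpq hq
  have hX := F.pow_le_pow_bits
  have hm := F.m_add_two_le
  have hn1 : F.n + 1 < 2 ^ F.bits := Nat.lt_two_pow_self.trans_le hX
  have hlt := fun x => lt_two_pow_of_le (F := F) (x := x) (a := p + q + E + C + 24 * D + 2) hw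
    (by omega)
  have hS := const_le_pow F (p + q + E + C + 24 * D + 1)
  have hx : (p + q + E + C + 24 * D + 1) * 2 ^ F.bits ≤
      (2 ^ F.bits) ^ (p + q + E + C + 24 * D + 2) := by
    rw [pow_succ _ (p + q + E + C + 24 * D + 1)]
    exact Nat.mul_le_mul_right _ hS
  generalize 2 ^ F.bits = X at *
  refine ⟨hlt _ (le_trans ?_ hx), hlt _ (le_trans ?_ hx)⟩
  · have h1 : F.n * p + p ≤ X * p := by
      rw [← Nat.succ_mul]
      exact Nat.mul_le_mul_right _ (by omega)
    have h2 : q + E + C + 24 * D ≤ X * (q + E + C + 24 * D) := Nat.le_mul_of_pos_left _ (by omega)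
    have h3 : (p + q + E + C + 24 * D + 1) * X = X * p + X * (q + E + C + 24 * D) + X := by ring
    omega
  · have h1 : 8 * D * (F.m + 1) ≤ 8 * D * X := Nat.mul_le_mul_left _ (by omega)
    have h3 : (p + q + E + C + 24 * D + 1) * X =
        8 * D * X + X + (p + q + E + C + 16 * D) * X := by ring
    have h4 : 1 ≤ (p + q + E + C + 16 * D) * X := Nat.mul_pos (by omega) (by omega)
    omega

end

/-! ## The right threshold -/

theorem capOf_le {N : ℕ} {E : List (ℕ × ℕ × ℕ)} (hE : IsEdgeList N E) {c : ℕ}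
    (hc : ∀ e ∈ E, e.2.2 ≤ c) (u v : ℕ) : capOf E u v ≤ c := by
  by_cases h : (u, v) ∈ E.map fun e => (e.1, e.2.1)
  · obtain ⟨e, he, h⟩ := List.mem_map.1 h
    rw [Prod.mk.injEq] at h
    rw [← h.1, ← h.2, capOf_of_mem hE.nodup he]
    exact hc e he
  · rw [capOf_eq_zero h]
    exact Nat.zero_le _

/-- The number of edges and the capacities are at most `2 ^ h` times a quadratic polynomial in the
number of clauses, so padding with `D ≥ 2` makes `A = 1` possible. The threshold is within a factor
2 of `N ^ c`, hence `B = 2` without logarithms. -/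
theorem inClass_ofEdges {F : CNF} {h K N D k : ℕ} {c : ℝ} (hN : N = F.nodes h D) (hD : 2 ≤ D)
    (hKQ : K ≤ 2 ^ h) (hE : IsEdgeList N (F.edges h K)) (hk : (k : ℝ) ≤ (N : ℝ) ^ c)
    (hk' : (N : ℝ) ^ c ≤ 2 * k) :
    (KPMFInstance.ofEdges hE k).InClass c 1 2 0 := by
  have h2 : (8 * (F.m + 1)) ^ 2 ≤ (8 * (F.m + 1)) ^ D := Nat.pow_le_pow_right (by omega) hD
  have hQ : 1 ≤ 2 ^ h := Nat.one_le_two_pow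
  have hN2 : 2 ^ h * (8 * (F.m + 1)) ^ 2 ≤ N := hN ▸ Nat.mul_le_mul_left _ h2
  have h64 : (8 * (F.m + 1)) ^ 2 = 64 * (F.m * F.m) + 128 * F.m + 64 := by ring
  have h1 : 1 * (8 * (F.m + 1)) ^ 2 ≤ 2 ^ h * (8 * (F.m + 1)) ^ 2 := Nat.mul_le_mul_right _ hQ
  refine ⟨?_, ?_, fun u v => ?_, ?_, ?_⟩
  · change 2 ≤ N
    omega
  · have hm : (KPMFInstance.ofEdges hE k).m = (F.edges h K).length := by
      simp [KPMFInstance.m, KPMFInstance.ofEdges]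
    change (KPMFInstance.ofEdges hE k).m ≤ 1 * N
    rw [hm, one_mul]
    refine le_trans length_edgeList_le (le_trans (Nat.mul_le_mul_left _ ?_) hN2)
    have : F.m * (7 + F.m) = F.m * F.m + 7 * F.m := by ring
    omega
  · refine (capOf_le hE (fun e he => cap_le_of_mem_edgeList he) _ _).trans (le_trans ?_ hN2)
    calc K * (F.m + 1) + F.m ≤ 2 ^ h * (F.m + 1) + 2 ^ h * F.m :=
          Nat.add_le_add (Nat.mul_le_mul_right _ hKQ) (Nat.le_mul_of_pos_left _ hQ)
      _ = 2 ^ h * (F.m + 1 + F.m) := by ring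
      _ ≤ 2 ^ h * (8 * (F.m + 1)) ^ 2 := Nat.mul_le_mul_left _ (by omega)
  · change (N : ℝ) ^ c ≤ (2 : ℕ) * Real.log N ^ 0 * k
    rw [pow_zero, mul_one]
    exact_mod_cast hk'
  · change (k : ℝ) ≤ (2 : ℕ) * (N : ℝ) ^ c * Real.log N ^ 0
    rw [pow_zero, mul_one]
    have : 0 ≤ (N : ℝ) ^ c := by positivity
    push_cast
    linarith

end WordRAM

/-! ### Real estimates for the number of nodes, the threshold and the fuel. -/

namespace CNF

section

variable {F : CNF} {p q D E : ℕ} {c : ℝ}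

theorem lt_half_mul (F : CNF) (hq : 0 < q) : F.n * p < F.half p q * q := by
  rw [half, Nat.succ_mul, mul_comm _ q]
  have := Nat.div_add_mod (F.n * p) q
  have := Nat.mod_lt (F.n * p) hq
  omega

theorem half_mul_le (F : CNF) : F.half p q * q ≤ F.n * p + q := by
  rw [half, Nat.succ_mul]
  exact Nat.add_le_add_right (Nat.div_mul_le_self _ _) _

theorem nodes_rpow (F : CNF) (h : ℕ) (e : ℝ) : (F.nodes h D : ℝ) ^ e =
    2 ^ (h * e : ℝ) * (8 * ((F.m : ℝ) + 1)) ^ (D * e : ℝ) := by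
  have h1 : (0 : ℝ) ≤ 8 * ((F.m : ℝ) + 1) := by positivity
  rw [nodes]
  push_cast
  rw [Real.mul_rpow (by positivity) (by positivity), ← Real.rpow_natCast, ← Real.rpow_mul (by norm_num),
    ← Real.rpow_natCast, ← Real.rpow_mul h1]

/-- Since `h` is at least `n * p / q` and `p / q` is at least `1 / (2 + c)`, one has `n - 2h ≤ hc`,
which takes care of the power of two. The padding exponent satisfies `D * c ≥ 1`, which takes care
of the polynomial factor. -/
theorem mul_le_nodes_rpow (hc : 0 < c) (hq : 0 < q) (hpq : 1 ≤ (p / q : ℝ) * (2 + c))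
    (hD : 1 ≤ D * c) : (2 : ℝ) ^ (F.n - 2 * F.half p q) * (8 * ((F.m : ℝ) + 1)) ≤
      (F.nodes (F.half p q) D : ℝ) ^ c := by
  have hq' : (0 : ℝ) < q := by exact_mod_cast hq
  have h1 : (1 : ℝ) ≤ 8 * ((F.m : ℝ) + 1) := by
    have : (0 : ℝ) ≤ F.m := by positivity
    linarith
  rw [nodes_rpow]
  refine mul_le_mul ?_ ?_ (by positivity) (by positivity)
  · rw [← Real.rpow_natCast]
    refine Real.rpow_le_rpow_of_exponent_le (by norm_num) ?_
    rcases le_total F.n (2 * F.half p q) with h | h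
    · rw [Nat.sub_eq_zero_of_le h]
      push_cast
      positivity
    · rw [Nat.cast_sub h]
      push_cast
      have h2 : (F.n : ℝ) * (p / q) ≤ F.half p q := by
        rw [← mul_div_assoc, div_le_iff₀ hq']
        exact_mod_cast (F.lt_half_mul hq).le
      have h3 : (F.n : ℝ) ≤ F.n * ((p / q) * (2 + c)) := le_mul_of_one_le_right (by positivity) hpq
      have h4 : (F.n : ℝ) * (p / q) * (2 + c) ≤ F.half p q * (2 + c) :=
        mul_le_mul_of_nonneg_right h2 (by linarith)
      nlinarith
  · calc 8 * ((F.m : ℝ) + 1) = (8 * ((F.m : ℝ) + 1)) ^ (1 : ℝ) := (Real.rpow_one _).symm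
      _ ≤ _ := Real.rpow_le_rpow_of_exponent_le h1 hD

/-- The exponent of 2 is at most `n (1 + η/2)(1 - η) + 3 ≤ n (1 - η/2) + 3`: the rounding of `p / q`
gives back only half of the saving `η`, and the other half is at least `1 / E`. -/
theorem time_le_fuel {ε η k : ℝ} (hc : 0 < c) (hc1 : c ≤ 1) (hη : 0 < η) (hη1 : η ≤ 1 / 2)
    (hηε : η ≤ ε) (hq : 0 < q) (hpq : (p / q : ℝ) * (2 + c) ≤ 1 + η / 2) (hE : (1 / E : ℝ) ≤ η / 2)
    (hk : 1 ≤ k) (hkN : k ≤ (F.nodes (F.half p q) D : ℝ) ^ c) :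
    ((F.nodes (F.half p q) D : ℝ) ^ 2 * k) ^ (1 - ε) ≤
      8 * 8 ^ (3 * D) * (2 ^ (F.n - F.n / E) * ((F.m : ℝ) + 1) ^ (3 * D)) := by
  have hq' : (0 : ℝ) < q := by exact_mod_cast hq
  have h1 : (1 : ℝ) ≤ 8 * ((F.m : ℝ) + 1) := by
    have : (0 : ℝ) ≤ F.m := by positivity
    linarith
  have hN1 : (1 : ℝ) ≤ F.nodes (F.half p q) D := by
    have : 1 ≤ F.nodes (F.half p q) D := Nat.mul_pos (by positivity) (by positivity)
    exact_mod_cast this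
  have hNk : 1 ≤ (F.nodes (F.half p q) D : ℝ) ^ 2 * k :=
    one_le_mul_of_one_le_of_one_le (one_le_pow₀ hN1) hk
  have he0 : 0 ≤ (2 + c) * (1 - η) := mul_nonneg (by linarith) (by linarith)
  have he3 : (2 + c) * (1 - η) ≤ 3 := by nlinarith
  -- Passing from `ε` to the smaller `η ≤ 1 / 2` only increases the bound, as the base is at least
  -- 1, and it keeps the exponent nonnegative for `ε > 1`.
  have h2 : ((F.nodes (F.half p q) D : ℝ) ^ 2 * k) ^ (1 - ε) ≤
      (F.nodes (F.half p q) D : ℝ) ^ ((2 + c) * (1 - η)) := by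
    calc ((F.nodes (F.half p q) D : ℝ) ^ 2 * k) ^ (1 - ε)
        ≤ ((F.nodes (F.half p q) D : ℝ) ^ 2 * k) ^ (1 - η) :=
          Real.rpow_le_rpow_of_exponent_le hNk (by linarith)
      _ ≤ ((F.nodes (F.half p q) D : ℝ) ^ (2 + c)) ^ (1 - η) := by
          refine Real.rpow_le_rpow (by linarith) ?_ (by linarith)
          rw [Real.rpow_add (by linarith)]
          have := mul_le_mul_of_nonneg_left hkN (by positivity :
            0 ≤ (F.nodes (F.half p q) D : ℝ) ^ 2)
          exact_mod_cast this
      _ = _ := (Real.rpow_mul (by linarith) _ _).symm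
  refine h2.trans ?_
  rw [nodes_rpow]
  -- The factor 8 is the price of rounding `h` up by at most 1, since its coefficient in the
  -- exponent is at most 3.
  have h3 : (2 : ℝ) ^ ((F.half p q : ℝ) * ((2 + c) * (1 - η))) ≤ 8 * 2 ^ (F.n - F.n / E) := by
    have h4 : (F.half p q : ℝ) ≤ F.n * (p / q) + 1 := by
      have : (F.half p q : ℝ) * q ≤ F.n * p + q := by exact_mod_cast F.half_mul_le
      rw [← mul_le_mul_iff_left₀ hq']
      refine this.trans (le_of_eq ?_)
      field_simp
    have h5 : ((F.n - F.n / E : ℕ) : ℝ) ≥ F.n * (1 - η / 2) := by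
      rw [Nat.cast_sub (Nat.div_le_self _ _)]
      have h6 : ((F.n / E : ℕ) : ℝ) ≤ F.n / E := Nat.cast_div_le
      have h7 : (F.n : ℝ) * (1 / E) ≤ F.n * (η / 2) := mul_le_mul_of_nonneg_left hE (by positivity)
      rw [mul_one_div] at h7
      linarith
    have h8 : (F.half p q : ℝ) * ((2 + c) * (1 - η)) ≤ 3 + (F.n - F.n / E : ℕ) := by
      have hn : (0 : ℝ) ≤ F.n := by positivity
      calc (F.half p q : ℝ) * ((2 + c) * (1 - η)) ≤ (F.n * (p / q) + 1) * ((2 + c) * (1 - η)) :=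
            mul_le_mul_of_nonneg_right h4 he0
        _ = F.n * ((p / q * (2 + c)) * (1 - η)) + (2 + c) * (1 - η) := by ring
        _ ≤ F.n * ((1 + η / 2) * (1 - η)) + 3 := by
            refine add_le_add (mul_le_mul_of_nonneg_left ?_ hn) he3
            exact mul_le_mul_of_nonneg_right hpq (by linarith)
        _ ≤ F.n * (1 - η / 2) + 3 := by
            refine add_le_add (mul_le_mul_of_nonneg_left ?_ hn) le_rfl
            nlinarith
        _ ≤ _ := by linarith
    refine (Real.rpow_le_rpow_of_exponent_le (by norm_num) h8).trans (le_of_eq ?_)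
    rw [Real.rpow_add (by norm_num), Real.rpow_natCast]
    norm_num
  have h9 : (8 * ((F.m : ℝ) + 1)) ^ ((D : ℝ) * ((2 + c) * (1 - η))) ≤
      8 ^ (3 * D) * ((F.m : ℝ) + 1) ^ (3 * D) := by
    rw [← mul_pow, ← Real.rpow_natCast (8 * ((F.m : ℝ) + 1))]
    refine Real.rpow_le_rpow_of_exponent_le h1 ?_
    push_cast
    have : (0 : ℝ) ≤ D := by positivity
    nlinarith
  calc _ ≤ (8 * 2 ^ (F.n - F.n / E)) * (8 ^ (3 * D) * ((F.m : ℝ) + 1) ^ (3 * D)) :=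
        mul_le_mul h3 h9 (by positivity) (by positivity)
    _ = _ := by ring

end

end CNF

namespace WordRAM

/-- The successful threshold is the largest power of two that is at most `N ^ c`. It is below `N` by
`c ≤ 1`, hence among those that are tried, and it is large enough by the slack of 8 in
`CNF.mul_le_nodes_rpow`. -/
theorem exists_succeeds {F : CNF} {P : Prog} {κ p q D E C w : ℕ} {c ε η B : ℝ}
    (hP : ∀ x : KPMFInstance, x.InClass c 1 2 0 → ∀ w : ℕ, κ * x.bits ≤ w →
      ∃ (t : ℕ) (s : State), Exec w P (initial w x.input) t s ∧ x.Correct (s.mem 1) ∧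
        (t : ℝ) ≤ B * ((x.n : ℝ) ^ 2 * x.k) ^ (1 - ε))
    (hc : 0 < c) (hc1 : c ≤ 1) (hη : 0 < η) (hη1 : η ≤ 1 / 2) (hηε : η ≤ ε) (hq : 0 < q)
    (hpq : p ≤ q) (hpq1 : 1 ≤ (p / q : ℝ) * (2 + c)) (hpq2 : (p / q : ℝ) * (2 + c) ≤ 1 + η / 2)
    (hE : (1 / E : ℝ) ≤ η / 2) (hD : 2 ≤ D) (hDc : 1 ≤ D * c) (hC : |B| * (8 * 8 ^ (3 * D)) ≤ C)
    (hw : κ * (4 * D + 2) * F.bits ≤ w)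
    (hfits : Fits w F (F.half p q) (2 ^ (F.n - 2 * F.half p q)) (F.nodes (F.half p q) D)
      (F.fuel D E C)) :
    ∃ i < F.half p q + 8 * D * (F.m + 1) + 1, Succeeds w F (F.half p q)
      (2 ^ (F.n - 2 * F.half p q)) (F.nodes (F.half p q) D) (F.fuel D E C) P (2 ^ i % 2 ^ w) := by
  obtain ⟨h, hh⟩ : ∃ h, h = F.half p q := ⟨_, rfl⟩
  obtain ⟨K, hK⟩ : ∃ K, K = 2 ^ (F.n - 2 * F.half p q) := ⟨_, rfl⟩
  obtain ⟨N, hN⟩ : ∃ N, N = F.nodes (F.half p q) D := ⟨_, rfl⟩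
  have hlow := CNF.mul_le_nodes_rpow (F := F) hc hq hpq1 hDc
  have htime := fun k => CNF.time_le_fuel (F := F) (D := D) (k := k) hc hc1 hη hη1 hηε hq hpq2 hE
  have hhn := F.half_le hpq hq
  have hNX := F.nodes_le (D := D) hhn
  rw [← hN] at hlow htime hNX hfits ⊢
  rw [← hK] at hfits ⊢
  rw [← hh] at hfits ⊢
  have hN1 : 1 ≤ N := by
    rw [hN]
    exact Nat.mul_pos (by positivity) (by positivity)
  have hN1' : (1 : ℝ) ≤ N := by exact_mod_cast hN1
  have hNc1 : (1 : ℝ) ≤ (N : ℝ) ^ c := Real.one_le_rpow hN1' hc.le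
  have hNcN : (N : ℝ) ^ c ≤ N := by
    calc (N : ℝ) ^ c ≤ (N : ℝ) ^ (1 : ℝ) := Real.rpow_le_rpow_of_exponent_le hN1' hc1
      _ = N := Real.rpow_one _
  obtain ⟨i, hi1, hi2⟩ : ∃ i : ℕ, (2 : ℝ) ^ i ≤ (N : ℝ) ^ c ∧ (N : ℝ) ^ c < 2 ^ (i + 1) :=
    exists_nat_pow_near hNc1 (by norm_num)
  have hiN : 2 ^ i ≤ N := by
    have := hi1.trans hNcN
    exact_mod_cast this
  have hiw : 2 ^ i % 2 ^ w = 2 ^ i := Nat.mod_eq_of_lt (hiN.trans_lt hfits.N)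
  have hE' : IsEdgeList N (F.edges h K) := CNF.isEdgeList_edges F hfits.nodes
  refine ⟨i, ?_, ?_⟩
  · have h1 : N ≤ 2 ^ (h + 8 * D * (F.m + 1)) := by
      rw [hN, CNF.nodes, pow_add, hh]
      refine Nat.mul_le_mul_left _ ?_
      rw [show 8 * D * (F.m + 1) = 8 * (F.m + 1) * D by ring, pow_mul]
      exact Nat.pow_le_pow_left Nat.lt_two_pow_self.le _
    exact Nat.lt_succ_of_le ((Nat.pow_le_pow_iff_right (by norm_num)).1 (hiN.trans h1))
  · rw [hiw]
    have hclass : (KPMFInstance.ofEdges hE' (2 ^ i)).InClass c 1 2 0 := by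
      refine inClass_ofEdges (hh ▸ hN) hD hfits.le_Q hE' ?_ ?_
      · push_cast
        exact hi1
      · push_cast
        rw [pow_succ] at hi2
        linarith
    refine ⟨?_, hE', ?_⟩
    -- This gives `4 * (K * F.m) < 2 ^ i`, more than what is needed.
    · have h1 : (K : ℝ) * (8 * ((F.m : ℝ) + 1)) < 2 ^ (i + 1) := by
        refine lt_of_le_of_lt (le_trans (le_of_eq ?_) hlow) hi2
        rw [hK]
        push_cast
        rfl
      have h2 : K * (8 * (F.m + 1)) < 2 ^ (i + 1) := by exact_mod_cast h1
      have h3 : K * (8 * (F.m + 1)) = 8 * (K * F.m) + 8 * K := by ring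
      rw [pow_succ] at h2
      omega
    · have hbits : κ * (KPMFInstance.ofEdges hE' (2 ^ i)).bits ≤ w := by
        refine le_trans ?_ hw
        rw [mul_assoc]
        refine Nat.mul_le_mul_left _ ?_
        change Nat.log 2 N + 1 ≤ _
        have h1 : Nat.log 2 N ≤ F.bits * (4 * D + 1) := by
          rw [← pow_mul] at hNX
          have := Nat.log_mono_right (b := 2) hNX
          rwa [Nat.log_pow (by norm_num)] at this
        have h2 : 1 ≤ F.bits := by rw [CNF.bits]; omega
        have h3 : (4 * D + 2) * F.bits = F.bits * (4 * D + 1) + F.bits := by ring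
        omega
      obtain ⟨t, s, hex, hcor, ht⟩ := hP _ hclass w hbits
      refine ⟨t, s, hex, hcor, ?_⟩
      have h1 : (1 : ℝ) ≤ ((2 ^ i : ℕ) : ℝ) := by exact_mod_cast Nat.one_le_two_pow
      have h2 := htime ((2 ^ i : ℕ) : ℝ) h1 (by push_cast; exact hi1)
      have h3 : (t : ℝ) ≤ (F.fuel D E C : ℕ) := by
        refine ht.trans ?_
        change B * ((N : ℝ) ^ 2 * ((2 ^ i : ℕ) : ℝ)) ^ (1 - ε) ≤ _
        have h4 : (0 : ℝ) ≤ ((N : ℝ) ^ 2 * ((2 ^ i : ℕ) : ℝ)) ^ (1 - ε) := by positivity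
        have h5 : (0 : ℝ) ≤ 2 ^ (F.n - F.n / E) * ((F.m : ℝ) + 1) ^ (3 * D) := by positivity
        calc B * ((N : ℝ) ^ 2 * ((2 ^ i : ℕ) : ℝ)) ^ (1 - ε)
            ≤ |B| * ((N : ℝ) ^ 2 * ((2 ^ i : ℕ) : ℝ)) ^ (1 - ε) :=
              mul_le_mul_of_nonneg_right (le_abs_self B) h4
          _ ≤ |B| * (8 * 8 ^ (3 * D) * (2 ^ (F.n - F.n / E) * ((F.m : ℝ) + 1) ^ (3 * D))) :=
              mul_le_mul_of_nonneg_left h2 (abs_nonneg B)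
          _ = |B| * (8 * 8 ^ (3 * D)) * (2 ^ (F.n - F.n / E) * ((F.m : ℝ) + 1) ^ (3 * D)) := by ring
          _ ≤ C * (2 ^ (F.n - F.n / E) * ((F.m : ℝ) + 1) ^ (3 * D)) :=
              mul_le_mul_of_nonneg_right hC h5
          _ = (F.fuel D E C : ℕ) := by
              rw [CNF.fuel]
              push_cast
              ring
      exact_mod_cast h3

end WordRAM

/-! ### The total running time. -/

namespace CNF

/-- The growth of the running time. -/
noncomputable def expo (F : CNF) (E : ℕ) : ℝ := (2 : ℝ) ^ ((1 - 1 / E : ℝ) * F.n)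

section

variable {F : CNF} {p q D E C R c : ℕ}

theorem one_le_expo (F : CNF) (hE : 1 ≤ E) : 1 ≤ F.expo E := by
  refine Real.one_le_rpow (by norm_num) (mul_nonneg ?_ (by positivity))
  have h1 : (1 : ℝ) ≤ E := by exact_mod_cast hE
  rw [sub_nonneg, div_le_one (by linarith)]
  exact h1

theorem two_pow_sub_div_le (F : CNF) (E : ℕ) : (2 : ℝ) ^ (F.n - F.n / E) ≤ 2 * F.expo E := by
  have h1 : ((F.n - F.n / E : ℕ) : ℝ) ≤ 1 + (1 - 1 / E : ℝ) * F.n := by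
    rw [Nat.cast_sub (Nat.div_le_self _ _)]
    have h2 : (F.n : ℝ) / E < (F.n / E : ℕ) + 1 := by
      rw [← Nat.floor_div_eq_div (K := ℝ)]
      exact Nat.lt_floor_add_one _
    have h3 : (1 - 1 / E : ℝ) * F.n = F.n - F.n / E := by ring
    linarith
  calc (2 : ℝ) ^ (F.n - F.n / E) = (2 : ℝ) ^ ((F.n - F.n / E : ℕ) : ℝ) :=
        (Real.rpow_natCast _ _).symm
    _ ≤ (2 : ℝ) ^ (1 + (1 - 1 / E : ℝ) * F.n) :=
        Real.rpow_le_rpow_of_exponent_le (by norm_num) h1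
    _ = 2 * F.expo E := by rw [Real.rpow_add (by norm_num), Real.rpow_one, expo]

theorem two_pow_half_le (F : CNF) (hq : 0 < q) (hpq : (p / q : ℝ) ≤ 1 - 1 / E) :
    (2 : ℝ) ^ F.half p q ≤ 2 * F.expo E := by
  have hq' : (0 : ℝ) < q := by exact_mod_cast hq
  have h1 : (F.half p q : ℝ) ≤ 1 + (1 - 1 / E : ℝ) * F.n := by
    have h2 : (F.half p q : ℝ) * q ≤ F.n * p + q := by exact_mod_cast F.half_mul_le
    have h3 : (F.half p q : ℝ) ≤ 1 + (p / q) * F.n := by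
      rw [← mul_le_mul_iff_left₀ hq']
      refine h2.trans (le_of_eq ?_)
      field_simp
      ring
    have h4 := mul_le_mul_of_nonneg_right hpq (by positivity : (0 : ℝ) ≤ F.n)
    linarith
  calc (2 : ℝ) ^ F.half p q = (2 : ℝ) ^ (F.half p q : ℝ) := (Real.rpow_natCast _ _).symm
    _ ≤ (2 : ℝ) ^ (1 + (1 - 1 / E : ℝ) * F.n) :=
        Real.rpow_le_rpow_of_exponent_le (by norm_num) h1
    _ = 2 * F.expo E := by rw [Real.rpow_add (by norm_num), Real.rpow_one, expo]

/-- The number of steps of the whole program. -/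
theorem steps_le (F : CNF) (hq : 0 < q) (hpq : p ≤ q) (hpq' : (p / q : ℝ) ≤ 1 - 1 / E)
    (hE : 1 ≤ E) {K : ℕ} (hK : K ≤ 2 ^ F.half p q) :
    ((200 * D + 150 + ((F.half p q + 8 * D * (F.m + 1) + 1) * (2 ^ F.half p q *
      (4000 * F.size ^ 3) + c * (1 + F.fuel D E C) + F.fuel D E C * 200 +
      K * (200 * F.size ^ 2) + (R + 230)) + 5) : ℕ) : ℝ) ≤
    ((200 * D + 155 + (8 * D + 2) * (8630 + c * (1 + 2 * C) + 400 * C + R) : ℕ) : ℝ) *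
      F.expo E * ((F.m : ℝ) + F.n + 1) ^ (3 * D + 4) := by
  have hZ := F.one_le_expo hE
  have hf : (F.fuel D E C : ℝ) ≤ C * (2 * F.expo E) * ((F.m : ℝ) + 1) ^ (3 * D) := by
    rw [fuel]
    push_cast
    gcongr
    exact F.two_pow_sub_div_le E
  have hh := F.two_pow_half_le hq hpq'
  have hK' : (K : ℝ) ≤ 2 ^ F.half p q := by exact_mod_cast hK
  have hL : ((F.half p q : ℝ) + 8 * D * (F.m + 1) + 1) ≤ (8 * D + 2) * ((F.m : ℝ) + F.n + 1) := by
    have h1 : F.half p q + 8 * D * (F.m + 1) + 1 ≤ (8 * D + 2) * (F.m + F.n + 1) := by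
      have := F.half_le hpq hq
      have h2 : (8 * D + 2) * (F.m + F.n + 1) = 8 * D * (F.m + 1) + 8 * D * F.n +
        2 * (F.m + F.n + 1) := by ring
      omega
    exact_mod_cast h1
  have hm : (0 : ℝ) ≤ F.m := by positivity
  have hn : (0 : ℝ) ≤ F.n := by positivity
  have hSdef : ((F.size : ℕ) : ℝ) = (F.m : ℝ) + F.n + 1 := by simp [size]
  have hmS : (F.m : ℝ) + 1 ≤ (F.m : ℝ) + F.n + 1 := by linarith
  push_cast
  rw [hSdef]
  generalize hSe : (F.m : ℝ) + F.n + 1 = S at *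
  have hS : 1 ≤ S := by linarith
  generalize F.expo E = Z at *
  have p1 : S ^ 3 ≤ S ^ (3 * D + 3) := pow_le_pow_right₀ hS (by omega)
  have p2 : S ^ 2 ≤ S ^ (3 * D + 3) := pow_le_pow_right₀ hS (by omega)
  have p3 : ((F.m : ℝ) + 1) ^ (3 * D) ≤ S ^ (3 * D + 3) :=
    (pow_le_pow_left₀ (by linarith) hmS _).trans (pow_le_pow_right₀ hS (by omega))
  have p4 : 1 ≤ S ^ (3 * D + 3) := one_le_pow₀ hS
  have p5 : S ^ (3 * D + 4) = S * S ^ (3 * D + 3) := by ring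
  rw [p5]
  generalize S ^ (3 * D + 3) = Y at *
  have q1 : 1 ≤ Z * Y := one_le_mul_of_one_le_of_one_le hZ p4
  have q2 : (2 : ℝ) ^ F.half p q * (4000 * S ^ 3) ≤ 8000 * (Z * Y) := by
    calc (2 : ℝ) ^ F.half p q * (4000 * S ^ 3) ≤ (2 * Z) * (4000 * Y) := by gcongr
      _ = _ := by ring
  have q3 : (K : ℝ) * (200 * S ^ 2) ≤ 400 * (Z * Y) := by
    calc (K : ℝ) * (200 * S ^ 2) ≤ (2 * Z) * (200 * Y) := by
          gcongr
          exact hK'.trans hh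
      _ = _ := by ring
  have q4 : (F.fuel D E C : ℝ) ≤ 2 * C * (Z * Y) := by
    refine hf.trans ?_
    calc (C : ℝ) * (2 * Z) * ((F.m : ℝ) + 1) ^ (3 * D) ≤ C * (2 * Z) * Y := by gcongr
      _ = _ := by ring
  have hf0 : (0 : ℝ) ≤ F.fuel D E C := by positivity
  generalize (F.fuel D E C : ℝ) = f at *
  have q5 : ∀ b : ℝ, b * Z * (S * Y) = b * (S * (Z * Y)) := fun b => by ring
  rw [q5]
  generalize Z * Y = V at *
  -- The work for one threshold is at most a constant times `V`. The number of thresholds is linear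
  -- in `S` and supplies the remaining factor.
  have hin : (2 : ℝ) ^ F.half p q * (4000 * S ^ 3) + c * (1 + f) + f * 200 +
      K * (200 * S ^ 2) + (R + 230) ≤ (8630 + c * (1 + 2 * C) + 400 * C + R) * V := by
    have r1 : (c : ℝ) * (1 + f) ≤ c * (V + 2 * C * V) := by gcongr
    have r2 : (R : ℝ) ≤ R * V := le_mul_of_one_le_right (by positivity) q1
    nlinarith
  have hV : 1 ≤ S * V := one_le_mul_of_one_le_of_one_le hS q1
  have hLin := mul_le_mul hL hin (by positivity) (by positivity)
  have hD : (0 : ℝ) ≤ D := by positivity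
  nlinarith

end

end CNF

/-- A polynomial factor is absorbed. -/
theorem exists_pow_le_rpow (a : ℕ) {r : ℝ} (hr : 0 < r) :
    ∃ C : ℝ, 0 ≤ C ∧ ∀ n : ℕ, ((n : ℝ) + 1) ^ a ≤ C * 2 ^ (r * n) := by
  have h2 : (1 : ℝ) < 2 ^ r := Real.one_lt_rpow (by norm_num) hr
  obtain ⟨C, hC⟩ := (tendsto_pow_const_div_const_pow_of_one_lt a h2).bddAbove_range
  -- The boundedness of `n ^ a / (2 ^ r) ^ n` is used at `n + 1`, which costs the factor `2 ^ r`.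
  refine ⟨C * 2 ^ r, ?_, fun n => ?_⟩
  · have h0 := hC ⟨0, rfl⟩
    have : (0 : ℝ) ≤ ((0 : ℕ) : ℝ) ^ a / (2 ^ r) ^ 0 := by positivity
    exact mul_nonneg (this.trans h0) (by positivity)
  · have h0 := hC ⟨n + 1, rfl⟩
    have hp : (0 : ℝ) < ((2 : ℝ) ^ r) ^ (n + 1) := by positivity
    rw [div_le_iff₀ hp] at h0
    have h1 : ((2 : ℝ) ^ r) ^ (n + 1) = 2 ^ r * 2 ^ (r * n) := by
      rw [pow_succ, mul_comm, ← Real.rpow_mul_natCast (by norm_num)]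
    rw [h1] at h0
    push_cast at h0
    linarith

/-! ### Assembly of the algorithms for MAX-CNF-SAT and kSAT. -/

namespace WordRAM

/-- A fast algorithm for kPMF yields a fast algorithm that puts the maximum number of satisfied
clauses into register `10` and the number of clauses into register `2`. -/
theorem exists_maxSat {ε c : ℝ} {E : ℕ} (hε : 0 < ε) (hc : 0 < c) (hc1 : c ≤ 1) (hE1 : 1 ≤ E)
    (hE : (1 / E : ℝ) ≤ min ε (1 / 2) / 2) (hs : KPMFSolvable ε c) :
    ∃ (P : Prog) (κ : ℕ) (C : ℝ) (a : ℕ), 0 ≤ C ∧ 1 ≤ κ ∧ ∀ (F : CNF) (w : ℕ), κ * F.bits ≤ w →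
      ∃ (t : ℕ) (s : State), Exec w P (initial w F.input) t s ∧ s.reg 2 = F.m ∧
        IsGreatest (Set.range F.numSat) (s.reg 10) ∧
        (t : ℝ) ≤ C * F.expo E * ((F.m : ℝ) + F.n + 1) ^ a := by
  obtain ⟨P, κ, B, hP⟩ := hs 1 2 0
  obtain ⟨R, hR⟩ := P.exists_regsBelow
  have hη : 0 < min ε (1 / 2) := lt_min hε (by norm_num)
  have hη1 : min ε (1 / 2) ≤ 1 / 2 := min_le_right _ _
  have hηε : min ε (1 / 2) ≤ ε := min_le_left _ _
  generalize min ε (1 / 2) = η at *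
  have hc2 : 0 < 2 + c := by linarith
  -- The machine computes `h` from a rational number slightly above `1 / (2 + c)`, as `c` itself may
  -- be irrational. Its numerator and denominator are constants of the program.
  obtain ⟨r, hr1, hr2⟩ := exists_rat_btwn
    (div_lt_div_of_pos_right (by linarith : (1 : ℝ) < 1 + η / 2) hc2)
  have hr0 : 0 < r := by
    have : (0 : ℝ) < r := (by positivity : 0 < 1 / (2 + c)).trans hr1
    exact_mod_cast this
  obtain ⟨p, q, hq, hpq⟩ : ∃ p q : ℕ, 0 < q ∧ (p / q : ℝ) = r := by
    refine ⟨r.num.toNat, r.den, r.den_pos, ?_⟩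
    have h1 : ((r.num.toNat : ℤ) : ℝ) = (r.num : ℝ) := by
      rw [Int.toNat_of_nonneg (Rat.num_nonneg.2 hr0.le)]
    rw [Int.cast_natCast] at h1
    rw [h1, Rat.cast_def]
  rw [← hpq] at hr1 hr2
  rw [div_lt_iff₀ hc2] at hr1
  rw [lt_div_iff₀ hc2] at hr2
  have hq' : (0 : ℝ) < q := by exact_mod_cast hq
  have hx : (0 : ℝ) ≤ p / q := by positivity
  -- By `η ≤ 1 / 2` the ratio is at most 5/8 and `1 / E` at most 1/4. This bounds the size of the
  -- network by the intended running time.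
  have hx1 : (p / q : ℝ) ≤ 1 - 1 / E := by nlinarith
  have hx2 : (1 / 3 : ℝ) ≤ p / q := by nlinarith
  have hpq₁ : p ≤ q := by
    have h1 : (p / q : ℝ) ≤ 1 := by
      have : (0 : ℝ) ≤ 1 / E := by positivity
      linarith
    rw [div_le_one hq'] at h1
    exact_mod_cast h1
  have hpq₂ : q ≤ 3 * p := by
    rw [le_div_iff₀ hq'] at hx2
    have : (q : ℝ) ≤ 3 * p := by linarith
    exact_mod_cast this
  -- The only place where `c > 0` is essential. The choice of `D` affects the degree of the
  -- polynomial factor but not the exponential saving.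
  obtain ⟨D, hD⟩ : ∃ D : ℕ, max 2 (1 / c) ≤ D := exists_nat_ge _
  have hD2 : 2 ≤ D := by
    have := (le_max_left _ _).trans hD
    exact_mod_cast this
  have hDc : 1 ≤ D * c := by
    have := (le_max_right _ _).trans hD
    rwa [div_le_iff₀ hc] at this
  obtain ⟨C, hC⟩ : ∃ C : ℕ, |B| * (8 * 8 ^ (3 * D)) ≤ C := exists_nat_ge _
  refine ⟨maxSatProg P R p q D E C, p + q + E + C + 24 * D + 10 + κ * (4 * D + 2),
    ((200 * D + 155 + (8 * D + 2) * (8630 + P.fuelCost * (1 + 2 * C) + 400 * C + R) : ℕ) : ℝ),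
    3 * D + 4, by positivity, by omega, fun F w hw => ?_⟩
  have hw₁ : (p + q + E + C + 24 * D + 10) * F.bits ≤ w :=
    (Nat.mul_le_mul_right _ (Nat.le_add_right _ _)).trans hw
  have hw₂ : κ * (4 * D + 2) * F.bits ≤ w :=
    (Nat.mul_le_mul_right _ (Nat.le_add_left _ _)).trans hw
  have hfits := fits hq hpq₁ hpq₂ (by omega) hw₁
  obtain ⟨hp, hL⟩ := constants_lt hq hpq₁ hw₁
  have hgood := exists_succeeds hP hc hc1 hη hη1 hηε hq hpq₁ hr1.le hr2.le hE hD2 hDc hC hw₂ hfits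
  obtain ⟨α, hα⟩ := F.exists_max_numSat
  have hBm : F.numSat α ≤ F.m := List.countP_le_length
  obtain ⟨t, s, s', hex, ht, ag, k2, k10, kmax⟩ := Runs.seq
    (runs_parameterProg hq hE1 rfl rfl rfl rfl hfits hp hL)
    (fun s h => runs_candidatesProg hR hfits rfl hL hgood hα hBm h.1 h.2.1 h.2.2.1 h.2.2.2)
    (initial w F.input) (Agree.refl _)
  have h2 : s.reg 2 = s'.reg 2 := ag.reg 2 rfl
  have h10 : s.reg 10 = s'.reg 10 := ag.reg 10 rfl
  refine ⟨t, s, hex, h2.trans k2, ?_, ?_⟩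
  · have h : s'.reg 10 = F.numSat α := le_antisymm k10 (kmax α)
    rw [h10, h]
    exact ⟨⟨α, rfl⟩, by rintro _ ⟨b, rfl⟩; exact hα b⟩
  · refine le_trans ?_ (F.steps_le hq hpq₁ hx1 hE1 hfits.le_Q)
    exact_mod_cast ht

theorem polynomial_le {F : CNF} (a : ℕ) :
    ((F.m : ℝ) + F.n + 1) ^ a ≤ ((F.m : ℝ) + 1) ^ a * ((F.n : ℝ) + 1) ^ a := by
  rw [← mul_pow]
  have hm : (0 : ℝ) ≤ F.m := by positivity
  have hn : (0 : ℝ) ≤ F.n := by positivity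
  exact pow_le_pow_left₀ (by linarith) (by nlinarith) a

/-- Half of the saving `1 / E` is given up to absorb the polynomial in the number of variables. -/
theorem expo_mul_le (F : CNF) {E : ℕ} {C : ℝ} {a : ℕ}
    (hC : ∀ n : ℕ, ((n : ℝ) + 1) ^ a ≤ C * 2 ^ ((1 / (2 * E) : ℝ) * n)) :
    F.expo E * ((F.n : ℝ) + 1) ^ a ≤ C * 2 ^ ((1 - 1 / (2 * E) : ℝ) * F.n) := by
  have h1 : (2 : ℝ) ^ ((1 - 1 / (2 * E) : ℝ) * F.n) =
      F.expo E * 2 ^ ((1 / (2 * E) : ℝ) * F.n) := by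
    rw [CNF.expo, ← Real.rpow_add (by norm_num)]
    congr 1
    rw [one_div, one_div, mul_inv]
    ring
  rw [h1, mul_left_comm]
  exact mul_le_mul_of_nonneg_left (hC _) (Real.rpow_nonneg (by norm_num) _)

theorem maxCNFSatSolvable {ε c : ℝ} {E : ℕ} (hε : 0 < ε) (hc : 0 < c) (hc1 : c ≤ 1) (hE1 : 1 ≤ E)
    (hE : (1 / E : ℝ) ≤ min ε (1 / 2) / 2) (hs : KPMFSolvable ε c) :
    MaxCNFSatSolvable (1 / (2 * E)) := by
  obtain ⟨P, κ, C, a, hC0, hκ, hP⟩ := exists_maxSat hε hc hc1 hE1 hE hs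
  have hE0 : (0 : ℝ) < E := by exact_mod_cast hE1
  obtain ⟨C', hC'0, hC'⟩ := exists_pow_le_rpow (a + a) (r := 1 / (2 * E)) (by positivity)
  intro A
  refine ⟨.seq P (.seq (.const 11 0) (.store 1 11 10)), κ, (C * (A + 1) ^ a + 2) * C',
    fun F hF w hw => ?_⟩
  obtain ⟨t, s, hex, -, hmax, ht⟩ := hP F w hw
  refine ⟨_, _, .seq hex (.seq (.const _ _ _) (.store _ _ _ _)), ?_, ?_⟩
  · simpa [CNF.CorrectMax, State.setReg, State.setMem] using hmax
  -- With linearly many clauses the polynomial in both parameters becomes one of degree `a + a` in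
  -- the number of variables.
  · have h1 : (F.m : ℝ) + 1 ≤ (A + 1) * ((F.n : ℝ) + 1) := by
      have : (F.m : ℝ) ≤ A * F.n := by exact_mod_cast hF
      have hA : (0 : ℝ) ≤ A := by positivity
      have hn : (0 : ℝ) ≤ F.n := by positivity
      nlinarith
    have h2 : ((F.m : ℝ) + F.n + 1) ^ a ≤ (A + 1) ^ a * ((F.n : ℝ) + 1) ^ (a + a) := by
      refine (polynomial_le a).trans ?_
      rw [pow_add, ← mul_assoc, ← mul_pow (A + 1 : ℝ)]
      exact mul_le_mul_of_nonneg_right (pow_le_pow_left₀ (by positivity) h1 a) (by positivity)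
    have hZ := F.one_le_expo hE1
    have h3 : 1 ≤ F.expo E * ((F.n : ℝ) + 1) ^ (a + a) :=
      one_le_mul_of_one_le_of_one_le hZ (one_le_pow₀ (by
        have : (0 : ℝ) ≤ F.n := by positivity
        linarith))
    calc ((t + (1 + 1) : ℕ) : ℝ) = t + 2 := by push_cast; ring
      _ ≤ C * F.expo E * ((A + 1) ^ a * ((F.n : ℝ) + 1) ^ (a + a)) +
          2 * (F.expo E * ((F.n : ℝ) + 1) ^ (a + a)) := by
        have h4 := mul_le_mul_of_nonneg_left h2 (by positivity : 0 ≤ C * F.expo E)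
        linarith
      _ = (C * (A + 1) ^ a + 2) * (F.expo E * ((F.n : ℝ) + 1) ^ (a + a)) := by ring
      _ ≤ (C * (A + 1) ^ a + 2) * (C' * 2 ^ ((1 - 1 / (2 * E) : ℝ) * F.n)) :=
        mul_le_mul_of_nonneg_left (expo_mul_le F hC') (by positivity)
      _ = _ := (mul_assoc _ _ _).symm

/-- No assignment satisfies more than all clauses, so satisfiability means that the maximum equals
their number. -/
theorem satisfiable_iff {F : CNF} {b : ℕ} (hb : IsGreatest (Set.range F.numSat) b) :
    F.Satisfiable ↔ b = F.m := by
  have hle : ∀ a, F.numSat a ≤ F.m := fun a => List.countP_le_length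
  constructor
  · rintro ⟨a, ha⟩
    have h1 : F.numSat a = F.m := List.countP_eq_length.2 ha
    obtain ⟨a', h2⟩ := hb.1
    exact le_antisymm (h2 ▸ hle a') (h1 ▸ hb.2 ⟨a, rfl⟩)
  · rintro rfl
    obtain ⟨a, ha⟩ := hb.1
    exact ⟨a, List.countP_eq_length.1 ha⟩

/-- `exists_maxSat` holds for all formulas, without a bound on the number or width of clauses. The
power of `F.m + 1` is kept as the polynomial factor that the definition allows, so no sparsification
is needed, and the same saving works for all `k`. -/
theorem kSatSolvable {ε c : ℝ} {E : ℕ} (hε : 0 < ε) (hc : 0 < c) (hc1 : c ≤ 1) (hE1 : 1 ≤ E)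
    (hE : (1 / E : ℝ) ≤ min ε (1 / 2) / 2) (hs : KPMFSolvable ε c) (k : ℕ) :
    KSatSolvable k (1 / (2 * E)) := by
  obtain ⟨P, κ, C, a, hC0, hκ, hP⟩ := exists_maxSat hε hc hc1 hE1 hE hs
  have hE0 : (0 : ℝ) < E := by exact_mod_cast hE1
  obtain ⟨C', hC'0, hC'⟩ := exists_pow_le_rpow a (r := 1 / (2 * E)) (by positivity)
  refine ⟨a, .seq P (.seq (.op .eq 10 10 2) (.seq (.const 11 0) (.store 1 11 10))), κ,
    (C + 3) * C', fun F _ w hw => ?_⟩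
  obtain ⟨t, s, hex, h2, hmax, ht⟩ := hP F w hw
  refine ⟨_, _, .seq hex (.seq (.op _ _ _ _ _) (.seq (.const _ _ _) (.store _ _ _ _))), ?_, ?_⟩
  · have hw1 : 1 < 2 ^ w := by
      refine Nat.one_lt_two_pow (Nat.ne_of_gt (lt_of_lt_of_le (Nat.mul_pos hκ ?_) hw))
      rw [CNF.bits]
      omega
    have h3 := satisfiable_iff hmax
    by_cases h : s.reg 10 = F.m
    · simp [CNF.CorrectSat, State.setReg, State.setMem, Op.eval, h2, h, h3, Nat.mod_eq_of_lt hw1]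
    · simp [CNF.CorrectSat, State.setReg, State.setMem, Op.eval, h2, h, h3]
  · have hZ := F.one_le_expo hE1
    have hm1 : (1 : ℝ) ≤ (F.m : ℝ) + 1 := by
      have : (0 : ℝ) ≤ F.m := by positivity
      linarith
    have hn1 : (1 : ℝ) ≤ (F.n : ℝ) + 1 := by
      have : (0 : ℝ) ≤ F.n := by positivity
      linarith
    have h3 : 1 ≤ F.expo E * (((F.m : ℝ) + 1) ^ a * ((F.n : ℝ) + 1) ^ a) :=
      one_le_mul_of_one_le_of_one_le hZ
        (one_le_mul_of_one_le_of_one_le (one_le_pow₀ hm1) (one_le_pow₀ hn1))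
    calc ((t + (1 + (1 + 1)) : ℕ) : ℝ) = t + 3 := by push_cast; ring
      _ ≤ C * F.expo E * (((F.m : ℝ) + 1) ^ a * ((F.n : ℝ) + 1) ^ a) +
          3 * (F.expo E * (((F.m : ℝ) + 1) ^ a * ((F.n : ℝ) + 1) ^ a)) := by
        have h4 := mul_le_mul_of_nonneg_left (polynomial_le (F := F) a)
          (by positivity : 0 ≤ C * F.expo E)
        linarith
      _ = (C + 3) * ((F.m : ℝ) + 1) ^ a * (F.expo E * ((F.n : ℝ) + 1) ^ a) := by ring
      _ ≤ (C + 3) * ((F.m : ℝ) + 1) ^ a * (C' * 2 ^ ((1 - 1 / (2 * E) : ℝ) * F.n)) :=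
        mul_le_mul_of_nonneg_left (expo_mul_le F hC') (by positivity)
      _ = _ := by ring

end WordRAM

theorem theorem7 (ε : ℝ) (hε : 0 < ε) :
    ∃ δ : ℝ, 0 < δ ∧ ∀ c : ℝ, 0 ≤ c → c ≤ 1 → KPMFSolvable ε c →
      MaxCNFSatSolvable δ ∧ ¬ SETH := by
  have hη : 0 < min ε (1 / 2) / 2 := half_pos (lt_min hε (by norm_num))
  -- With `E = n + 1` the saving depends on `ε` only; all the constants that depend on `c` go into
  -- the polynomial and the word length.
  obtain ⟨n, hn⟩ := exists_nat_one_div_lt hη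
  have hδ : (0 : ℝ) < 1 / (2 * (n + 1 : ℕ)) := by positivity
  refine ⟨1 / (2 * (n + 1 : ℕ)), hδ, fun c hc hc1 hs => ?_⟩
  rcases hc.eq_or_lt with rfl | hc
  · exact absurd hs (not_kPMFSolvable_zero hε)
  · have hE : (1 / (n + 1 : ℕ) : ℝ) ≤ min ε (1 / 2) / 2 := by
      push_cast
      exact hn.le
    refine ⟨WordRAM.maxCNFSatSolvable hε hc hc1 (by omega) hE hs, fun hseth => ?_⟩
    obtain ⟨k, -, hk⟩ := hseth _ hδ
    exact hk (WordRAM.kSatSolvable hε hc hc1 (by omega) hE hs k)
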